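/- For integers $1\le r\le n$ let $X_1,\dots,X_{r+1}$ be independent random points in $\mathbb{R}^n$, identically distributed according to one of the following models: (G) the Gaussian model: the standard normal distribution on $\mathbb{R}^n$, with density $(2\pi)^{-n/2}e^{-|x|^2/2}$; (B) the Beta model with a fixed parameter $\nu>0$ (not depending on $n$): the distribution with density $\pi^{-n/2}\,\dfrac{\Gamma(\frac{n+\nu}{2})}{\Gamma(\frac{\nu}{2})}\,(1-|x|^2)^{(\nu-2)/2}$ on $\{|x|<1\}$; (S) the spherical model: the uniform distribution on the unit sphere centred at the origin of $\mathbb{R}^n$. Let $\mathcal V_{n,r}$ be the $r$-dimensional volume of the simplex with vertices $X_1,\dots,X_{r+1}$, and let $Z$ be a standard normal random variable. Fix one of the models. 1. There are real numbers $a_{n,r}$ and $b_{n,r}>0$, depending only on $n$, $r$ and the model, such that for every integer sequence $r=r(n)$ with $1\le r(n)\le n$ and $r=o(n)$, $$\frac{\mathcal V_{n,r}-a_{n,r}}{b_{n,r}}\ \xrightarrow[n\to\infty]{d}\ Z .$$ 2. There are real numbers $b_{n,r}>0$, depending only on $n$, $r$ and the model, such that for every $\alpha\in(0,1)$ and every integer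 sequence $r=r(n)$ with $1\le r(n)\le n$ and $r\sim\alpha n$, $$\frac{\mathcal V_{n,r}}{b_{n,r}}\ \xrightarrow[n\to\infty]{d}\ e^{\sigma Z},$$ where $\sigma=\sqrt{\tfrac12\log\tfrac1{1-\alpha}}$ in the Gaussian model and $\sigma=\sqrt{\tfrac12\log\tfrac1{1-\alpha}-\tfrac\alpha2}$ in the Beta and spherical models. -/

import Mathlib

open MeasureTheory ProbabilityTheory Filter Asymptotics
open scoped Topology ENNReal

/-- The density of the Beta distribution with parameter `ν` on `ℝⁿ`. -/
noncomputable def betaDensity (ν : ℝ) (n : ℕ) (x : EuclideanSpace ℝ (Fin n)) : ℝ :=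
  if ‖x‖ < 1 then
    1 / Real.pi ^ ((n : ℝ) / 2) * (Real.Gamma ((n + ν) / 2) / Real.Gamma (ν / 2)) *
      (1 - ‖x‖ ^ 2) ^ ((ν - 2) / 2)
  else 0

/-- The uniform distribution on the unit sphere of `ℝⁿ` (for `n ≥ 1`): the normalized surface
measure, regarded as a measure on `ℝⁿ`. -/
noncomputable def sphereUniform (n : ℕ) : Measure (EuclideanSpace ℝ (Fin n)) :=
  (cond (volume : Measure (EuclideanSpace ℝ (Fin n))).toSphere Set.univ).map Subtype.val

/-- The three models for the vertices: Gaussian, Beta with a fixed parameter `ν > 0`, and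
spherical. -/
inductive VertexModel where
  | gaussian : VertexModel
  | beta (ν : ℝ) (hν : 0 < ν) : VertexModel
  | spherical : VertexModel

namespace VertexModel

/-- The distribution of a single vertex in `ℝⁿ`. -/
noncomputable def law (m : VertexModel) (n : ℕ) : Measure (EuclideanSpace ℝ (Fin n)) :=
  match m with
  | gaussian => stdGaussian (EuclideanSpace ℝ (Fin n))
  | beta ν _ => volume.withDensity fun x => ENNReal.ofReal (betaDensity ν n x)
  | spherical => sphereUniform n

/-- The variance of the logarithm of the log-normal limit. -/
noncomputable def limitVariance (m : VertexModel) (α : ℝ) : ℝ :=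
  match m with
  | gaussian => 1 / 2 * Real.log (1 / (1 - α))
  | beta _ _ => 1 / 2 * Real.log (1 / (1 - α)) - α / 2
  | spherical => 1 / 2 * Real.log (1 / (1 - α)) - α / 2

end VertexModel

/-- The `r`-dimensional volume of the simplex (convex hull) with the `r + 1` vertices `x i`.
`μHE[r]` is the `r`-dimensional Hausdorff measure, normalized so that it is Lebesgue measure on
`r`-dimensional Euclidean subspaces. -/
noncomputable def simplexVolume {n r : ℕ} (x : Fin (r + 1) → EuclideanSpace ℝ (Fin n)) : ℝ :=
  (μHE[r] : Measure (EuclideanSpace ℝ (Fin n))).real (convexHull ℝ (Set.range x))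

/-- For each dimension `n ≥ 1`, the points `X n 0, …, X n (r n)` are independent random points
in `ℝⁿ`, each distributed according to the model `m`. Nothing is required in dimension `0`. -/
structure IsVertexArray (m : VertexModel) (r : ℕ → ℕ) {Ω : ℕ → Type*}
    [∀ n, MeasurableSpace (Ω n)] (P : ∀ n, Measure (Ω n))
    (X : ∀ n, Fin (r n + 1) → Ω n → EuclideanSpace ℝ (Fin n)) : Prop where
  hasLaw : ∀ n, 1 ≤ n → ∀ i, HasLaw (X n i) (m.law n) (P n)
  indep : ∀ n, 1 ≤ n → iIndepFun (X n) (P n)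

/-!
The proof computes the moments of the volume of the random simplex explicitly and derives a central
limit theorem for its logarithm.

*Moments.* The volume is the square root of a Gram determinant `S` times a constant
(`simplexVolume_eq`). When a vertex is added, `S` and the distance `h` from the origin to the affine
hull of the vertices change through two coordinates of the new vertex only (`gramVolume_cons`,
`affineHeight_cons`), whose joint law is known by rotation invariance (`lintegral_component_dist`).
The change of variables `lintegral_point_pair` in the plane shows that the law of `h`, tilted by
`S ^ k`, stays in a one-parameter family: Gaussian weights with growing precision, or Beta weights
with growing exponent. Each vertex therefore multiplies `E S ^ k` by an explicit quotient of Gamma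
functions (`WeightFamily.lintegral_gramVolume_succ`, `lintegral_gramVolume_gaussian`,
`lintegral_gramVolume_beta`). The spherical model is the limit `ν → 0` of Beta models, and its
moments are the limits of theirs (`lintegral_gramVolume_sphere`).

*Central limit theorem.* The expansion of `log Γ` to second order with a cubic remainder
(`log_Gamma_expansion`) gives `log E S ^ k = k μ + k² v / 2 + O(k³ v / n)`, with `v` at least of
order `1 / n`, so that the error vanishes for `k = t / √v`. In the Beta and spherical models `v` is
so small that cancellations between the remainders have to be used. Hence
`E exp (t (log S - μ) / √v)` tends to `exp (t² / 2)` for every `t > 0`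
(`VertexModel.tendsto_log_moment`). This is sufficient for convergence in law to a standard normal
variable (`tendsto_gaussianReal_of_tendsto_exp`), because the exponential moments of positive order
give tightness and determine the limit by analytic continuation. Moments of negative order are not
needed.

*Conclusion.* The volume is `c exp (s Y)`, where `Y = (log S - μ) / √v` and `s = √v / 2` tends to
the root of the limit variance (`VertexModel.tendsto_logVar`). If `r ∼ α n`, the volume divided by `c`
converges to the log-normal law. If `r = o(n)`, then `s → 0`, and `(exp (s Y) - 1) / s` has the same
limit as `Y`. Both are instances of `VertexModel.tendstoInDistribution_of_logScore`.
-/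

/-! ### Gram determinants and the volume of a simplex -/

section Gram

variable {E : Type*} [NormedAddCommGroup E] [InnerProductSpace ℝ E] [FiniteDimensional ℝ E]

omit [FiniteDimensional ℝ E] in
lemma det_gram_comp_equiv {ι κ : Type*} [Fintype ι] [DecidableEq ι] [Fintype κ] [DecidableEq κ]
    (v : ι → E) (σ : κ ≃ ι) :
    (Matrix.gram ℝ (v ∘ σ)).det = (Matrix.gram ℝ v).det := by
  have h : Matrix.gram ℝ (v ∘ σ) = (Matrix.gram ℝ v).submatrix σ σ := rfl
  rw [h, Matrix.det_submatrix_equiv_self]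

/-- A new vector multiplies the Gram determinant by the square of its distance to the span of the
others. -/
lemma det_gram_cons {k : ℕ} (w : E) (v : Fin k → E) :
    (Matrix.gram ℝ (Fin.cons w v : Fin (k + 1) → E)).det =
      (Matrix.gram ℝ v).det *
        ‖w - (Submodule.span ℝ (Set.range v)).starProjection w‖ ^ 2 := by
  set U := Submodule.span ℝ (Set.range v) with hU
  set p := U.starProjection w with hp
  have hpU : p ∈ U := Submodule.starProjection_apply_mem U w
  obtain ⟨c, hc⟩ := (Submodule.mem_span_range_iff_exists_fun ℝ).1 hpU
  set A := Matrix.gram ℝ (Fin.cons w v : Fin (k + 1) → E) with hA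
  have hperp : ∀ z ∈ U, inner ℝ (w - p) z = 0 := fun z hz =>
    Submodule.starProjection_inner_eq_zero w z hz
  have hrow : A = A.updateRow 0 ((fun j => inner ℝ (w - p) ((Fin.cons w v : Fin (k + 1) → E) j)) +
      ∑ i, (Fin.cons 0 c : Fin (k + 1) → ℝ) i • A i) := by
    ext i j
    refine Fin.cases ?_ (fun i => ?_) i
    · rw [Matrix.updateRow_self]
      simp only [Fin.sum_univ_succ, Pi.add_apply, Finset.sum_apply, Pi.smul_apply, hA,
        Matrix.gram_apply, Fin.cons_zero, Fin.cons_succ, zero_smul, zero_add,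
        smul_eq_mul, inner_sub_left]
      rw [← hc, sum_inner]
      simp [inner_smul_left]
    · rw [Matrix.updateRow_ne (Fin.succ_ne_zero i)]
  have hnorm : inner ℝ (w - p) w = ‖w - p‖ ^ 2 := by
    rw [← real_inner_self_eq_norm_sq, inner_sub_right (w - p) w p, hperp p hpU, sub_zero]
  rw [hrow, Matrix.det_updateRow_add, Matrix.det_updateRow_sum, Fin.cons_zero, zero_smul, add_zero,
    Matrix.det_succ_row_zero, Fin.sum_univ_succ]
  have hz : ∀ i : Fin k, inner ℝ (w - p) (v i) = 0 := fun i =>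
    hperp _ (Submodule.subset_span ⟨i, rfl⟩)
  have hsub : (A.updateRow 0 (fun j => inner ℝ (w - p)
      ((Fin.cons w v : Fin (k + 1) → E) j))).submatrix Fin.succ Fin.succ =
      Matrix.gram ℝ v := by
    ext i j
    simp [hA]
  simp [hz, hsub, hnorm, mul_comm]

/-- The edge vectors of a simplex at its last vertex. -/
def edgeVectors {m : ℕ} (x : Fin (m + 1) → E) (i : Fin m) : E := x i.castSucc - x (Fin.last m)

/-- The square of `m!` times the `m`-dimensional volume of the simplex with the `m + 1` vertices
`x i`: the Gram determinant of its edge vectors. -/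
noncomputable def gramVolume {m : ℕ} (x : Fin (m + 1) → E) : ℝ :=
  (Matrix.gram ℝ (edgeVectors x)).det

/-- The last vertex followed by the edge vectors: a linear frame with the same span as the
vertices. -/
def vertexFrame {m : ℕ} (x : Fin (m + 1) → E) : Fin (m + 1) → E :=
  Fin.cons (x (Fin.last m)) (edgeVectors x)

/-- The distance from the origin to the affine hull of the vertices `x i`, as a quotient of two
Gram determinants; it is `0` if the vertices are affinely dependent. -/
noncomputable def affineHeight {m : ℕ} (x : Fin (m + 1) → E) : ℝ :=
  √((Matrix.gram ℝ (vertexFrame x)).det / gramVolume x)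

omit [FiniteDimensional ℝ E] in
lemma gramVolume_nonneg {m : ℕ} (x : Fin (m + 1) → E) : 0 ≤ gramVolume x :=
  (Matrix.posSemidef_gram ℝ _).det_nonneg

omit [InnerProductSpace ℝ E] [FiniteDimensional ℝ E] in
lemma edgeVectors_cons {m : ℕ} (w : E) (x : Fin (m + 1) → E) :
    edgeVectors (Fin.cons w x : Fin (m + 2) → E) =
      Fin.cons (w - x (Fin.last m)) (edgeVectors x) := by
  funext i
  refine Fin.cases ?_ (fun i => ?_) i
  · simp [edgeVectors, ← Fin.succ_last]
  · simp only [edgeVectors, ← Fin.succ_last, Fin.cons_succ, ← Fin.succ_castSucc]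

/-- The foot of the perpendicular from the origin to the affine hull. -/
noncomputable def affineFoot {m : ℕ} (x : Fin (m + 1) → E) : E :=
  x (Fin.last m) - (Submodule.span ℝ (Set.range (edgeVectors x))).starProjection (x (Fin.last m))

/-- The linear span of the vertices. -/
def vertexSpan {m : ℕ} (x : Fin (m + 1) → E) : Submodule ℝ E :=
  Submodule.span ℝ (Set.range (vertexFrame x))

lemma det_gram_vertexFrame {m : ℕ} (x : Fin (m + 1) → E) :
    (Matrix.gram ℝ (vertexFrame x)).det = gramVolume x * ‖affineFoot x‖ ^ 2 :=
  det_gram_cons _ _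

lemma affineHeight_eq_norm_foot {m : ℕ} {x : Fin (m + 1) → E} (hx : gramVolume x ≠ 0) :
    affineHeight x = ‖affineFoot x‖ := by
  rw [affineHeight, det_gram_vertexFrame, mul_div_cancel_left₀ _ hx, Real.sqrt_sq (norm_nonneg _)]

omit [InnerProductSpace ℝ E] [FiniteDimensional ℝ E] in
lemma vertexFrame_cons {m : ℕ} (w : E) (x : Fin (m + 1) → E) :
    vertexFrame (Fin.cons w x : Fin (m + 2) → E) =
    (Fin.cons (w - x (Fin.last m)) (vertexFrame x) : Fin (m + 2) → E) ∘ (Equiv.swap 0 1) := by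
  funext i
  refine Fin.cases ?_ (fun i => Fin.cases ?_ (fun i => ?_) i) i
  · simp only [vertexFrame, Function.comp, Equiv.swap_apply_left, Fin.cons_zero]
    rw [← Fin.succ_last, Fin.cons_succ]
    rfl
  · simp [vertexFrame, edgeVectors_cons]
  · rw [Function.comp, Equiv.swap_apply_of_ne_of_ne (Fin.succ_ne_zero _)]
    · simp [vertexFrame, edgeVectors_cons]
    · intro h
      exact Fin.succ_ne_zero i (Fin.succ_injective _ (h.trans (by rfl)))

lemma det_gram_vertexFrame_cons {m : ℕ} (w : E) (x : Fin (m + 1) → E) :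
    (Matrix.gram ℝ (vertexFrame (Fin.cons w x : Fin (m + 2) → E))).det =
      (Matrix.gram ℝ (vertexFrame x)).det * ‖w - (vertexSpan x).starProjection w‖ ^ 2 := by
  have hmem : x (Fin.last m) ∈ vertexSpan x :=
    Submodule.subset_span ⟨0, by simp [vertexFrame]⟩
  rw [vertexFrame_cons, det_gram_comp_equiv, det_gram_cons]
  change _ * ‖w - _ - (vertexSpan x).starProjection _‖ ^ 2 = _
  rw [map_sub, Submodule.starProjection_eq_self_iff.2 hmem]
  congr 3
  abel

lemma affineFoot_mem_vertexSpan {m : ℕ} (x : Fin (m + 1) → E) : affineFoot x ∈ vertexSpan x := by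
  rw [vertexSpan, vertexFrame, Fin.range_cons, Submodule.span_insert]
  exact Submodule.sub_mem _ (Submodule.mem_sup_left (Submodule.mem_span_singleton_self _))
    (Submodule.mem_sup_right (Submodule.starProjection_apply_mem _ _))

/-- The orthogonal projection onto the span of the vertices splits into the projection onto the
direction of the affine hull and the one onto the line through the foot. -/
lemma starProjection_vertexSpan {m : ℕ} {x : Fin (m + 1) → E} (hx : affineFoot x ≠ 0) (w : E) :
    (vertexSpan x).starProjection w =
      (Submodule.span ℝ (Set.range (edgeVectors x))).starProjection w +
        inner ℝ ((‖affineFoot x‖)⁻¹ • affineFoot x) w • ((‖affineFoot x‖)⁻¹ • affineFoot x) := by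
  set V := Submodule.span ℝ (Set.range (edgeVectors x)) with hV
  set l := x (Fin.last m)
  set a := affineFoot x with ha
  have hspan : vertexSpan x = Submodule.span ℝ {l} ⊔ V := by
    rw [vertexSpan, vertexFrame, Fin.range_cons, Submodule.span_insert]
  have hal : a = l - V.starProjection l := rfl
  have haU : a ∈ vertexSpan x := affineFoot_mem_vertexSpan x
  have haV : ∀ z ∈ V, inner ℝ a z = 0 := fun z hz => Submodule.starProjection_inner_eq_zero l z hz
  have hwV : ∀ z ∈ V, inner ℝ (w - V.starProjection w) z = 0 := fun z hz =>
    Submodule.starProjection_inner_eq_zero w z hz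
  have hn : ‖a‖ ≠ 0 := norm_ne_zero_iff.2 hx
  have key : ∀ z, inner ℝ (w - (V.starProjection w + inner ℝ (‖a‖⁻¹ • a) w • (‖a‖⁻¹ • a))) z =
      inner ℝ (w - V.starProjection w) z - ‖a‖⁻¹ ^ 2 * inner ℝ a w * inner ℝ a z := by
    intro z
    simp only [inner_sub_left, inner_add_left, real_inner_smul_left]
    ring
  refine (Submodule.eq_starProjection_of_mem_of_inner_eq_zero (K := vertexSpan x) ?_ ?_)
  · refine Submodule.add_mem _ ?_ (Submodule.smul_mem _ _ (Submodule.smul_mem _ _ haU))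
    rw [hspan]
    exact Submodule.mem_sup_right (Submodule.starProjection_apply_mem V w)
  · intro z hz
    rw [hspan] at hz
    obtain ⟨z1, hz1, z2, hz2, rfl⟩ := Submodule.mem_sup.1 hz
    obtain ⟨c, rfl⟩ := Submodule.mem_span_singleton.1 hz1
    have hl : l = a + V.starProjection l := by rw [hal]; abel
    have hPl : V.starProjection l ∈ V := Submodule.starProjection_apply_mem V l
    have hPw : V.starProjection w ∈ V := Submodule.starProjection_apply_mem V w
    rw [key, inner_add_right, inner_add_right, hwV z2 hz2, haV z2 hz2, real_inner_smul_right,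
      real_inner_smul_right, hl, inner_add_right, inner_add_right, haV _ hPl, hwV _ hPl,
      real_inner_self_eq_norm_sq, inner_sub_left, real_inner_comm a w,
      real_inner_comm a (V.starProjection w), haV _ hPw]
    field_simp
    ring

/-- The effect of a new vertex `w` on the squared volume. Project orthogonally to the plane spanned
by the foot `a` of the perpendicular and by the component of `w` orthogonal to the span of the old
vertices. The affine hull of the old vertices becomes the point `a`, and the factor is the squared
distance of the image of `w` to this point. -/
lemma gramVolume_cons {m : ℕ} {x : Fin (m + 1) → E} (hx : affineFoot x ≠ 0) (w : E) :
    gramVolume (Fin.cons w x : Fin (m + 2) → E) = gramVolume x *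
      (‖w - (vertexSpan x).starProjection w‖ ^ 2 +
        (inner ℝ ((‖affineFoot x‖)⁻¹ • affineFoot x) w - ‖affineFoot x‖) ^ 2) := by
  have h1 : gramVolume (Fin.cons w x : Fin (m + 2) → E) =
      (Matrix.gram ℝ (Fin.cons (w - x (Fin.last m)) (edgeVectors x) : Fin (m + 1) → E)).det := by
    rw [gramVolume, edgeVectors_cons]
  rw [h1, det_gram_cons, ← gramVolume]
  congr 1
  set V := Submodule.span ℝ (Set.range (edgeVectors x)) with hV
  set l := x (Fin.last m)
  have hP := starProjection_vertexSpan hx w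
  set a := affineFoot x with ha
  set e := ‖a‖⁻¹ • a with he
  have hn : ‖a‖ ≠ 0 := norm_ne_zero_iff.2 hx
  have hen : ‖e‖ = 1 := by rw [he, norm_smul, norm_inv, norm_norm, inv_mul_cancel₀ hn]
  have hae : a = ‖a‖ • e := by rw [he, smul_smul, mul_inv_cancel₀ hn, one_smul]
  have heU : e ∈ vertexSpan x := Submodule.smul_mem _ _ (affineFoot_mem_vertexSpan x)
  have hdec : w - l - V.starProjection (w - l) =
      (w - (vertexSpan x).starProjection w) + (inner ℝ e w - ‖a‖) • e := by
    rw [hP, map_sub, sub_smul, ← hae]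
    have : a = l - V.starProjection l := rfl
    rw [this]
    abel
  rw [hdec, norm_add_sq_real, real_inner_smul_right,
    Submodule.starProjection_inner_eq_zero w e heU, norm_smul, hen]
  simp

/-- The effect of a new vertex `w` on the height. In the plane of `gramVolume_cons`, the new height
is the distance from the origin to the line through the foot and the image of `w`. The pair of
squared volume and height therefore evolves through two coordinates of the new vertex only. -/
lemma affineHeight_cons {m : ℕ} {x : Fin (m + 1) → E} (hx : gramVolume x ≠ 0)
    (hh : affineHeight x ≠ 0) (w : E) :
    affineHeight (Fin.cons w x : Fin (m + 2) → E) =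
      affineHeight x * ‖w - (vertexSpan x).starProjection w‖ /
      √(‖w - (vertexSpan x).starProjection w‖ ^ 2 +
        (inner ℝ ((‖affineFoot x‖)⁻¹ • affineFoot x) w - affineHeight x) ^ 2) := by
  have h1 := affineHeight_eq_norm_foot hx
  have h2 : affineFoot x ≠ 0 := fun h => hh (by rw [h1, h, norm_zero])
  rw [h1, affineHeight, det_gram_vertexFrame_cons, gramVolume_cons h2, det_gram_vertexFrame,
    mul_assoc, mul_div_mul_left _ _ hx, Real.sqrt_div (by positivity), ← mul_pow,
    Real.sqrt_sq (by positivity)]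

omit [FiniteDimensional ℝ E] in
lemma continuous_gramVolume {m : ℕ} :
    Continuous (gramVolume : (Fin (m + 1) → E) → ℝ) := by
  refine Continuous.matrix_det (continuous_matrix fun i j => ?_)
  simp only [Matrix.gram_apply, edgeVectors]
  fun_prop

lemma gramVolume_ne_zero_of_linearIndependent {m : ℕ} {x : Fin (m + 1) → E}
    (hx : LinearIndependent ℝ (vertexFrame x)) : gramVolume x ≠ 0 ∧ affineHeight x ≠ 0 := by
  have h := Matrix.det_gram_ne_zero_iff_linearIndependent.2 hx
  have h' := h
  rw [det_gram_vertexFrame] at h'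
  have hS := left_ne_zero_of_mul h'
  refine ⟨hS, ?_⟩
  rw [affineHeight_eq_norm_foot hS]
  exact fun h0 => h' (by rw [h0]; simp)

omit [FiniteDimensional ℝ E] in
lemma linearIndependent_vertexFrame_cons {m : ℕ} {x : Fin (m + 1) → E} {w : E}
    (hx : LinearIndependent ℝ (vertexFrame x)) (hw : w ∉ vertexSpan x) :
    LinearIndependent ℝ (vertexFrame (Fin.cons w x : Fin (m + 2) → E)) := by
  have hmem : x (Fin.last m) ∈ vertexSpan x :=
    Submodule.subset_span ⟨0, by simp [vertexFrame]⟩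
  have h0 : LinearIndependent ℝ
      (Fin.cons (w - x (Fin.last m)) (vertexFrame x) : Fin (m + 2) → E) :=
    linearIndependent_finCons.2 ⟨hx, fun h => hw (by
      have := Submodule.add_mem (vertexSpan x) h hmem
      simpa using this)⟩
  rw [vertexFrame_cons]
  exact h0.comp _ (Equiv.injective _)

end Gram

/-- The vertices of the standard corner simplex in `ℝʳ`: the standard basis and the origin. -/
noncomputable def cornerVertices (r : ℕ) : Fin (r + 1) → EuclideanSpace ℝ (Fin r) :=
  Fin.snoc (fun i => EuclideanSpace.basisFun (Fin r) ℝ i) 0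

/-- The volume of the standard corner simplex in `ℝʳ`. -/
noncomputable def cornerVolume (r : ℕ) : ℝ :=
  (volume : Measure (EuclideanSpace ℝ (Fin r))).real (convexHull ℝ (Set.range (cornerVertices r)))

lemma cornerVolume_pos (r : ℕ) : 0 < cornerVolume r := by
  have hfin : (Set.range (cornerVertices r)).Finite := Set.finite_range _
  have hbdd : Bornology.IsBounded (convexHull ℝ (Set.range (cornerVertices r))) :=
    isBounded_convexHull.2 hfin.isBounded
  rw [cornerVolume, Measure.real, ENNReal.toReal_pos_iff]
  refine ⟨?_, hbdd.measure_lt_top⟩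
  have h0 : (0 : EuclideanSpace ℝ (Fin r)) ∈ Set.range (cornerVertices r) :=
    ⟨Fin.last r, by simp [cornerVertices]⟩
  have hspan : affineSpan ℝ (Set.range (cornerVertices r)) = ⊤ := by
    rw [← Set.insert_eq_of_mem h0]
    refine SetLike.coe_injective ?_
    rw [affineSpan_insert_zero]
    have : Submodule.span ℝ (Set.range (cornerVertices r)) = ⊤ := by
      rw [eq_top_iff, ← (EuclideanSpace.basisFun (Fin r) ℝ).toBasis.span_eq]
      refine Submodule.span_mono ?_
      rintro _ ⟨i, rfl⟩
      exact ⟨i.castSucc, by simp [cornerVertices]⟩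
    rw [this]
    rfl
  have hint := interior_convexHull_nonempty_iff_affineSpan_eq_top.2 hspan
  exact (isOpen_interior.measure_pos _ hint).trans_le (measure_mono interior_subset)

open scoped Pointwise in
/-- The volume of a simplex is the square root of its Gram determinant, up to a constant that
depends only on its dimension. -/
lemma simplexVolume_eq {n r : ℕ} (x : Fin (r + 1) → EuclideanSpace ℝ (Fin n)) :
    simplexVolume x = √(gramVolume x) * cornerVolume r := by
  let b := EuclideanSpace.basisFun (Fin r) ℝ
  let f : EuclideanSpace ℝ (Fin r) →ₗ[ℝ] EuclideanSpace ℝ (Fin n) :=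
    b.toBasis.constr ℝ (edgeVectors x)
  have hf : ∀ i, f (b i) = edgeVectors x i := fun i => by
    have := b.toBasis.constr_basis ℝ (edgeVectors x) i
    rwa [OrthonormalBasis.coe_toBasis] at this
  have hdet : f.normDet = √(gramVolume x) := by
    have := f.normDet_sq_eq_det_gram b
    simp only [hf, RCLike.ofReal_real_eq_id, id] at this
    rw [gramVolume, ← this, Real.sqrt_sq f.normDet_nonneg]
  have hset : convexHull ℝ (Set.range x) =
      x (Fin.last r) +ᵥ (f '' convexHull ℝ (Set.range (cornerVertices r))) := by
    rw [f.image_convexHull, ← Set.range_comp, ← convexHull_vadd]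
    congr 1
    rw [← Set.image_vadd, ← Set.range_comp]
    congr 1
    funext i
    refine Fin.lastCases ?_ (fun i => ?_) i
    · simp [cornerVertices]
    · have := hf i
      simp only [Function.comp, cornerVertices, Fin.snoc_castSucc, vadd_eq_add]
      rw [this, edgeVectors]
      abel
  have hvol := f.euclideanHausdorffMeasure_image_eq_normDet_mul_volume
    (convexHull ℝ (Set.range (cornerVertices r)))
  rw [finrank_euclideanSpace_fin] at hvol
  rw [simplexVolume, hset, Measure.real, measure_vadd, hvol, ENNReal.toReal_mul, hdet,
    ENNReal.toReal_ofReal (Real.sqrt_nonneg _)]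
  rfl

/-! ### Change of variables for a point and a foot of a perpendicular -/

lemma lintegral_comp_abs {f : ℝ → ℝ≥0∞} :
    ∫⁻ x, f |x| = 2 * ∫⁻ x in Set.Ioi (0 : ℝ), f x := by
  have hpos : ∫⁻ x in Set.Ioi (0 : ℝ), f |x| = ∫⁻ x in Set.Ioi (0 : ℝ), f x :=
    setLIntegral_congr_fun measurableSet_Ioi fun x hx => by rw [abs_of_pos hx]
  have hneg : ∫⁻ x in Set.Iic (0 : ℝ), f |x| = ∫⁻ x in Set.Ioi (0 : ℝ), f x := by
    rw [← hpos, setLIntegral_congr Iio_ae_eq_Iic.symm]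
    have h := (Measure.measurePreserving_neg (volume : Measure ℝ)).setLIntegral_comp_preimage_emb
      (MeasurableEquiv.neg ℝ).measurableEmbedding (fun x => f |x|) (Set.Iio 0)
    rw [← h]
    simp
  rw [← lintegral_add_compl _ (measurableSet_Iic (a := (0 : ℝ))), Set.compl_Iic, hneg, hpos,
    two_mul]

lemma lintegral_comp_mul_left_real {a : ℝ} (ha : 0 < a) (f : ℝ → ℝ≥0∞) :
    ∫⁻ x, f x = ENNReal.ofReal a * ∫⁻ x, f (a * x) := by
  have h := Real.smul_map_volume_mul_left ha.ne'
  conv_lhs => rw [← h]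
  rw [lintegral_smul_measure, (Homeomorph.mulLeft₀ a ha.ne').measurableEmbedding.lintegral_map
    |> fun h => (show ∫⁻ y, f y ∂(Measure.map (fun x => a * x) volume) = ∫⁻ x, f (a * x) from h f),
    abs_of_pos ha, smul_eq_mul]

lemma setLIntegral_Ioi_comp_mul_left {a : ℝ} (ha : 0 < a) (f : ℝ → ℝ≥0∞) :
    ∫⁻ x in Set.Ioi 0, f x = ENNReal.ofReal a * ∫⁻ x in Set.Ioi 0, f (a * x) := by
  rw [← lintegral_indicator measurableSet_Ioi, ← lintegral_indicator measurableSet_Ioi,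
    lintegral_comp_mul_left_real ha]
  congr 2
  funext x
  simp [Set.indicator, mul_pos_iff_of_pos_left ha]

lemma lintegral_polar {f : ℝ × ℝ → ℝ≥0∞} (hf : Measurable f) :
    ∫⁻ z, f z = ∫⁻ r in Set.Ioi (0 : ℝ), ∫⁻ θ in Set.Ioo (-Real.pi) Real.pi,
      ENNReal.ofReal r * f (r * Real.cos θ, r * Real.sin θ) := by
  rw [← lintegral_comp_polarCoord_symm, polarCoord_target, Measure.volume_eq_prod,
    ← Measure.prod_restrict, lintegral_prod _ (Measurable.aemeasurable ?_)]
  · rfl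
  · simp only [polarCoord_symm_apply, smul_eq_mul]
    fun_prop

/-- Let `A = (h, 0)` and let `X = z` be a second point of the plane, at distance `ρ` from `A`. The
line `AX` has distance `|q| = h |z.2| / ρ` from the origin, and `A` and `X` have coordinates `s` and
`s + ρ` along it. The formula changes the variables `(h, z)` to `(ρ, s, q)`; it consists of
polar coordinates around `A`, followed by the inverse of polar coordinates around the origin. -/
lemma lintegral_point_pair (N : ℝ) {Φ : ℝ × ℝ × ℝ × ℝ → ℝ≥0∞} (hΦ : Measurable Φ) :
    ∫⁻ h in Set.Ioi (0 : ℝ), ∫⁻ z : ℝ × ℝ, ENNReal.ofReal (h ^ N * |z.2| ^ (N - 1)) *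
      Φ (h ^ 2, z.1 ^ 2 + z.2 ^ 2, √(z.2 ^ 2 + (z.1 - h) ^ 2),
        h * |z.2| / √(z.2 ^ 2 + (z.1 - h) ^ 2)) =
    ∫⁻ ρ in Set.Ioi (0 : ℝ), ∫⁻ z : ℝ × ℝ, ENNReal.ofReal (ρ ^ N * |z.2| ^ (N - 1)) *
      Φ (z.1 ^ 2 + z.2 ^ 2, z.2 ^ 2 + (z.1 + ρ) ^ 2, ρ, |z.2|) := by
  have hL : ∀ h ∈ Set.Ioi (0 : ℝ), ∫⁻ z : ℝ × ℝ, ENNReal.ofReal (h ^ N * |z.2| ^ (N - 1)) *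
      Φ (h ^ 2, z.1 ^ 2 + z.2 ^ 2, √(z.2 ^ 2 + (z.1 - h) ^ 2),
        h * |z.2| / √(z.2 ^ 2 + (z.1 - h) ^ 2)) =
      ∫⁻ ρ in Set.Ioi (0 : ℝ), ∫⁻ θ in Set.Ioo (-Real.pi) Real.pi,
        ENNReal.ofReal (ρ ^ N * (h * |h * Real.sin θ| ^ (N - 1))) *
        Φ (h ^ 2, h ^ 2 + 2 * h * ρ * Real.cos θ + ρ ^ 2, ρ, |h * Real.sin θ|) := by
    intro h hh
    have hh : 0 < h := hh
    rw [← lintegral_add_right_eq_self _ ((h, 0) : ℝ × ℝ), lintegral_polar (by fun_prop)]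
    refine setLIntegral_congr_fun measurableSet_Ioi fun ρ hρ => ?_
    have hρ : 0 < ρ := hρ
    refine lintegral_congr fun θ => ?_
    have h1 : (ρ * Real.sin θ + 0) ^ 2 + (ρ * Real.cos θ + h - h) ^ 2 = ρ ^ 2 := by
      linear_combination ρ ^ 2 * Real.sin_sq_add_cos_sq θ
    have h2 : (ρ * Real.cos θ + h) ^ 2 + (ρ * Real.sin θ + 0) ^ 2 =
        h ^ 2 + 2 * h * ρ * Real.cos θ + ρ ^ 2 := by
      linear_combination ρ ^ 2 * Real.sin_sq_add_cos_sq θ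
    have h3 : h * |ρ * Real.sin θ + 0| / ρ = |h * Real.sin θ| := by
      rw [add_zero, abs_mul, abs_mul, abs_of_pos hρ, abs_of_pos hh]
      field_simp
    have h4 : ρ * (h ^ N * |ρ * Real.sin θ + 0| ^ (N - 1)) =
        ρ ^ N * (h * |h * Real.sin θ| ^ (N - 1)) := by
      rw [add_zero, abs_mul, abs_mul, abs_of_pos hρ, abs_of_pos hh,
        Real.mul_rpow hρ.le (abs_nonneg _), Real.mul_rpow hh.le (abs_nonneg _),
        Real.rpow_sub_one hρ.ne', Real.rpow_sub_one hh.ne']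
      field_simp
    simp only [Prod.mk_add_mk]
    rw [h1, h2, Real.sqrt_sq hρ.le, h3, ← mul_assoc, ← ENNReal.ofReal_mul hρ.le, h4]
  have hR : ∀ ρ ∈ Set.Ioi (0 : ℝ), ∫⁻ z : ℝ × ℝ, ENNReal.ofReal (ρ ^ N * |z.2| ^ (N - 1)) *
      Φ (z.1 ^ 2 + z.2 ^ 2, z.2 ^ 2 + (z.1 + ρ) ^ 2, ρ, |z.2|) =
      ∫⁻ h in Set.Ioi (0 : ℝ), ∫⁻ θ in Set.Ioo (-Real.pi) Real.pi,
        ENNReal.ofReal (ρ ^ N * (h * |h * Real.sin θ| ^ (N - 1))) *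
        Φ (h ^ 2, h ^ 2 + 2 * h * ρ * Real.cos θ + ρ ^ 2, ρ, |h * Real.sin θ|) := by
    intro ρ hρ
    rw [lintegral_polar (by fun_prop)]
    refine setLIntegral_congr_fun measurableSet_Ioi fun h hh => ?_
    have hh : 0 < h := hh
    refine lintegral_congr fun θ => ?_
    have h1 : (h * Real.cos θ) ^ 2 + (h * Real.sin θ) ^ 2 = h ^ 2 := by
      linear_combination h ^ 2 * Real.sin_sq_add_cos_sq θ
    have h2 : (h * Real.sin θ) ^ 2 + (h * Real.cos θ + ρ) ^ 2 =
        h ^ 2 + 2 * h * ρ * Real.cos θ + ρ ^ 2 := by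
      linear_combination h ^ 2 * Real.sin_sq_add_cos_sq θ
    simp only
    rw [h1, h2, ← mul_assoc, ← ENNReal.ofReal_mul hh.le, mul_left_comm]
  rw [setLIntegral_congr_fun measurableSet_Ioi hL, setLIntegral_congr_fun measurableSet_Ioi hR,
    lintegral_lintegral_swap]
  refine Measurable.aemeasurable ?_
  refine Measurable.lintegral_prod_right' (f := fun p : (ℝ × ℝ) × ℝ =>
    ENNReal.ofReal (p.1.2 ^ N * (p.1.1 * |p.1.1 * Real.sin p.2| ^ (N - 1))) *
        Φ (p.1.1 ^ 2, p.1.1 ^ 2 + 2 * p.1.1 * p.1.2 * Real.cos p.2 + p.1.2 ^ 2, p.1.2,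
          |p.1.1 * Real.sin p.2|)) ?_
  fun_prop

/-! ### Beta and Gaussian weights -/

/-- The weight `(1 - q) ^ b` on `q < 1`. -/
noncomputable def betaWeight (b q : ℝ) : ℝ≥0∞ := if q < 1 then ENNReal.ofReal ((1 - q) ^ b) else 0

@[fun_prop]
lemma measurable_betaWeight (b : ℝ) : Measurable (betaWeight b) :=
  Measurable.ite measurableSet_Iio (by fun_prop) measurable_const

lemma lintegral_betaWeight {m b : ℝ} (hm : 0 < m) (hb : -1 < b) :
    ∫⁻ q : ℝ, ENNReal.ofReal (|q| ^ (m - 1)) * betaWeight b (q ^ 2) =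
      ENNReal.ofReal (beta (m / 2) (b + 1)) := by
  have hm2 : 0 < m / 2 := by positivity
  have hb1 : 0 < b + 1 := by linarith
  have hB : 0 < beta (m / 2) (b + 1) := beta_pos hm2 hb1
  have h1 : ∀ q : ℝ, ENNReal.ofReal (|q| ^ (m - 1)) * betaWeight b (q ^ 2) =
      (fun x => ENNReal.ofReal (x ^ (m - 1)) * betaWeight b (x ^ 2)) |q| := fun q => by simp
  rw [lintegral_congr h1,
    lintegral_comp_abs (f := fun x => ENNReal.ofReal (x ^ (m - 1)) * betaWeight b (x ^ 2))]
  have himg : (fun x : ℝ => x ^ 2) '' Set.Ioi 0 = Set.Ioi 0 := by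
    ext y
    refine ⟨?_, fun hy => ⟨√y, Real.sqrt_pos.2 hy, Real.sq_sqrt (le_of_lt hy)⟩⟩
    rintro ⟨x, hx, rfl⟩
    exact pow_pos (show (0 : ℝ) < x from hx) 2
  have hcv := lintegral_image_eq_lintegral_abs_deriv_mul (s := Set.Ioi (0 : ℝ))
    (f := fun x => x ^ 2) (f' := fun x => 2 * x) measurableSet_Ioi
    (fun x _ => by simpa using (hasDerivAt_pow 2 x).hasDerivWithinAt)
    (fun x hx y hy hxy => by
      have hx : (0 : ℝ) < x := hx
      have hy : (0 : ℝ) < y := hy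
      exact (pow_left_inj₀ hx.le hy.le two_ne_zero).1 hxy)
    (betaPDF (m / 2) (b + 1))
  have hone : ∫⁻ x in Set.Ioi 0, betaPDF (m / 2) (b + 1) x = 1 := by
    rw [← lintegral_betaPDF_eq_one hm2 hb1, ← lintegral_indicator measurableSet_Ioi]
    refine lintegral_congr fun x => ?_
    by_cases hx : 0 < x
    · simp [hx]
    · simp [hx, betaPDF_eq_zero_of_nonpos (not_lt.1 hx)]
  rw [himg, hone] at hcv
  have hpt : ∀ x ∈ Set.Ioi (0 : ℝ),
      2 * (ENNReal.ofReal (x ^ (m - 1)) * betaWeight b (x ^ 2)) =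
      ENNReal.ofReal (beta (m / 2) (b + 1)) *
        (ENNReal.ofReal |2 * x| * betaPDF (m / 2) (b + 1) (x ^ 2)) := by
    intro x hx
    have hx : 0 < x := hx
    by_cases hx1 : x ^ 2 < 1
    · rw [betaWeight, if_pos hx1, betaPDF_of_pos_lt_one (by positivity) hx1,
        show (2 : ℝ≥0∞) = ENNReal.ofReal 2 by simp, ← ENNReal.ofReal_mul (by positivity),
        ← ENNReal.ofReal_mul (by positivity), ← ENNReal.ofReal_mul (by positivity),
        ← ENNReal.ofReal_mul hB.le, abs_of_pos (by positivity)]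
      congr 1
      have : (x ^ 2) ^ (m / 2 - 1) * x = x ^ (m - 1) := by
        rw [← Real.rpow_natCast, ← Real.rpow_mul hx.le, ← Real.rpow_add_one hx.ne']
        congr 1
        push_cast
        ring
      rw [← this, add_sub_cancel_right]
      field_simp
    · rw [betaWeight, if_neg hx1, betaPDF_eq_zero_of_one_le (not_lt.1 hx1)]
      simp
  have hmeas : Measurable fun x : ℝ =>
      ENNReal.ofReal |2 * x| * betaPDF (m / 2) (b + 1) (x ^ 2) := by
    have : Measurable (betaPDF (m / 2) (b + 1)) :=
      (measurable_betaPDFReal _ _).ennreal_ofReal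
    fun_prop
  rw [← lintegral_const_mul _ (by fun_prop), setLIntegral_congr_fun measurableSet_Ioi hpt,
    lintegral_const_mul _ hmeas, ← hcv, mul_one]

/-- The weight `exp (-a q / 2)`. -/
noncomputable def gaussWeight (a q : ℝ) : ℝ≥0∞ := ENNReal.ofReal (Real.exp (-(a * q / 2)))

@[fun_prop]
lemma measurable_gaussWeight (a : ℝ) : Measurable (gaussWeight a) := by
  unfold gaussWeight
  fun_prop

/-- The total mass of `|q| ^ (m - 1) exp (-a q² / 2)` on the line. -/
noncomputable def gaussMass (m a : ℝ) : ℝ := (2 / a) ^ (m / 2) * Real.Gamma (m / 2)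

lemma gaussMass_pos {m a : ℝ} (hm : 0 < m) (ha : 0 < a) : 0 < gaussMass m a :=
  mul_pos (Real.rpow_pos_of_pos (by positivity) _) (Real.Gamma_pos_of_pos (by positivity))

lemma lintegral_gaussWeight {m a : ℝ} (hm : 0 < m) (ha : 0 < a) :
    ∫⁻ q : ℝ, ENNReal.ofReal (|q| ^ (m - 1)) * gaussWeight a (q ^ 2) =
      ENNReal.ofReal (gaussMass m a) := by
  have h1 : ∀ q : ℝ, ENNReal.ofReal (|q| ^ (m - 1)) * gaussWeight a (q ^ 2) =
      (fun x => ENNReal.ofReal (x ^ (m - 1)) * gaussWeight a (x ^ 2)) |q| := fun q => by simp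
  rw [lintegral_congr h1,
    lintegral_comp_abs (f := fun x => ENNReal.ofReal (x ^ (m - 1)) * gaussWeight a (x ^ 2))]
  have h2 := integral_rpow_mul_exp_neg_mul_rpow (p := 2) (q := m - 1) (b := a / 2) (by norm_num)
    (by linarith) (by positivity)
  have hint := integrableOn_rpow_mul_exp_neg_mul_rpow (p := 2) (s := m - 1) (b := a / 2)
    (by linarith) (by norm_num) (by positivity)
  have h3 : ∫⁻ x in Set.Ioi (0 : ℝ), ENNReal.ofReal (x ^ (m - 1)) * gaussWeight a (x ^ 2) =
      ENNReal.ofReal (∫ x in Set.Ioi (0 : ℝ), x ^ (m - 1) * Real.exp (-(a / 2) * x ^ (2 : ℝ))) := by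
    rw [ofReal_integral_eq_lintegral_ofReal hint]
    · refine setLIntegral_congr_fun measurableSet_Ioi fun x hx => ?_
      have hx : 0 < x := hx
      simp only [gaussWeight]
      rw [← ENNReal.ofReal_mul (by positivity), Real.rpow_two]
      congr 3
      ring
    · refine (ae_restrict_iff' measurableSet_Ioi).2 (ae_of_all _ fun x hx => ?_)
      have hx : 0 < x := hx
      simp only [Pi.zero_apply]
      positivity
  rw [h3, h2, show (2 : ℝ≥0∞) = ENNReal.ofReal 2 by simp, ← ENNReal.ofReal_mul (by norm_num)]
  congr 1
  rw [gaussMass, show (2 / a) = (a / 2)⁻¹ by rw [inv_div], Real.inv_rpow (by positivity),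
    ← Real.rpow_neg (by positivity)]
  rw [show (m - 1 + 1) / 2 = m / 2 by ring, show -(m - 1 + 1) / 2 = -(m / 2) by ring]
  ring

/-! ### Integrals produced by adding a vertex -/

/-- The law of the distance `q` from the origin to the line through `(h, 0)` and a random point `z`
of the plane, tilted by the `2k`-th power of the distance of the two points: if `h` has weight `W`
and `z` has weight `V`, then `q` has a weight `W'`, provided that the integrals of `W V` over the
pairs of points on a line at distance `q` from the origin are a constant multiple of `W'`. This is
one step of the recursion for the height of a random simplex. -/
lemma lintegral_add_vertex {N k : ℝ} {W V W' ψ : ℝ → ℝ≥0∞} (hW : Measurable W) (hV : Measurable V)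
    (hψ : Measurable ψ) {I : ℝ≥0∞}
    (hI : ∀ q : ℝ, ∫⁻ ρ in Set.Ioi (0 : ℝ), ∫⁻ s : ℝ, ENNReal.ofReal (ρ ^ (N + 2 * k)) *
      (W (s ^ 2 + q ^ 2) * V (q ^ 2 + (s + ρ) ^ 2)) = I * W' (q ^ 2)) :
    ∫⁻ h in Set.Ioi (0 : ℝ), ENNReal.ofReal (h ^ N) * W (h ^ 2) *
      ∫⁻ z : ℝ × ℝ, ENNReal.ofReal (|z.2| ^ (N - 1)) * V (z.1 ^ 2 + z.2 ^ 2) *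
        (ENNReal.ofReal ((z.2 ^ 2 + (z.1 - h) ^ 2) ^ k) *
          ψ (h * |z.2| / √(z.2 ^ 2 + (z.1 - h) ^ 2))) =
    ∫⁻ q : ℝ, ENNReal.ofReal (|q| ^ (N - 1)) * (I * W' (q ^ 2)) * ψ |q| := by
  have h := lintegral_point_pair N (Φ := fun p => W p.1 * V p.2.1 *
    (ENNReal.ofReal ((p.2.2.1 ^ 2) ^ k) * ψ p.2.2.2)) (by fun_prop)
  simp only at h
  have h1 : ∀ h ∈ Set.Ioi (0 : ℝ), ENNReal.ofReal (h ^ N) * W (h ^ 2) *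
      ∫⁻ z : ℝ × ℝ, ENNReal.ofReal (|z.2| ^ (N - 1)) * V (z.1 ^ 2 + z.2 ^ 2) *
        (ENNReal.ofReal ((z.2 ^ 2 + (z.1 - h) ^ 2) ^ k) *
          ψ (h * |z.2| / √(z.2 ^ 2 + (z.1 - h) ^ 2))) =
      ∫⁻ z : ℝ × ℝ, ENNReal.ofReal (h ^ N * |z.2| ^ (N - 1)) *
        (W (h ^ 2) * V (z.1 ^ 2 + z.2 ^ 2) *
        (ENNReal.ofReal ((√(z.2 ^ 2 + (z.1 - h) ^ 2) ^ 2) ^ k) *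
          ψ (h * |z.2| / √(z.2 ^ 2 + (z.1 - h) ^ 2)))) := by
    intro h hh
    have hh : 0 < h := hh
    rw [← lintegral_const_mul _ (by fun_prop)]
    refine lintegral_congr fun z => ?_
    rw [Real.sq_sqrt (by positivity), ENNReal.ofReal_mul (by positivity)]
    ring
  rw [setLIntegral_congr_fun measurableSet_Ioi h1, h]
  simp_rw [Measure.volume_eq_prod]
  have h2 : ∀ ρ ∈ Set.Ioi (0 : ℝ), ∫⁻ z : ℝ × ℝ, ENNReal.ofReal (ρ ^ N * |z.2| ^ (N - 1)) *
      (W (z.1 ^ 2 + z.2 ^ 2) * V (z.2 ^ 2 + (z.1 + ρ) ^ 2) *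
        (ENNReal.ofReal ((ρ ^ 2) ^ k) * ψ |z.2|)) ∂((volume : Measure ℝ).prod volume) =
      ∫⁻ q : ℝ, ∫⁻ s : ℝ, ENNReal.ofReal (|q| ^ (N - 1)) * (ENNReal.ofReal (ρ ^ (N + 2 * k)) *
        (W (s ^ 2 + q ^ 2) * V (q ^ 2 + (s + ρ) ^ 2))) * ψ |q| := by
    intro ρ hρ
    have hρ : 0 < ρ := hρ
    rw [lintegral_prod_symm _ (by fun_prop)]
    refine lintegral_congr fun q => lintegral_congr fun s => ?_
    rw [Real.rpow_add hρ, Real.rpow_mul hρ.le, Real.rpow_two, ENNReal.ofReal_mul (by positivity),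
      ENNReal.ofReal_mul (by positivity)]
    ring
  rw [setLIntegral_congr_fun measurableSet_Ioi h2, lintegral_lintegral_swap]
  · refine lintegral_congr fun q => ?_
    rw [← hI, ← lintegral_const_mul _ ?_, ← lintegral_mul_const _ ?_]
    · refine lintegral_congr fun ρ => ?_
      rw [lintegral_mul_const _ (by fun_prop), lintegral_const_mul _ (by fun_prop)]
    · refine Measurable.const_mul ?_ _
      exact Measurable.lintegral_prod_right' (f := fun p : ℝ × ℝ =>
        ENNReal.ofReal (p.1 ^ (N + 2 * k)) *
        (W (p.2 ^ 2 + q ^ 2) * V (q ^ 2 + (p.2 + p.1) ^ 2))) (by fun_prop)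
    · exact Measurable.lintegral_prod_right' (f := fun p : ℝ × ℝ =>
        ENNReal.ofReal (p.1 ^ (N + 2 * k)) *
        (W (p.2 ^ 2 + q ^ 2) * V (q ^ 2 + (p.2 + p.1) ^ 2))) (by fun_prop)
  · refine Measurable.aemeasurable ?_
    exact Measurable.lintegral_prod_right' (f := fun p : (ℝ × ℝ) × ℝ =>
      ENNReal.ofReal (|p.1.2| ^ (N - 1)) * (ENNReal.ofReal (p.1.1 ^ (N + 2 * k)) *
        (W (p.2 ^ 2 + p.1.2 ^ 2) * V (p.1.2 ^ 2 + (p.2 + p.1.1) ^ 2))) * ψ |p.1.2|) (by fun_prop)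

lemma betaWeight_scale {b τ : ℝ} (hτ : 0 < τ) (x q : ℝ) (hq : 1 - q = τ ^ 2) :
    betaWeight b (q + τ ^ 2 * x) = ENNReal.ofReal (τ ^ (2 * b)) * betaWeight b x := by
  have h1 : 1 - (q + τ ^ 2 * x) = τ ^ 2 * (1 - x) := by linear_combination hq
  have h2 : q + τ ^ 2 * x < 1 ↔ x < 1 := by
    rw [← sub_pos, h1, mul_pos_iff_of_pos_left (by positivity), sub_pos]
  by_cases hx : x < 1
  · rw [betaWeight, if_pos (h2.2 hx), betaWeight, if_pos hx, h1,
      Real.mul_rpow (by positivity) (by linarith), ENNReal.ofReal_mul (by positivity),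
      ← Real.rpow_natCast, ← Real.rpow_mul hτ.le]
    norm_num
  · rw [betaWeight, if_neg (fun h => hx (h2.1 h)), betaWeight, if_neg hx, mul_zero]

/-- The two-point integral `∫∫ |x - y|^M (1 - x²)^B (1 - y²)^b` over `-1 < x < y < 1`. -/
noncomputable def betaPair (M B b : ℝ) : ℝ≥0∞ :=
  ∫⁻ ρ in Set.Ioi (0 : ℝ), ∫⁻ s : ℝ, ENNReal.ofReal (ρ ^ M) *
    (betaWeight B (s ^ 2) * betaWeight b ((s + ρ) ^ 2))

/-- The chord at distance `q` from the centre is the interval `(-1, 1)` scaled by `√(1 - q²)`, so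
the two-point integral over it is a power of `1 - q²` times the one over the diameter. -/
lemma lintegral_betaWeight_pair (M B b q : ℝ) :
    ∫⁻ ρ in Set.Ioi (0 : ℝ), ∫⁻ s : ℝ, ENNReal.ofReal (ρ ^ M) *
      (betaWeight B (s ^ 2 + q ^ 2) * betaWeight b (q ^ 2 + (s + ρ) ^ 2)) =
      betaPair M B b * betaWeight (B + b + M / 2 + 1) (q ^ 2) := by
  by_cases hq : q ^ 2 < 1
  · set τ := √(1 - q ^ 2) with hτ
    have hτ2 : 1 - q ^ 2 = τ ^ 2 := (Real.sq_sqrt (by linarith)).symm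
    have hτ0 : 0 < τ := Real.sqrt_pos.2 (by linarith)
    rw [setLIntegral_Ioi_comp_mul_left hτ0]
    have h1 : ∀ ρ ∈ Set.Ioi (0 : ℝ), ∫⁻ s : ℝ, ENNReal.ofReal ((τ * ρ) ^ M) *
        (betaWeight B (s ^ 2 + q ^ 2) * betaWeight b (q ^ 2 + (s + τ * ρ) ^ 2)) =
        ENNReal.ofReal (τ ^ (M + 1 + 2 * B + 2 * b)) * ∫⁻ s : ℝ, ENNReal.ofReal (ρ ^ M) *
        (betaWeight B (s ^ 2) * betaWeight b ((s + ρ) ^ 2)) := by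
      intro ρ hρ
      have hρ : 0 < ρ := hρ
      rw [lintegral_comp_mul_left_real hτ0, ← lintegral_const_mul _ (by fun_prop),
        ← lintegral_const_mul _ (by fun_prop)]
      refine lintegral_congr fun s => ?_
      have e1 : (τ * s) ^ 2 + q ^ 2 = q ^ 2 + τ ^ 2 * s ^ 2 := by ring
      have e2 : q ^ 2 + (τ * s + τ * ρ) ^ 2 = q ^ 2 + τ ^ 2 * (s + ρ) ^ 2 := by ring
      rw [e1, e2, betaWeight_scale hτ0 _ _ hτ2, betaWeight_scale hτ0 _ _ hτ2,
        Real.mul_rpow hτ0.le hρ.le, Real.rpow_add hτ0, Real.rpow_add hτ0, Real.rpow_add hτ0,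
        Real.rpow_one, ENNReal.ofReal_mul (by positivity), ENNReal.ofReal_mul (by positivity),
        ENNReal.ofReal_mul (by positivity), ENNReal.ofReal_mul (by positivity)]
      ring
    rw [setLIntegral_congr_fun measurableSet_Ioi h1, lintegral_const_mul _ ?_, ← betaPair,
      betaWeight, if_pos hq, ← mul_assoc, mul_comm, ← ENNReal.ofReal_mul hτ0.le, hτ2]
    · congr 2
      rw [← Real.rpow_natCast, ← Real.rpow_mul hτ0.le]
      nth_rw 1 [← Real.rpow_one τ]
      rw [← Real.rpow_add hτ0]
      congr 1
      push_cast
      ring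
    · exact Measurable.lintegral_prod_right' (f := fun p : ℝ × ℝ => ENNReal.ofReal (p.1 ^ M) *
        (betaWeight B (p.2 ^ 2) * betaWeight b ((p.2 + p.1) ^ 2))) (by fun_prop)
  · have h1 : ∀ s : ℝ, betaWeight B (s ^ 2 + q ^ 2) = 0 := fun s => by
      rw [betaWeight, if_neg]
      nlinarith [sq_nonneg s]
    simp only [h1, zero_mul, mul_zero, lintegral_zero]
    rw [betaWeight, if_neg hq, mul_zero]

lemma lintegral_betaWeight_plane {m b : ℝ} (hm : 0 < m) (hb : -1 < b) :
    ∫⁻ z : ℝ × ℝ, ENNReal.ofReal (|z.2| ^ (m - 1)) * betaWeight b (z.1 ^ 2 + z.2 ^ 2) =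
      ENNReal.ofReal (beta (1 / 2) (b + 1) * beta (m / 2) (b + 3 / 2)) := by
  have h1 : ∀ q : ℝ, ∫⁻ t : ℝ, betaWeight b (t ^ 2 + q ^ 2) =
      ENNReal.ofReal (beta (1 / 2) (b + 1)) * betaWeight (b + 1 / 2) (q ^ 2) := by
    intro q
    by_cases hq : q ^ 2 < 1
    · set τ := √(1 - q ^ 2) with hτ
      have hτ2 : 1 - q ^ 2 = τ ^ 2 := (Real.sq_sqrt (by linarith)).symm
      have hτ0 : 0 < τ := Real.sqrt_pos.2 (by linarith)
      have h2 := lintegral_betaWeight (m := 1) one_pos hb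
      simp only [sub_self, Real.rpow_zero, ENNReal.ofReal_one, one_mul] at h2
      have e1 : ∀ t : ℝ, (τ * t) ^ 2 + q ^ 2 = q ^ 2 + τ ^ 2 * t ^ 2 := fun t => by ring
      rw [lintegral_comp_mul_left_real hτ0]
      simp_rw [e1, betaWeight_scale hτ0 _ _ hτ2]
      rw [lintegral_const_mul _ (by fun_prop), h2, ← mul_assoc, mul_comm,
        ← ENNReal.ofReal_mul hτ0.le]
      rw [show betaWeight (b + 1 / 2) (q ^ 2) = ENNReal.ofReal ((1 - q ^ 2) ^ (b + 1 / 2)) from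
        if_pos hq, hτ2, ← Real.rpow_natCast, ← Real.rpow_mul hτ0.le]
      congr 2
      push_cast
      rw [mul_add, Real.rpow_add hτ0, mul_comm]
      norm_num
    · have h2 : ∀ s : ℝ, betaWeight b (s ^ 2 + q ^ 2) = 0 := fun s => by
        rw [betaWeight, if_neg]
        nlinarith [sq_nonneg s]
      simp only [h2, lintegral_zero]
      rw [betaWeight, if_neg hq, mul_zero]
  rw [Measure.volume_eq_prod, lintegral_prod_symm _ (by fun_prop)]
  have h3 : ∀ q : ℝ, ∫⁻ t : ℝ, ENNReal.ofReal (|q| ^ (m - 1)) * betaWeight b (t ^ 2 + q ^ 2) =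
      ENNReal.ofReal (beta (1 / 2) (b + 1)) *
        (ENNReal.ofReal (|q| ^ (m - 1)) * betaWeight (b + 1 / 2) (q ^ 2)) := fun q => by
    rw [lintegral_const_mul _ (by fun_prop), h1]
    ring
  simp only
  rw [lintegral_congr h3, lintegral_const_mul _ (by fun_prop),
    lintegral_betaWeight hm (by linarith),
    ← ENNReal.ofReal_mul (beta_pos (by norm_num) (by linarith)).le]
  congr 3
  ring

lemma setLIntegral_betaWeight {m b : ℝ} (hm : 0 < m) (hb : -1 < b) :
    ∫⁻ h in Set.Ioi (0 : ℝ), ENNReal.ofReal (h ^ (m - 1)) * betaWeight b (h ^ 2) =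
      ENNReal.ofReal (beta (m / 2) (b + 1) / 2) := by
  have h1 := lintegral_comp_abs (f := fun x => ENNReal.ofReal (x ^ (m - 1)) * betaWeight b (x ^ 2))
  simp only [sq_abs] at h1
  rw [lintegral_betaWeight hm hb] at h1
  rw [ENNReal.ofReal_div_of_pos two_pos, h1, ENNReal.ofReal_ofNat, mul_comm,
    ENNReal.mul_div_cancel_right two_ne_zero (by simp)]

/-- The two-point integral is found from the total mass in the change of variables, which holds for
real exponents. -/
lemma betaPair_eq {M B b : ℝ} (hM : 0 < M) (hB : -1 < B) (hb : -1 < b) :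
    betaPair M B b = ENNReal.ofReal (beta ((M + 1) / 2) (B + 1) / 2 *
      (beta (1 / 2) (b + 1) * beta (M / 2) (b + 3 / 2)) / beta (M / 2) (B + b + M / 2 + 2)) := by
  have h := lintegral_add_vertex (N := M) (k := 0) (W := betaWeight B) (V := betaWeight b)
    (W' := betaWeight (B + b + M / 2 + 1)) (ψ := fun _ => 1) (I := betaPair M B b)
    (by fun_prop) (by fun_prop) (by fun_prop)
    (fun q => by simpa using lintegral_betaWeight_pair M B b q)
  simp only [Real.rpow_zero, ENNReal.ofReal_one, mul_one] at h
  rw [lintegral_betaWeight_plane hM hb, lintegral_mul_const _ (by fun_prop)] at h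
  have h2 := setLIntegral_betaWeight (m := M + 1) (b := B) (by linarith) hB
  rw [add_sub_cancel_right] at h2
  have h3 : ∀ q : ℝ, ENNReal.ofReal (|q| ^ (M - 1)) *
      (betaPair M B b * betaWeight (B + b + M / 2 + 1) (q ^ 2)) = betaPair M B b *
      (ENNReal.ofReal (|q| ^ (M - 1)) * betaWeight (B + b + M / 2 + 1) (q ^ 2)) := fun q => by ring
  rw [h2, lintegral_congr h3, lintegral_const_mul _ (by fun_prop),
    lintegral_betaWeight hM (by linarith)] at h
  have hp : 0 < beta (M / 2) (B + b + M / 2 + 2) := beta_pos (by linarith) (by linarith)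
  have hq : 0 < beta ((M + 1) / 2) (B + 1) := beta_pos (by linarith) (by linarith)
  rw [show B + b + M / 2 + 1 + 1 = B + b + M / 2 + 2 by ring, ← ENNReal.ofReal_mul (by positivity)]
    at h
  rw [ENNReal.ofReal_div_of_pos hp, h, ENNReal.mul_div_cancel_right]
  · simpa using hp
  · simp

/-- The Gaussian two-point integral. -/
noncomputable def gaussPair (M a : ℝ) : ℝ≥0∞ :=
  ∫⁻ ρ in Set.Ioi (0 : ℝ), ∫⁻ s : ℝ, ENNReal.ofReal (ρ ^ M) *
    (gaussWeight a (s ^ 2) * gaussWeight 1 ((s + ρ) ^ 2))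

lemma gaussWeight_add (a p q : ℝ) : gaussWeight a (p + q) = gaussWeight a p * gaussWeight a q := by
  rw [gaussWeight, gaussWeight, gaussWeight, ← ENNReal.ofReal_mul (Real.exp_pos _).le,
    ← Real.exp_add]
  congr 2
  ring

lemma lintegral_gaussWeight_pair (M a q : ℝ) :
    ∫⁻ ρ in Set.Ioi (0 : ℝ), ∫⁻ s : ℝ, ENNReal.ofReal (ρ ^ M) *
      (gaussWeight a (s ^ 2 + q ^ 2) * gaussWeight 1 (q ^ 2 + (s + ρ) ^ 2)) =
      gaussPair M a * gaussWeight (a + 1) (q ^ 2) := by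
  have h0 : gaussWeight (a + 1) (q ^ 2) = gaussWeight a (q ^ 2) * gaussWeight 1 (q ^ 2) := by
    rw [gaussWeight, gaussWeight, gaussWeight, ← ENNReal.ofReal_mul (Real.exp_pos _).le,
      ← Real.exp_add]
    congr 2
    ring
  rw [gaussPair, ← lintegral_mul_const]
  · refine lintegral_congr fun ρ => ?_
    rw [← lintegral_mul_const _ (by fun_prop)]
    refine lintegral_congr fun s => ?_
    rw [gaussWeight_add, gaussWeight_add, h0]
    ring
  · exact Measurable.lintegral_prod_right' (f := fun p : ℝ × ℝ => ENNReal.ofReal (p.1 ^ M) *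
        (gaussWeight a (p.2 ^ 2) * gaussWeight 1 ((p.2 + p.1) ^ 2))) (by fun_prop)

lemma lintegral_gaussWeight_plane {M : ℝ} (hM : 0 < M) :
    ∫⁻ z : ℝ × ℝ, ENNReal.ofReal (|z.2| ^ (M - 1)) * gaussWeight 1 (z.1 ^ 2 + z.2 ^ 2) =
      ENNReal.ofReal (gaussMass 1 1 * gaussMass M 1) := by
  have h1 := lintegral_gaussWeight (m := 1) (a := 1) one_pos one_pos
  have h2 := lintegral_gaussWeight (m := M) (a := 1) hM one_pos
  simp only [sub_self, Real.rpow_zero, ENNReal.ofReal_one, one_mul] at h1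
  rw [ENNReal.ofReal_mul (gaussMass_pos one_pos one_pos).le, ← h1, ← h2,
    ← lintegral_prod_mul (by fun_prop) (by fun_prop), Measure.volume_eq_prod]
  refine lintegral_congr fun z => ?_
  rw [gaussWeight_add]
  ring

/-- As in `betaPair_eq`, the value comes from the total mass in the change of variables. -/
lemma gaussPair_eq {M a : ℝ} (hM : 0 < M) (ha : 0 < a) :
    gaussPair M a = ENNReal.ofReal (gaussMass (M + 1) a / 2 * (gaussMass 1 1 * gaussMass M 1) /
      gaussMass M (a + 1)) := by
  have h := lintegral_add_vertex (N := M) (k := 0) (W := gaussWeight a) (V := gaussWeight 1)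
    (W' := gaussWeight (a + 1)) (ψ := fun _ => 1) (I := gaussPair M a)
    (by fun_prop) (by fun_prop) (by fun_prop)
    (fun q => by simpa using lintegral_gaussWeight_pair M a q)
  simp only [Real.rpow_zero, ENNReal.ofReal_one, mul_one] at h
  have h1 := lintegral_comp_abs (f := fun x => ENNReal.ofReal (x ^ M) * gaussWeight a (x ^ 2))
  simp only [sq_abs] at h1
  have h2 := lintegral_gaussWeight (m := M + 1) (a := a) (by linarith) ha
  rw [add_sub_cancel_right, h1] at h2
  have h2' : ∫⁻ x in Set.Ioi (0 : ℝ), ENNReal.ofReal (x ^ M) * gaussWeight a (x ^ 2) =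
      ENNReal.ofReal (gaussMass (M + 1) a / 2) := by
    rw [ENNReal.ofReal_div_of_pos two_pos, ← h2, ENNReal.ofReal_ofNat, mul_comm,
      ENNReal.mul_div_cancel_right two_ne_zero (by simp)]
  have h3 : ∀ q : ℝ, ENNReal.ofReal (|q| ^ (M - 1)) *
      (gaussPair M a * gaussWeight (a + 1) (q ^ 2)) = gaussPair M a *
      (ENNReal.ofReal (|q| ^ (M - 1)) * gaussWeight (a + 1) (q ^ 2)) := fun q => by ring
  have hp : 0 < gaussMass M (a + 1) := gaussMass_pos hM (by linarith)
  rw [lintegral_gaussWeight_plane hM, lintegral_mul_const _ (by fun_prop), h2', lintegral_congr h3,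
    lintegral_const_mul _ (by fun_prop), lintegral_gaussWeight hM (by linarith),
    ← ENNReal.ofReal_mul (half_pos (gaussMass_pos (by linarith) ha)).le] at h
  rw [ENNReal.ofReal_div_of_pos hp, h, ENNReal.mul_div_cancel_right]
  · simpa using hp
  · simp

/-! ### Rotation invariant laws -/

section Rotation

variable {E : Type*} [NormedAddCommGroup E] [InnerProductSpace ℝ E] [FiniteDimensional ℝ E]
  [MeasurableSpace E] [BorelSpace E]

lemma lintegral_orthogonal_split (U : Submodule ℝ E) {f : E → ℝ≥0∞} (hf : Measurable f) :
    ∫⁻ w, f w = ∫⁻ v : Uᗮ, ∫⁻ u : U, f (u + v) := by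
  have h := U.measurePreserving_measurableEquivProd (0 : E)
  rw [InnerProductSpace.euclideanHausdorffMeasure_eq_volume] at h
  rw [← h.symm.lintegral_comp hf, Measure.volume_eq_prod, lintegral_prod_symm]
  · simp
  · exact (hf.comp (MeasurableEquiv.measurable _)).aemeasurable

/-- Integration of a function of the component along a unit vector and of the norm: the orthogonal
complement of the unit vector is identified with `ℝᵐ`. -/
lemma lintegral_inner_norm {m : ℕ} (hE : Module.finrank ℝ E = m + 1) {e : E} (he : ‖e‖ = 1)
    {F : ℝ × ℝ → ℝ≥0∞} (hF : Measurable F) :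
    ∫⁻ w : E, F (inner ℝ e w, ‖w‖ ^ 2) =
      ∫⁻ t : ℝ, ∫⁻ y : EuclideanSpace ℝ (Fin m), F (t, t ^ 2 + ‖y‖ ^ 2) := by
  have he0 : e ≠ 0 := fun h => by simp [h] at he
  let K : Submodule ℝ E := Submodule.span ℝ {e}
  have hK : Module.finrank ℝ Kᗮ = m := by
    have : Fact (Module.finrank ℝ E = m + 1) := ⟨hE⟩
    exact Submodule.finrank_orthogonal_span_singleton he0
  let b : Kᗮ ≃ₗᵢ[ℝ] EuclideanSpace ℝ (Fin m) :=
    (stdOrthonormalBasis ℝ Kᗮ).reindex (finCongr hK) |>.repr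
  let c : ℝ ≃ₗᵢ[ℝ] K := LinearIsometryEquiv.toSpanUnitSingleton e he
  have hc : ∀ t : ℝ, ((c t : K) : E) = t • e := fun t => by
    simp [c, LinearIsometryEquiv.toSpanUnitSingleton]
  have hperp : ∀ v : Kᗮ, inner ℝ e (v : E) = 0 := fun v =>
    (Submodule.mem_orthogonal_singleton_iff_inner_right.1 v.2)
  have hm : Measurable fun w : E => F (inner ℝ e w, ‖w‖ ^ 2) := by fun_prop
  rw [lintegral_orthogonal_split K hm]
  have h1 : ∀ v : Kᗮ, ∫⁻ u : K, F (inner ℝ e ((u : E) + v), ‖(u : E) + v‖ ^ 2) =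
      ∫⁻ t : ℝ, F (t, t ^ 2 + ‖v‖ ^ 2) := by
    intro v
    rw [← c.measurePreserving.lintegral_comp (by fun_prop)]
    refine lintegral_congr fun t => ?_
    have e1 : inner ℝ e (t • e + (v : E)) = t := by
      rw [inner_add_right, hperp, real_inner_smul_right, real_inner_self_eq_norm_sq, he]
      simp
    have e2 : ‖t • e + (v : E)‖ ^ 2 = t ^ 2 + ‖v‖ ^ 2 := by
      rw [norm_add_sq_real, real_inner_smul_left, hperp, norm_smul, he]
      simp
    rw [hc, e1, e2]
  rw [lintegral_congr h1, lintegral_lintegral_swap (by fun_prop)]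
  refine lintegral_congr fun t => ?_
  rw [← b.symm.measurePreserving.lintegral_comp (by fun_prop)]
  simp

/-- Integration in polar coordinates. -/
lemma lintegral_eq_lintegral_toSphere {n : ℕ} (hn : Module.finrank ℝ E = n) (h0 : 1 ≤ n)
    {f : E → ℝ≥0∞} (hf : Measurable f) :
    ∫⁻ x, f x = ∫⁻ u : Metric.sphere (0 : E) 1, (∫⁻ r in Set.Ioi (0 : ℝ),
      ENNReal.ofReal (r ^ (n - 1)) * f (r • (u : E)))
      ∂(volume : Measure E).toSphere := by
  have : Nontrivial E := Module.nontrivial_of_finrank_pos (R := ℝ) (by omega)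
  have h := (volume : Measure E).measurePreserving_homeomorphUnitSphereProd
  have h1 : ∫⁻ x, f x = ∫⁻ x : ({(0)}ᶜ : Set E), f x ∂((volume : Measure E).comap (↑)) := by
    rw [lintegral_subtype_comap (measurableSet_singleton _).compl, restrict_compl_singleton]
  rw [h1, ← (MeasurePreserving.symm (homeomorphUnitSphereProd E).toMeasurableEquiv h).lintegral_comp
    (by fun_prop), lintegral_prod _ (Measurable.aemeasurable ?_)]
  · refine lintegral_congr fun u => ?_
    rw [Measure.volumeIoiPow, lintegral_withDensity_eq_lintegral_mul _ (by fun_prop)]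
    · rw [← lintegral_subtype_comap measurableSet_Ioi, hn]
      rfl
    · exact hf.comp (measurable_subtype_coe.comp
        ((MeasurableEquiv.measurable _).comp measurable_prodMk_left))
  · exact hf.comp (measurable_subtype_coe.comp (MeasurableEquiv.measurable _))

/-- Half the surface area of the unit sphere of `ℝⁿ`. -/
noncomputable def halfSphereArea (n : ℕ) : ℝ≥0∞ :=
  (volume : Measure (EuclideanSpace ℝ (Fin n))).toSphere Set.univ / 2

/-- Integration of a radial function. The radius runs over the whole line, which gives the same form
as the integrals over signed distances in `lintegral_add_vertex`. -/
lemma lintegral_comp_norm {n : ℕ} (hn : Module.finrank ℝ E = n) (h0 : 1 ≤ n) {f : ℝ → ℝ≥0∞}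
    (hf : Measurable f) :
    ∫⁻ x : E, f ‖x‖ =
      halfSphereArea n * ∫⁻ r : ℝ, ENNReal.ofReal (|r| ^ ((n : ℝ) - 1)) * f |r| := by
  let b : E ≃ₗᵢ[ℝ] EuclideanSpace ℝ (Fin n) :=
    (stdOrthonormalBasis ℝ E).reindex (finCongr hn) |>.repr
  rw [← b.symm.measurePreserving.lintegral_comp (by fun_prop)]
  simp only [LinearIsometryEquiv.norm_map]
  rw [lintegral_eq_lintegral_toSphere (finrank_euclideanSpace_fin) h0 (by fun_prop),
    lintegral_comp_abs (f := fun r => ENNReal.ofReal (r ^ ((n : ℝ) - 1)) * f r), halfSphereArea]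
  have h1 : ∀ u : Metric.sphere (0 : EuclideanSpace ℝ (Fin n)) 1,
      ∫⁻ r in Set.Ioi (0 : ℝ), ENNReal.ofReal (r ^ (n - 1)) *
        f ‖r • (u : EuclideanSpace ℝ (Fin n))‖ =
      ∫⁻ r in Set.Ioi (0 : ℝ), ENNReal.ofReal (r ^ ((n : ℝ) - 1)) * f r := fun u => by
    refine setLIntegral_congr_fun measurableSet_Ioi fun r hr => ?_
    have hr : 0 < r := hr
    have hu : ‖(u : EuclideanSpace ℝ (Fin n))‖ = 1 := by simp
    rw [norm_smul, hu, mul_one, Real.norm_of_nonneg hr.le, ← Real.rpow_natCast, Nat.cast_pred h0]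
  rw [lintegral_congr h1, lintegral_const, ← mul_assoc,
    ENNReal.div_mul_cancel two_ne_zero (by simp),
    mul_comm]

end Rotation

section Radial

variable {n : ℕ} {μ : Measure (EuclideanSpace ℝ (Fin n))} {g : ℝ → ℝ≥0∞} {κ : ℝ≥0∞}

/-- The joint law of the component of a rotation invariant random vector along a unit vector of a
subspace, and of its distance to the subspace. -/
lemma lintegral_component_dist (hg : Measurable g)
    (hμ : μ = volume.withDensity fun x => κ * g (‖x‖ ^ 2)) {m : ℕ} (hm : m + 1 < n)
    {V : ℝ → ℝ≥0∞} {c : ℝ≥0∞}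
    (hV : ∀ q, ∫⁻ y : EuclideanSpace ℝ (Fin m), g (q + ‖y‖ ^ 2) = c * V q) (hVm : Measurable V)
    {U : Submodule ℝ (EuclideanSpace ℝ (Fin n))} (hU : Module.finrank ℝ U = m + 1)
    {e : EuclideanSpace ℝ (Fin n)} (heU : e ∈ U) (he : ‖e‖ = 1)
    {f : ℝ × ℝ → ℝ≥0∞} (hf : Measurable f) :
    ∫⁻ w, f (inner ℝ e w, ‖w - U.starProjection w‖) ∂μ =
      κ * c * halfSphereArea (n - m - 1) * ∫⁻ z : ℝ × ℝ,
        ENNReal.ofReal (|z.2| ^ ((n : ℝ) - m - 1 - 1)) * V (z.1 ^ 2 + z.2 ^ 2) *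
          f (z.1, |z.2|) := by
  have hUo : Module.finrank ℝ Uᗮ = n - m - 1 := by
    have := U.finrank_add_finrank_orthogonal
    rw [finrank_euclideanSpace_fin] at this
    omega
  have hcast : ((n - m - 1 : ℕ) : ℝ) - 1 = (n : ℝ) - m - 1 - 1 := by
    rw [Nat.cast_sub (by omega), Nat.cast_sub (by omega)]
    simp
  rw [hμ, lintegral_withDensity_eq_lintegral_mul _ (by fun_prop) (by fun_prop),
    lintegral_orthogonal_split U (by fun_prop)]
  simp only [Pi.mul_apply]
  have h1 : ∀ v : Uᗮ, ∫⁻ u : U, κ * g (‖(u : EuclideanSpace ℝ (Fin n)) + v‖ ^ 2) *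
      f (inner ℝ e ((u : EuclideanSpace ℝ (Fin n)) + v),
        ‖(u : EuclideanSpace ℝ (Fin n)) + v - U.starProjection (u + v)‖) =
      κ * c * ∫⁻ t : ℝ, V (t ^ 2 + ‖v‖ ^ 2) * f (t, ‖v‖) := by
    intro v
    have h2 : ∀ u : U, κ * g (‖(u : EuclideanSpace ℝ (Fin n)) + v‖ ^ 2) *
        f (inner ℝ e ((u : EuclideanSpace ℝ (Fin n)) + v),
          ‖(u : EuclideanSpace ℝ (Fin n)) + v - U.starProjection (u + v)‖) =
        (fun p : ℝ × ℝ => κ * g (p.2 + ‖v‖ ^ 2) * f (p.1, ‖v‖))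
          (inner ℝ (⟨e, heU⟩ : U) u, ‖u‖ ^ 2) := by
      intro u
      have e1 : ‖(u : EuclideanSpace ℝ (Fin n)) + v‖ ^ 2 = ‖u‖ ^ 2 + ‖v‖ ^ 2 := by
        rw [norm_add_sq_real, Submodule.inner_right_of_mem_orthogonal u.2 v.2]
        simp
      have e2 : inner ℝ e ((u : EuclideanSpace ℝ (Fin n)) + v) = inner ℝ (⟨e, heU⟩ : U) u := by
        rw [inner_add_right, Submodule.inner_right_of_mem_orthogonal heU v.2, add_zero]
        rfl
      have e3 : (u : EuclideanSpace ℝ (Fin n)) + v - U.starProjection (u + v) = v := by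
        rw [map_add, Submodule.starProjection_eq_self_iff.2 u.2,
          (Submodule.starProjection_apply_eq_zero_iff U).2 v.2]
        abel
      rw [e1, e2, e3]
      simp
    have he' : ‖(⟨e, heU⟩ : U)‖ = 1 := he
    have h4 := lintegral_inner_norm hU he'
      (F := fun p : ℝ × ℝ => κ * g (p.2 + ‖v‖ ^ 2) * f (p.1, ‖v‖)) (by fun_prop)
    rw [lintegral_congr h2, h4, ← lintegral_const_mul _ (by fun_prop)]
    refine lintegral_congr fun t => ?_
    simp only
    rw [lintegral_mul_const _ (by fun_prop), lintegral_const_mul _ (by fun_prop)]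
    have h3 : ∀ y : EuclideanSpace ℝ (Fin m), g (t ^ 2 + ‖y‖ ^ 2 + ‖v‖ ^ 2) =
        g (t ^ 2 + ‖v‖ ^ 2 + ‖y‖ ^ 2) := fun y => by congr 1; ring
    rw [lintegral_congr h3, hV]
    ring
  have hmeas : Measurable fun d : ℝ => κ * c * ∫⁻ t : ℝ, V (t ^ 2 + d ^ 2) * f (t, d) := by
    refine Measurable.const_mul ?_ _
    exact Measurable.lintegral_prod_right' (f := fun p : ℝ × ℝ =>
      V (p.2 ^ 2 + p.1 ^ 2) * f (p.2, p.1)) (by fun_prop)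
  have h5 : ∀ d : ℝ, ENNReal.ofReal (|d| ^ ((n : ℝ) - m - 1 - 1)) *
      (κ * c * ∫⁻ t : ℝ, V (t ^ 2 + |d| ^ 2) * f (t, |d|)) = κ * c * ∫⁻ t : ℝ,
        ENNReal.ofReal (|d| ^ ((n : ℝ) - m - 1 - 1)) * V (t ^ 2 + d ^ 2) * f (t, |d|) := by
    intro d
    rw [mul_left_comm, ← lintegral_const_mul _ (by fun_prop)]
    simp only [sq_abs, mul_assoc]
  rw [lintegral_congr h1, lintegral_comp_norm hUo (by omega) hmeas, hcast, lintegral_congr h5,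
    lintegral_const_mul, Measure.volume_eq_prod, lintegral_prod_symm _ (by fun_prop)]
  · ring
  · exact Measurable.lintegral_prod_right' (f := fun p : ℝ × ℝ =>
      ENNReal.ofReal (|p.1| ^ ((n : ℝ) - m - 1 - 1)) * V (p.2 ^ 2 + p.1 ^ 2) * f (p.2, |p.1|))
      (by fun_prop)

end Radial

lemma lintegral_pi_cons {X : Type*} [MeasurableSpace X] {μ : Measure X} [SigmaFinite μ] {m : ℕ}
    {f : (Fin (m + 1) → X) → ℝ≥0∞} (hf : Measurable f) :
    ∫⁻ x, f x ∂(Measure.pi fun _ => μ) =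
      ∫⁻ x, ∫⁻ w, f (Fin.cons w x) ∂μ ∂(Measure.pi fun _ : Fin m => μ) := by
  have h := measurePreserving_piFinSuccAbove (fun _ : Fin (m + 1) => μ) 0
  rw [← (MeasurePreserving.symm _ h).lintegral_comp hf, lintegral_prod_symm]
  · refine lintegral_congr fun x => lintegral_congr fun w => ?_
    congr 1
    exact Fin.insertNth_zero' w x
  · exact (hf.comp (MeasurableEquiv.measurable _)).aemeasurable

/-- If the law of a vertex does not charge proper subspaces, then `m + 1 ≤ n` independent vertices
are almost surely linearly independent: each new vertex avoids the span of the previous ones. -/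
lemma ae_linearIndependent_vertexFrame {n : ℕ} {μ : Measure (EuclideanSpace ℝ (Fin n))}
    [IsProbabilityMeasure μ]
    (hμ : ∀ K : Submodule ℝ (EuclideanSpace ℝ (Fin n)), K ≠ ⊤ → μ K = 0) (m : ℕ) (hm : m < n) :
    ∀ᵐ x ∂(Measure.pi fun _ : Fin (m + 1) => μ), LinearIndependent ℝ (vertexFrame x) := by
  have hmeas : ∀ m : ℕ, MeasurableSet {x : Fin (m + 1) → EuclideanSpace ℝ (Fin n) |
      ¬ LinearIndependent ℝ (vertexFrame x)} := by
    intro m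
    have h1 : {x : Fin (m + 1) → EuclideanSpace ℝ (Fin n) |
      ¬ LinearIndependent ℝ (vertexFrame x)} = {x | (Matrix.gram ℝ (vertexFrame x)).det = 0} := by
      ext x
      simp [← Matrix.det_gram_ne_zero_iff_linearIndependent]
    rw [h1]
    refine (isClosed_eq ?_ continuous_const).measurableSet
    refine Continuous.matrix_det (continuous_matrix fun i j => ?_)
    have hc : ∀ i, Continuous fun x : Fin (m + 1) → EuclideanSpace ℝ (Fin n) =>
        vertexFrame x i := by
      intro i
      refine Fin.cases ?_ (fun i => ?_) i
      · simp only [vertexFrame, Fin.cons_zero]; fun_prop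
      · simp only [vertexFrame, Fin.cons_succ, edgeVectors]; fun_prop
    exact (hc i).inner (hc j)
  have hne : ∀ (k : ℕ), k < n → ∀ v : Fin k → EuclideanSpace ℝ (Fin n),
      Submodule.span ℝ (Set.range v) ≠ ⊤ := by
    intro k hk v h
    have h1 := finrank_range_le_card (R := ℝ) v
    rw [Set.finrank, h, finrank_top, finrank_euclideanSpace_fin, Fintype.card_fin] at h1
    omega
  have hstep : ∀ (m : ℕ), (∀ᵐ x ∂(Measure.pi fun _ : Fin m => μ), ∀ᵐ w ∂μ,
      LinearIndependent ℝ (vertexFrame (Fin.cons w x))) →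
      ∀ᵐ x ∂(Measure.pi fun _ : Fin (m + 1) => μ), LinearIndependent ℝ (vertexFrame x) := by
    intro m h
    rw [ae_iff, ← lintegral_indicator_one (hmeas m),
      lintegral_pi_cons (measurable_one.indicator (hmeas m)), lintegral_eq_zero_iff']
    · filter_upwards [h] with x hx
      rw [Pi.zero_apply, lintegral_eq_zero_iff']
      · filter_upwards [hx] with w hw
        simp [hw]
      · refine (Measurable.comp (measurable_one.indicator (hmeas m)) ?_).aemeasurable
        exact measurable_pi_lambda _ fun i => Fin.cases (by simpa using measurable_id')
          (fun i => by simp) i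
    · refine (Measurable.lintegral_prod_right' (f := fun p : (Fin m → EuclideanSpace ℝ (Fin n)) ×
        EuclideanSpace ℝ (Fin n) => Set.indicator {x : Fin (m + 1) → EuclideanSpace ℝ (Fin n) |
          ¬ LinearIndependent ℝ (vertexFrame x)} 1 (Fin.cons p.2 p.1)) ?_).aemeasurable
      refine Measurable.comp (measurable_one.indicator (hmeas m)) ?_
      exact measurable_pi_lambda _ fun i => Fin.cases (by simpa using measurable_snd)
          (fun i => by simp only [Fin.cons_succ]; fun_prop) i
  induction m with
  | zero =>
    refine hstep 0 (ae_of_all _ fun x => ?_)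
    have h0 : μ (⊥ : Submodule ℝ (EuclideanSpace ℝ (Fin n))) = 0 := by
      refine hμ ⊥ fun h => hne 0 hm (fun i => 0) ?_
      rw [Set.range_eq_empty, Submodule.span_empty, h]
    filter_upwards [(measure_eq_zero_iff_ae_notMem.1 h0)] with w hw
    rw [vertexFrame, linearIndependent_finCons]
    refine ⟨linearIndependent_empty_type, ?_⟩
    rw [Set.range_eq_empty, Submodule.span_empty]
    exact hw
  | succ m ih =>
    refine hstep (m + 1) ?_
    filter_upwards [ih (by omega)] with x hx
    have h0 : μ (vertexSpan x) = 0 := hμ _ (hne _ hm _)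
    filter_upwards [(measure_eq_zero_iff_ae_notMem.1 h0)] with w hw
    exact linearIndependent_vertexFrame_cons hx hw

/-! ### The moments of the volume -/

lemma measurable_affineHeight {n m : ℕ} :
    Measurable (affineHeight : (Fin (m + 1) → EuclideanSpace ℝ (Fin n)) → ℝ) := by
  have hc : ∀ i, Continuous fun x : Fin (m + 1) → EuclideanSpace ℝ (Fin n) => vertexFrame x i := by
    intro i
    refine Fin.cases ?_ (fun i => ?_) i
    · simp only [vertexFrame, Fin.cons_zero]; fun_prop
    · simp only [vertexFrame, Fin.cons_succ, edgeVectors]; fun_prop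
  have h1 : Measurable fun x : Fin (m + 1) → EuclideanSpace ℝ (Fin n) =>
      (Matrix.gram ℝ (vertexFrame x)).det :=
    (Continuous.matrix_det (continuous_matrix fun i j => (hc i).inner (hc j))).measurable
  have h2 : Measurable (gramVolume : (Fin (m + 1) → EuclideanSpace ℝ (Fin n)) → ℝ) :=
    continuous_gramVolume.measurable
  unfold affineHeight
  fun_prop

/-- A rotation invariant law on `ℝⁿ` whose marginals, and the weights they produce when vertices
are added one at a time, are known: `V m` is, as a function of the squared norm, the density of the
projection that forgets `m` coordinates, and `W m` is the weight of the height of a simplex with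
`m + 1` vertices, tilted by the `k`-th power of its squared volume. -/
structure WeightFamily {n : ℕ} (μ : Measure (EuclideanSpace ℝ (Fin n))) (κ : ℝ≥0∞) (k : ℝ)
    (V W : ℕ → ℝ → ℝ≥0∞) (c I : ℕ → ℝ≥0∞) : Prop where
  eq_withDensity : μ = volume.withDensity fun x => κ * V 0 (‖x‖ ^ 2)
  measurable_V : ∀ m, Measurable (V m)
  measurable_W : ∀ m, Measurable (W m)
  W_zero : W 0 = V 0
  marginal : ∀ m q, ∫⁻ y : EuclideanSpace ℝ (Fin m), V 0 (q + ‖y‖ ^ 2) = c m * V m q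
  pair : ∀ m, m + 1 < n → ∀ q : ℝ, ∫⁻ ρ in Set.Ioi (0 : ℝ), ∫⁻ s : ℝ,
    ENNReal.ofReal (ρ ^ ((n : ℝ) - m - 1 + 2 * k)) *
      (W m (s ^ 2 + q ^ 2) * V m (q ^ 2 + (s + ρ) ^ 2)) = I m * W (m + 1) (q ^ 2)

namespace WeightFamily

variable {n : ℕ} {μ : Measure (EuclideanSpace ℝ (Fin n))} [IsProbabilityMeasure μ] {κ : ℝ≥0∞}
  {k : ℝ} {V W : ℕ → ℝ → ℝ≥0∞} {c I : ℕ → ℝ≥0∞}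

/-- The constant in the law of the component and distance for a subspace of dimension `m + 1`. -/
noncomputable def splitConst (n : ℕ) (κ : ℝ≥0∞) (c : ℕ → ℝ≥0∞) (m : ℕ) : ℝ≥0∞ :=
  κ * c m * halfSphereArea (n - m - 1)

omit [IsProbabilityMeasure μ] in
lemma measure_submodule_eq_zero (h : WeightFamily μ κ k V W c I)
    (K : Submodule ℝ (EuclideanSpace ℝ (Fin n))) (hK : K ≠ ⊤) : μ K = 0 := by
  rw [h.eq_withDensity]
  exact withDensity_absolutelyContinuous _ _ (Measure.addHaar_submodule volume K hK)

/-- The constants are determined by the fact that the component and distance have a probability law.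
-/
lemma splitConst_mul (h : WeightFamily μ κ k V W c I) {m : ℕ} (hm : m + 1 < n) :
    splitConst n κ c m * ∫⁻ z : ℝ × ℝ,
      ENNReal.ofReal (|z.2| ^ ((n : ℝ) - m - 1 - 1)) * V m (z.1 ^ 2 + z.2 ^ 2) = 1 := by
  let b := stdOrthonormalBasis ℝ (EuclideanSpace ℝ (Fin n))
  let b' : Fin (m + 1) → EuclideanSpace ℝ (Fin n) := fun i =>
    b (Fin.castLE (by rw [finrank_euclideanSpace_fin]; omega) i)
  have hb' : Orthonormal ℝ b' := b.orthonormal.comp _ (Fin.castLE_injective _)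
  have hr : Module.finrank ℝ (Submodule.span ℝ (Set.range b')) = m + 1 := by
    rw [finrank_span_eq_card hb'.linearIndependent, Fintype.card_fin]
  have h1 := lintegral_component_dist (h.measurable_V 0) h.eq_withDensity hm (h.marginal m)
    (h.measurable_V m) hr (Submodule.subset_span ⟨0, rfl⟩) (hb'.1 0) (f := fun _ => 1)
    measurable_const
  simpa [splitConst] using h1.symm

/-- The height of a random simplex with `m + 1` vertices, tilted by the `k`-th power of its squared
volume, has weight `C W m`. -/
def HasHeightWeight (μ : Measure (EuclideanSpace ℝ (Fin n))) (k : ℝ) (W : ℕ → ℝ → ℝ≥0∞) (m : ℕ)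
    (C : ℝ≥0∞) : Prop :=
  ∀ ψ : ℝ → ℝ≥0∞, Measurable ψ →
    ∫⁻ x : Fin (m + 1) → EuclideanSpace ℝ (Fin n),
      ENNReal.ofReal (gramVolume x ^ k) * ψ (affineHeight x) ∂(Measure.pi fun _ => μ) =
    C * ∫⁻ q : ℝ, ENNReal.ofReal (|q| ^ ((n : ℝ) - m - 1)) * W m (q ^ 2) * ψ |q|

omit [IsProbabilityMeasure μ] in
/-- The height of a single vertex is its norm. -/
lemma hasHeightWeight_zero (h : WeightFamily μ κ k V W c I) (hn : 1 ≤ n) :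
    HasHeightWeight μ k W 0 (κ * halfSphereArea n) := by
  intro ψ hψ
  have h1 : ∀ x : Fin 1 → EuclideanSpace ℝ (Fin n),
      ENNReal.ofReal (gramVolume x ^ k) * ψ (affineHeight x) = ψ ‖x default‖ := by
    intro x
    have e1 : gramVolume x = 1 := by simp [gramVolume]
    have e2 : affineFoot x = x default := by
      have hbot : ∀ y ∈ Submodule.span ℝ (Set.range (edgeVectors x)), y = 0 := by
        rw [Set.range_eq_empty, Submodule.span_empty]
        exact fun y hy => (Submodule.mem_bot ℝ).1 hy
      rw [affineFoot, hbot _ (Submodule.starProjection_apply_mem _ _), sub_zero]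
      rfl
    rw [affineHeight_eq_norm_foot (by rw [e1]; exact one_ne_zero), e1, e2]
    simp
  have hV := h.measurable_V 0
  have h0 : ∫⁻ x : Fin 1 → EuclideanSpace ℝ (Fin n), ψ ‖x default‖ ∂(Measure.pi fun _ => μ) =
      ∫⁻ w, ψ ‖w‖ ∂μ :=
    (measurePreserving_funUnique μ (Fin 1)).lintegral_comp (f := fun w => ψ ‖w‖) (by fun_prop)
  rw [lintegral_congr h1, h0, h.eq_withDensity,
    lintegral_withDensity_eq_lintegral_mul _ (by fun_prop) (by fun_prop)]
  have h2 := lintegral_comp_norm (E := EuclideanSpace ℝ (Fin n)) finrank_euclideanSpace_fin hn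
    (f := fun r => κ * V 0 (r ^ 2) * ψ r) (by fun_prop)
  simp only [Pi.mul_apply]
  have h3 : ∀ q : ℝ, ENNReal.ofReal (|q| ^ ((n : ℝ) - 1)) * (κ * V 0 (|q| ^ 2) * ψ |q|) =
      κ * (ENNReal.ofReal (|q| ^ ((n : ℝ) - (0 : ℕ) - 1)) * W 0 (q ^ 2) * ψ |q|) := fun q => by
    rw [h.W_zero, sq_abs, Nat.cast_zero, sub_zero]
    ring
  have hW := h.measurable_W 0
  rw [h2, lintegral_congr h3, lintegral_const_mul _ (by fun_prop)]
  ring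

/-- Adding a vertex turns the height weight `W m` into `W (m + 1)`. -/
lemma hasHeightWeight_succ (h : WeightFamily μ κ k V W c I) {m : ℕ} (hm : m + 1 < n) {C : ℝ≥0∞}
    (hC : HasHeightWeight μ k W m C) :
    HasHeightWeight μ k W (m + 1) (2 * C * splitConst n κ c m * I m) := by
  intro ψ hψ
  have hV := h.measurable_V m
  have hW := h.measurable_W m
  have hW' := h.measurable_W (m + 1)
  -- the contribution of the new vertex depends on the previous ones only through their height
  let G : ℝ → ℝ≥0∞ := fun a => ∫⁻ z : ℝ × ℝ,
    ENNReal.ofReal (|z.2| ^ ((n : ℝ) - m - 1 - 1)) * V m (z.1 ^ 2 + z.2 ^ 2) *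
      (ENNReal.ofReal ((z.2 ^ 2 + (z.1 - a) ^ 2) ^ k) *
        ψ (a * |z.2| / √(z.2 ^ 2 + (z.1 - a) ^ 2)))
  have hG : Measurable G := Measurable.lintegral_prod_right' (f := fun p : ℝ × ℝ × ℝ =>
    ENNReal.ofReal (|p.2.2| ^ ((n : ℝ) - m - 1 - 1)) * V m (p.2.1 ^ 2 + p.2.2 ^ 2) *
      (ENNReal.ofReal ((p.2.2 ^ 2 + (p.2.1 - p.1) ^ 2) ^ k) *
        ψ (p.1 * |p.2.2| / √(p.2.2 ^ 2 + (p.2.1 - p.1) ^ 2)))) (by fun_prop)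
  have hinner : ∀ᵐ x ∂(Measure.pi fun _ : Fin (m + 1) => μ),
      ∫⁻ w, ENNReal.ofReal (gramVolume (Fin.cons w x : Fin (m + 2) → _) ^ k) *
        ψ (affineHeight (Fin.cons w x : Fin (m + 2) → _)) ∂μ =
      ENNReal.ofReal (gramVolume x ^ k) * (splitConst n κ c m * G (affineHeight x)) := by
    filter_upwards [ae_linearIndependent_vertexFrame h.measure_submodule_eq_zero m (by omega)]
      with x hx
    obtain ⟨hS, hh⟩ := gramVolume_ne_zero_of_linearIndependent hx
    have hfoot := affineHeight_eq_norm_foot hS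
    have hf0 : affineFoot x ≠ 0 := fun h => hh (by rw [hfoot, h, norm_zero])
    have hn0 : ‖affineFoot x‖ ≠ 0 := norm_ne_zero_iff.2 hf0
    set e := (‖affineFoot x‖)⁻¹ • affineFoot x with he
    have hen : ‖e‖ = 1 := by rw [he, norm_smul, norm_inv, norm_norm, inv_mul_cancel₀ hn0]
    have heU : e ∈ vertexSpan x := Submodule.smul_mem _ _ (affineFoot_mem_vertexSpan x)
    have hrank : Module.finrank ℝ (vertexSpan x) = m + 1 := by
      rw [vertexSpan, finrank_span_eq_card hx, Fintype.card_fin]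
    have h1 := lintegral_component_dist (h.measurable_V 0) h.eq_withDensity hm (h.marginal m)
      (h.measurable_V m) hrank heU hen
      (f := fun p => ENNReal.ofReal ((p.2 ^ 2 + (p.1 - affineHeight x) ^ 2) ^ k) *
        ψ (affineHeight x * p.2 / √(p.2 ^ 2 + (p.1 - affineHeight x) ^ 2))) (by fun_prop)
    simp only [sq_abs] at h1
    rw [splitConst, ← h1, ← lintegral_const_mul' _ _ ENNReal.ofReal_ne_top]
    refine lintegral_congr fun w => ?_
    rw [gramVolume_cons hf0, affineHeight_cons hS hh, ← he, ← hfoot,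
      Real.mul_rpow (gramVolume_nonneg x) (by positivity),
      ENNReal.ofReal_mul (Real.rpow_nonneg (gramVolume_nonneg x) k), mul_assoc]
  have hS : Measurable (gramVolume : (Fin (m + 2) → EuclideanSpace ℝ (Fin n)) → ℝ) :=
    continuous_gramVolume.measurable
  have hH : Measurable (affineHeight : (Fin (m + 2) → EuclideanSpace ℝ (Fin n)) → ℝ) :=
    measurable_affineHeight
  rw [lintegral_pi_cons (by fun_prop), lintegral_congr_ae hinner,
    hC (fun a => splitConst n κ c m * G a) (by fun_prop)]
  have heven := lintegral_comp_abs (f := fun a => ENNReal.ofReal (a ^ ((n : ℝ) - m - 1)) *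
    W m (a ^ 2) * (splitConst n κ c m * G a))
  simp only [sq_abs] at heven
  have hstep := lintegral_add_vertex hW hV hψ (h.pair m hm)
  have h2 : ∀ a : ℝ, ENNReal.ofReal (a ^ ((n : ℝ) - m - 1)) *
      W m (a ^ 2) * (splitConst n κ c m * G a) = splitConst n κ c m *
      (ENNReal.ofReal (a ^ ((n : ℝ) - m - 1)) * W m (a ^ 2) * G a) := fun a => by ring
  have h3 : ∀ q : ℝ, ENNReal.ofReal (|q| ^ ((n : ℝ) - m - 1 - 1)) * (I m * W (m + 1) (q ^ 2)) *
      ψ |q| = I m * (ENNReal.ofReal (|q| ^ ((n : ℝ) - (m + 1 : ℕ) - 1)) * W (m + 1) (q ^ 2) *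
      ψ |q|) := fun q => by
    rw [show (n : ℝ) - m - 1 - 1 = n - (m + 1 : ℕ) - 1 by push_cast; ring]
    ring
  rw [heven, lintegral_congr h2, lintegral_const_mul _ (by fun_prop), hstep, lintegral_congr h3,
    lintegral_const_mul _ (by fun_prop)]
  ring

lemma exists_hasHeightWeight (h : WeightFamily μ κ k V W c I) (m : ℕ) (hm : m < n) :
    ∃ C, HasHeightWeight μ k W m C := by
  induction m with
  | zero => exact ⟨_, h.hasHeightWeight_zero hm⟩
  | succ m ih =>
    obtain ⟨C, hC⟩ := ih (by omega)
    exact ⟨_, h.hasHeightWeight_succ hm hC⟩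

/-- Adding a vertex multiplies the `k`-th moment of the squared volume by an explicit factor. -/
theorem lintegral_gramVolume_succ (h : WeightFamily μ κ k V W c I) {m : ℕ} (hm : m + 1 < n)
    {i j w w' : ℝ} (hi : I m = ENNReal.ofReal i) (hj0 : 0 < j) (hw0 : 0 < w)
    (hi0 : 0 ≤ i)
    (hj : ∫⁻ z : ℝ × ℝ, ENNReal.ofReal (|z.2| ^ ((n : ℝ) - m - 1 - 1)) * V m (z.1 ^ 2 + z.2 ^ 2) =
      ENNReal.ofReal j)
    (hw : ∫⁻ q : ℝ, ENNReal.ofReal (|q| ^ ((n : ℝ) - m - 1)) * W m (q ^ 2) = ENNReal.ofReal w)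
    (hw' : ∫⁻ q : ℝ, ENNReal.ofReal (|q| ^ ((n : ℝ) - m - 1 - 1)) * W (m + 1) (q ^ 2) =
      ENNReal.ofReal w') :
    ∫⁻ x : Fin (m + 2) → EuclideanSpace ℝ (Fin n), ENNReal.ofReal (gramVolume x ^ k)
        ∂(Measure.pi fun _ => μ) =
      ENNReal.ofReal (2 * i * w' / (j * w)) *
      ∫⁻ x : Fin (m + 1) → EuclideanSpace ℝ (Fin n), ENNReal.ofReal (gramVolume x ^ k)
        ∂(Measure.pi fun _ => μ) := by
  obtain ⟨C, hC⟩ := h.exists_hasHeightWeight m (by omega)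
  have h1 := hC (fun _ => 1) measurable_const
  have h2 := h.hasHeightWeight_succ hm hC (fun _ => 1) measurable_const
  have h3 := h.splitConst_mul hm
  rw [hj] at h3
  have h4 : splitConst n κ c m = ENNReal.ofReal j⁻¹ := by
    rw [ENNReal.ofReal_inv_of_pos hj0]
    exact ENNReal.eq_inv_of_mul_eq_one_left h3
  simp only [mul_one] at h1 h2
  rw [show (n : ℝ) - (m + 1 : ℕ) - 1 = n - m - 1 - 1 by push_cast; ring, hw', hi, h4] at h2
  rw [hw] at h1
  rw [h1, h2, show 2 * i * w' / (j * w) = 2 * j⁻¹ * i * w⁻¹ * w' by field_simp,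
    ENNReal.ofReal_mul (by positivity), ENNReal.ofReal_mul (by positivity),
    ENNReal.ofReal_mul (by positivity), ENNReal.ofReal_mul (by positivity), ENNReal.ofReal_ofNat,
    ENNReal.ofReal_inv_of_pos hw0]
  have h5 : (ENNReal.ofReal w)⁻¹ * ENNReal.ofReal w = 1 :=
    ENNReal.inv_mul_cancel (by simpa using hw0) (by simp)
  calc 2 * C * ENNReal.ofReal j⁻¹ * ENNReal.ofReal i * ENNReal.ofReal w'
      = 2 * C * ENNReal.ofReal j⁻¹ * ENNReal.ofReal i * ENNReal.ofReal w' * 1 := by rw [mul_one]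
    _ = _ := by rw [← h5]; ring

end WeightFamily

/-! ### The moments in the Beta model -/

/-- Forgetting `m` coordinates raises the exponent of a Beta weight by `m / 2`. -/
lemma lintegral_betaWeight_norm (m : ℕ) (b q : ℝ) :
    ∫⁻ y : EuclideanSpace ℝ (Fin m), betaWeight b (q + ‖y‖ ^ 2) =
      (∫⁻ y : EuclideanSpace ℝ (Fin m), betaWeight b (‖y‖ ^ 2)) * betaWeight (b + m / 2) q := by
  by_cases hq : q < 1
  · set τ := √(1 - q) with hτ
    have hτ2 : 1 - q = τ ^ 2 := (Real.sq_sqrt (by linarith)).symm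
    have hτ0 : 0 < τ := Real.sqrt_pos.2 (by linarith)
    have hmap := Measure.map_addHaar_smul (volume : Measure (EuclideanSpace ℝ (Fin m))) hτ0.ne'
    have hvol : (volume : Measure (EuclideanSpace ℝ (Fin m))) =
        ENNReal.ofReal (τ ^ m) • Measure.map (τ • ·) volume := by
      rw [hmap, finrank_euclideanSpace_fin, smul_smul, abs_of_pos (by positivity),
        ← ENNReal.ofReal_mul (by positivity), mul_inv_cancel₀ (by positivity), ENNReal.ofReal_one,
        one_smul]
    conv_lhs => rw [hvol]
    rw [lintegral_smul_measure, lintegral_map (by fun_prop) (by fun_prop)]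
    have h1 : ∀ y : EuclideanSpace ℝ (Fin m), betaWeight b (q + ‖τ • y‖ ^ 2) =
        ENNReal.ofReal (τ ^ (2 * b)) * betaWeight b (‖y‖ ^ 2) := fun y => by
      rw [norm_smul, Real.norm_of_nonneg hτ0.le, mul_pow, betaWeight_scale hτ0 _ _ hτ2]
    rw [lintegral_congr h1, lintegral_const_mul _ (by fun_prop),
      show betaWeight (b + m / 2) q = ENNReal.ofReal ((1 - q) ^ (b + m / 2 : ℝ)) from if_pos hq,
      smul_eq_mul, ← mul_assoc, mul_comm, ← ENNReal.ofReal_mul (by positivity), hτ2]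
    congr 2
    rw [← Real.rpow_natCast τ 2, ← Real.rpow_mul hτ0.le, ← Real.rpow_natCast τ m,
      ← Real.rpow_add hτ0]
    congr 1
    push_cast
    ring
  · have h1 : ∀ y : EuclideanSpace ℝ (Fin m), betaWeight b (q + ‖y‖ ^ 2) = 0 := fun y => by
      rw [betaWeight, if_neg]
      nlinarith [sq_nonneg ‖y‖]
    simp only [h1, lintegral_zero]
    rw [betaWeight, if_neg hq, mul_zero]

/-- The exponents of the tilted height weights in the Beta model: each new vertex adds the exponent
of its own marginal and `M / 2 + 1`, where `M = n - m - 1 + 2k` is the power of the distance in the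
two-point integral. -/
noncomputable def betaExponent (n : ℕ) (ν k : ℝ) (m : ℕ) : ℝ :=
  (ν - 2) / 2 + m * ((ν - 2) / 2 + (n + 1) / 2 + k)

/-- In the Beta model all weights are Beta weights. -/
lemma weightFamily_beta {n : ℕ} {ν k : ℝ} :
    WeightFamily (volume.withDensity fun x : EuclideanSpace ℝ (Fin n) =>
        ENNReal.ofReal (betaDensity ν n x))
      (ENNReal.ofReal (1 / Real.pi ^ ((n : ℝ) / 2) *
        (Real.Gamma ((n + ν) / 2) / Real.Gamma (ν / 2)))) k
      (fun m => betaWeight ((ν - 2) / 2 + m / 2)) (fun m => betaWeight (betaExponent n ν k m))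
      (fun m => ∫⁻ y : EuclideanSpace ℝ (Fin m), betaWeight ((ν - 2) / 2) (‖y‖ ^ 2))
      (fun m => betaPair ((n : ℝ) - m - 1 + 2 * k) (betaExponent n ν k m)
        ((ν - 2) / 2 + m / 2)) where
  eq_withDensity := by
    congr 1
    funext x
    have h1 : ‖x‖ < 1 ↔ ‖x‖ ^ 2 < 1 := by
      rw [sq_lt_one_iff₀ (norm_nonneg x)]
    by_cases hx : ‖x‖ < 1
    · have h2 : 0 ≤ (1 - ‖x‖ ^ 2) ^ ((ν - 2) / 2) :=
        Real.rpow_nonneg (by linarith [h1.1 hx]) _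
      simp only [betaDensity, if_pos hx, betaWeight, if_pos (h1.1 hx), CharP.cast_eq_zero, zero_div,
        add_zero]
      rw [ENNReal.ofReal_mul' h2]
    · simp [betaDensity, betaWeight, hx]
  measurable_V m := by fun_prop
  measurable_W m := by fun_prop
  W_zero := by simp [betaExponent]
  marginal m q := by
    simp only [CharP.cast_eq_zero, zero_div, add_zero]
    exact lintegral_betaWeight_norm m _ q
  pair m hm q := by
    rw [lintegral_betaWeight_pair]
    congr 2
    simp only [betaExponent]
    push_cast
    ring

lemma betaExponent_gt {n : ℕ} {ν k : ℝ} (hn : 1 ≤ n) (hν : 0 < ν) (hk : 0 ≤ k) (m : ℕ) :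
    -1 < betaExponent n ν k m := by
  have h1 : (1 : ℝ) ≤ n := by exact_mod_cast hn
  have h2 : 0 ≤ (m : ℝ) * ((ν - 2) / 2 + (n + 1) / 2 + k) := by
    have : 0 ≤ (ν - 2) / 2 + (n + 1) / 2 + k := by linarith
    positivity
  unfold betaExponent
  linarith

/-- The factor of `lintegral_gramVolume_succ` in the Beta model. The first two quotients make up a
factor of the product in `betaMoment`, the other two are the growth of the rest of it. -/
lemma beta_factor {N k B b : ℝ} (hN : 0 < N) (hk : 0 ≤ k) (hB : -1 < B) (hb : -1 < b) :
    2 * (beta ((N + 2 * k + 1) / 2) (B + 1) / 2 *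
      (beta (1 / 2) (b + 1) * beta ((N + 2 * k) / 2) (b + 3 / 2)) /
      beta ((N + 2 * k) / 2) (B + b + (N + 2 * k) / 2 + 2)) *
      beta (N / 2) (B + b + (N + 2 * k) / 2 + 1 + 1) /
      (beta (1 / 2) (b + 1) * beta (N / 2) (b + 3 / 2) * beta ((N + 1) / 2) (B + 1)) =
    (Real.Gamma ((N + 1) / 2 + k) / Real.Gamma ((N + 1) / 2) *
      (Real.Gamma (b + N / 2 + 3 / 2) / Real.Gamma (b + N / 2 + 3 / 2 + k))) *
      (Real.Gamma (B + b + N + 2 * k + 2) / Real.Gamma (B + b + N + k + 2) *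
        (Real.Gamma (B + (N + 3) / 2) / Real.Gamma (B + (N + 3) / 2 + k))) := by
  have hc : beta (1 / 2) (b + 1) ≠ 0 := (beta_pos (by norm_num) (by linarith)).ne'
  set c := beta (1 / 2) (b + 1)
  simp only [beta]
  rw [show (N + 2 * k + 1) / 2 = (N + 1) / 2 + k by ring,
    show (N + 1) / 2 + k + (B + 1) = B + (N + 3) / 2 + k by ring,
    show (N + 2 * k) / 2 + (b + 3 / 2) = b + N / 2 + 3 / 2 + k by ring,
    show (N + 2 * k) / 2 + (B + b + (N + 2 * k) / 2 + 2) = B + b + N + 2 * k + 2 by ring,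
    show B + b + (N + 2 * k) / 2 + 1 + 1 = B + b + (N + 2 * k) / 2 + 2 by ring,
    show N / 2 + (B + b + (N + 2 * k) / 2 + 2) = B + b + N + k + 2 by ring,
    show N / 2 + (b + 3 / 2) = b + N / 2 + 3 / 2 by ring,
    show (N + 1) / 2 + (B + 1) = B + (N + 3) / 2 by ring]
  have p : ∀ {x : ℝ}, 0 < x → Real.Gamma x ≠ 0 := fun h => (Real.Gamma_pos_of_pos h).ne'
  have h1 : Real.Gamma ((N + 1) / 2 + k) ≠ 0 := p (by linarith)
  have h2 : Real.Gamma (B + 1) ≠ 0 := p (by linarith)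
  have h3 : Real.Gamma (B + (N + 3) / 2 + k) ≠ 0 := p (by linarith)
  have h4 : Real.Gamma ((N + 2 * k) / 2) ≠ 0 := p (by linarith)
  have h5 : Real.Gamma (b + 3 / 2) ≠ 0 := p (by linarith)
  have h6 : Real.Gamma (b + N / 2 + 3 / 2 + k) ≠ 0 := p (by linarith)
  have h7 : Real.Gamma (B + b + (N + 2 * k) / 2 + 2) ≠ 0 := p (by linarith)
  have h8 : Real.Gamma (B + b + N + 2 * k + 2) ≠ 0 := p (by linarith)
  have h9 : Real.Gamma (N / 2) ≠ 0 := p (by linarith)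
  have h10 : Real.Gamma (B + b + N + k + 2) ≠ 0 := p (by linarith)
  have h11 : Real.Gamma (b + N / 2 + 3 / 2) ≠ 0 := p (by linarith)
  have h12 : Real.Gamma ((N + 1) / 2) ≠ 0 := p (by linarith)
  have h13 : Real.Gamma (B + (N + 3) / 2) ≠ 0 := p (by linarith)
  generalize Real.Gamma ((N + 1) / 2 + k) = g1 at *
  generalize Real.Gamma (B + 1) = g2 at *
  generalize Real.Gamma (B + (N + 3) / 2 + k) = g3 at *
  generalize Real.Gamma ((N + 2 * k) / 2) = g4 at *
  generalize Real.Gamma (b + 3 / 2) = g5 at *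
  generalize Real.Gamma (b + N / 2 + 3 / 2 + k) = g6 at *
  generalize Real.Gamma (B + b + (N + 2 * k) / 2 + 2) = g7 at *
  generalize Real.Gamma (B + b + N + 2 * k + 2) = g8 at *
  generalize Real.Gamma (N / 2) = g9 at *
  generalize Real.Gamma (B + b + N + k + 2) = g10 at *
  generalize Real.Gamma (b + N / 2 + 3 / 2) = g11 at *
  generalize Real.Gamma ((N + 1) / 2) = g12 at *
  generalize Real.Gamma (B + (N + 3) / 2) = g13 at *
  field_simp

/-- The `k`-th moment of the squared normalized volume of a simplex with `m + 1` vertices in the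
Beta model with parameter `ν` (in the spherical model for `ν = 0`). -/
noncomputable def betaMoment (n : ℕ) (ν k : ℝ) (m : ℕ) : ℝ :=
  (∏ j ∈ Finset.range m, Real.Gamma (((n : ℝ) - j) / 2 + k) / Real.Gamma (((n : ℝ) - j) / 2) *
    (Real.Gamma ((n + ν) / 2) / Real.Gamma ((n + ν) / 2 + k))) *
  (Real.Gamma ((n + ν) / 2 + m * ((n + ν) / 2 - 1) + (m + 1) * k) /
    Real.Gamma ((n + ν) / 2 + m * ((n + ν) / 2 - 1) + m * k) *
    (Real.Gamma ((n + ν) / 2) / Real.Gamma ((n + ν) / 2 + k)))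

/-- The moments of all nonnegative real orders of the volume in the Beta model. -/
theorem lintegral_gramVolume_beta {n : ℕ} {ν k : ℝ} (hν : 0 < ν) (hk : 0 ≤ k)
    [IsProbabilityMeasure (volume.withDensity fun x : EuclideanSpace ℝ (Fin n) =>
        ENNReal.ofReal (betaDensity ν n x))] (m : ℕ) (hm : m < n) :
    ∫⁻ x : Fin (m + 1) → EuclideanSpace ℝ (Fin n), ENNReal.ofReal (gramVolume x ^ k)
        ∂(Measure.pi fun _ => volume.withDensity fun x => ENNReal.ofReal (betaDensity ν n x)) =
      ENNReal.ofReal (betaMoment n ν k m) := by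
  have p : ∀ {x : ℝ}, 0 < x → 0 < Real.Gamma x := fun h => Real.Gamma_pos_of_pos h
  induction m with
  | zero =>
    have hb : (0 : ℝ) < (n + ν) / 2 := by positivity
    have h1 : ∀ x : Fin 1 → EuclideanSpace ℝ (Fin n), gramVolume x = 1 := fun x => by
      simp [gramVolume]
    have h2 := (p hb).ne'
    have h3 := (p (add_pos_of_pos_of_nonneg hb hk)).ne'
    simp only [h1, Real.one_rpow, ENNReal.ofReal_one, lintegral_one, betaMoment, Finset.range_zero,
      Finset.prod_empty, Nat.cast_zero, zero_mul, add_zero, zero_add, one_mul, measure_univ]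
    rw [div_mul_div_cancel₀ h2, div_self h3, ENNReal.ofReal_one]
  | succ m ih =>
    have hmn : (m : ℝ) + 1 < n := by exact_mod_cast hm
    have hm0 : (0 : ℝ) ≤ m := Nat.cast_nonneg m
    have hB := betaExponent_gt (n := n) (k := k) (by omega) hν hk m
    have hB' := betaExponent_gt (n := n) (k := k) (by omega) hν hk (m + 1)
    have hb : -1 < (ν - 2) / 2 + (m : ℝ) / 2 := by linarith
    have hN : 0 < (n : ℝ) - m - 1 := by linarith
    have hB1 : betaExponent n ν k (m + 1) = betaExponent n ν k m + ((ν - 2) / 2 + (m : ℝ) / 2) +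
        ((n : ℝ) - m - 1 + 2 * k) / 2 + 1 := by
      simp only [betaExponent]
      push_cast
      ring
    have hw := lintegral_betaWeight (m := (n : ℝ) - m) (by linarith) hB
    have hw' := lintegral_betaWeight hN hB'
    have q1 := beta_pos (α := 1 / 2) (β := (ν - 2) / 2 + (m : ℝ) / 2 + 1) (by norm_num)
      (by linarith)
    have q2 := beta_pos (α := ((n : ℝ) - m - 1) / 2) (β := (ν - 2) / 2 + (m : ℝ) / 2 + 3 / 2)
      (by linarith) (by linarith)
    have q3 := beta_pos (α := ((n : ℝ) - m) / 2) (β := betaExponent n ν k m + 1)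
      (by linarith) (by linarith)
    have q4 := beta_pos (α := ((n : ℝ) - m - 1 + 2 * k + 1) / 2) (β := betaExponent n ν k m + 1)
      (by linarith) (by linarith)
    have q5 := beta_pos (α := ((n : ℝ) - m - 1 + 2 * k) / 2)
      (β := (ν - 2) / 2 + (m : ℝ) / 2 + 3 / 2) (by linarith) (by linarith)
    have q6 := beta_pos (α := ((n : ℝ) - m - 1 + 2 * k) / 2)
      (β := betaExponent n ν k m + ((ν - 2) / 2 + (m : ℝ) / 2) +
        ((n : ℝ) - m - 1 + 2 * k) / 2 + 2) (by linarith) (by linarith)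
    have h := (weightFamily_beta (n := n) (ν := ν) (k := k)).lintegral_gramVolume_succ hm
      (betaPair_eq (by linarith) hB hb) (mul_pos q1 q2) q3 (by positivity)
      (lintegral_betaWeight_plane hN hb) hw hw'
    rw [h, ih (by omega), hB1]
    have hf := beta_factor (b := (ν - 2) / 2 + (m : ℝ) / 2) hN hk hB hb
    rw [show (n : ℝ) - m - 1 + 1 = n - m by ring] at hf
    rw [hf, show ((ν - 2) / 2 + (m : ℝ) / 2) + ((n : ℝ) - m - 1) / 2 + 3 / 2 = (n + ν) / 2 by ring,
      show betaExponent n ν k m + ((n : ℝ) - m - 1 + 3) / 2 =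
        (n + ν) / 2 + m * ((n + ν) / 2 - 1) + m * k by simp only [betaExponent]; ring,
      show (n + ν) / 2 + m * ((n + ν) / 2 - 1) + m * k + k =
        (n + ν) / 2 + m * ((n + ν) / 2 - 1) + (m + 1) * k by ring,
      show betaExponent n ν k m + ((ν - 2) / 2 + (m : ℝ) / 2) + ((n : ℝ) - m - 1) + 2 * k + 2 =
        (n + ν) / 2 + (m + 1 : ℕ) * ((n + ν) / 2 - 1) + ((m + 1 : ℕ) + 1) * k by
          simp only [betaExponent]; push_cast; ring,
      show betaExponent n ν k m + ((ν - 2) / 2 + (m : ℝ) / 2) + ((n : ℝ) - m - 1) + k + 2 =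
        (n + ν) / 2 + (m + 1 : ℕ) * ((n + ν) / 2 - 1) + (m + 1 : ℕ) * k by
          simp only [betaExponent]; push_cast; ring]
    have hbb : 1 / 2 < ((n : ℝ) + ν) / 2 := by linarith
    have hn2 : (2 : ℝ) ≤ n := by exact_mod_cast (by omega : 2 ≤ n)
    have hN0 : 0 ≤ ((n : ℝ) + ν) / 2 - 1 := by linarith
    have g3 := p (x := (n + ν) / 2 + m * ((n + ν) / 2 - 1) + (m + 1) * k) (by positivity)
    have g13 := p (x := (n + ν) / 2 + m * ((n + ν) / 2 - 1) + m * k) (by positivity)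
    have g12 := p (x := ((n : ℝ) - m) / 2) (by linarith)
    have g1 := p (x := ((n : ℝ) - m) / 2 + k) (by linarith)
    have g11 := p (x := ((n : ℝ) + ν) / 2) (by linarith)
    have g6 := p (x := ((n : ℝ) + ν) / 2 + k) (by linarith)
    have g8 := p (x := (n + ν) / 2 + (m + 1 : ℕ) * ((n + ν) / 2 - 1) + ((m + 1 : ℕ) + 1) * k)
      (by positivity)
    have g10 := p (x := (n + ν) / 2 + (m + 1 : ℕ) * ((n + ν) / 2 - 1) + (m + 1 : ℕ) * k)
      (by positivity)
    rw [← ENNReal.ofReal_mul (by positivity)]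
    congr 1
    simp only [betaMoment, Finset.prod_range_succ]
    have e3 := g3.ne'
    have e13 := g13.ne'
    generalize Real.Gamma ((n + ν) / 2 + m * ((n + ν) / 2 - 1) + (m + 1) * k) = x3 at e3 ⊢
    generalize Real.Gamma ((n + ν) / 2 + m * ((n + ν) / 2 - 1) + m * k) = x13 at e13 ⊢
    generalize (∏ j ∈ Finset.range m, _ : ℝ) = Q
    field_simp

/-! ### The moments in the Gaussian model -/

lemma lintegral_pi_prod {n : ℕ} {μ : Measure ℝ} [SigmaFinite μ] {f : Fin n → ℝ → ℝ≥0∞}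
    (hf : ∀ i, Measurable (f i)) :
    ∫⁻ x : Fin n → ℝ, ∏ i, f i (x i) ∂(Measure.pi fun _ => μ) = ∏ i, ∫⁻ t, f i t ∂μ := by
  induction n with
  | zero => simp
  | succ n ih =>
    rw [lintegral_pi_cons (by fun_prop)]
    simp only [Fin.prod_univ_succ, Fin.cons_zero, Fin.cons_succ]
    have h : ∀ x : Fin n → ℝ, ∫⁻ w, f 0 w * ∏ i : Fin n, f i.succ (x i) ∂μ =
        (∫⁻ w, f 0 w ∂μ) * ∏ i : Fin n, f i.succ (x i) := fun x => lintegral_mul_const _ (hf 0)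
    rw [lintegral_congr h, lintegral_const_mul _ (by fun_prop), ih fun i => hf _]

lemma pi_withDensity_real {n : ℕ} {f : ℝ → ℝ≥0∞} (hf : Measurable f)
    [SigmaFinite (volume.withDensity f)] :
    (Measure.pi fun _ : Fin n => volume.withDensity f) =
      (volume : Measure (Fin n → ℝ)).withDensity fun x => ∏ i, f (x i) := by
  refine (Measure.pi_eq fun s hs => ?_)
  rw [withDensity_apply _ (MeasurableSet.univ_pi hs),
    ← lintegral_indicator (MeasurableSet.univ_pi hs),
    volume_pi]
  have h : ∀ x : Fin n → ℝ, (Set.univ.pi s).indicator (fun x => ∏ i, f (x i)) x =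
      ∏ i, (s i).indicator f (x i) := by
    intro x
    by_cases hx : x ∈ Set.univ.pi s
    · rw [Set.indicator_of_mem hx]
      exact Finset.prod_congr rfl fun i _ =>
        (Set.indicator_of_mem (hx i (Set.mem_univ i)) f).symm
    · rw [Set.indicator_of_notMem hx]
      obtain ⟨i, hi⟩ : ∃ i, x i ∉ s i := by simpa [Set.mem_univ_pi] using hx
      exact (Finset.prod_eq_zero (Finset.mem_univ i) (Set.indicator_of_notMem hi f)).symm
  rw [lintegral_congr h, lintegral_pi_prod fun i => hf.indicator (hs i)]
  exact Finset.prod_congr rfl fun i _ => by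
    rw [lintegral_indicator (hs i), withDensity_apply _ (hs i)]

lemma stdGaussian_eq_withDensity (n : ℕ) :
    stdGaussian (EuclideanSpace ℝ (Fin n)) = volume.withDensity fun x =>
      ENNReal.ofReal ((√(2 * Real.pi))⁻¹ ^ n) * gaussWeight 1 (‖x‖ ^ 2) := by
  have hd : gaussianReal 0 1 = volume.withDensity (gaussianPDF 0 1) :=
    gaussianReal_of_var_ne_zero _ one_ne_zero
  have : SigmaFinite ((volume : Measure ℝ).withDensity (gaussianPDF 0 1)) := by
    rw [← hd]; infer_instance
  have hmeas : Measurable (gaussianPDF 0 1) := measurable_gaussianPDF 0 1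
  have hmp := (EuclideanSpace.volume_preserving_symm_measurableEquiv_toLp (Fin n)).symm
  rw [← map_pi_eq_stdGaussian, hd, pi_withDensity_real hmeas]
  ext s hs
  rw [Measure.map_apply (by fun_prop) hs, withDensity_apply _ hs,
    withDensity_apply _ (hs.preimage (by fun_prop)), ← lintegral_indicator hs,
    ← lintegral_indicator (hs.preimage (by fun_prop))]
  rw [← hmp.lintegral_comp (by
    refine Measurable.indicator (by fun_prop) hs)]
  refine lintegral_congr fun x => ?_
  have hx : ∏ i, gaussianPDF 0 1 (x i) = ENNReal.ofReal ((√(2 * Real.pi))⁻¹ ^ n) *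
      gaussWeight 1 (‖WithLp.toLp 2 x‖ ^ 2) := by
    rw [gaussWeight, ← ENNReal.ofReal_mul (by positivity), EuclideanSpace.real_norm_sq_eq]
    simp only [gaussianPDF, gaussianPDFReal]
    rw [← ENNReal.ofReal_prod_of_nonneg fun i _ => by positivity, Finset.prod_mul_distrib,
      Finset.prod_const, ← Real.exp_sum]
    simp [Finset.sum_div, neg_div, Finset.sum_neg_distrib]
  by_cases h : WithLp.toLp 2 x ∈ s
  · rw [Set.indicator_of_mem (by exact h), hx]
    exact (Set.indicator_of_mem (a := WithLp.toLp 2 x) h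
      (fun y : EuclideanSpace ℝ (Fin n) =>
      ENNReal.ofReal ((√(2 * Real.pi))⁻¹ ^ n) * gaussWeight 1 (‖y‖ ^ 2))).symm
  · rw [Set.indicator_of_notMem (by exact h)]
    exact (Set.indicator_of_notMem (a := WithLp.toLp 2 x) h
      (fun y : EuclideanSpace ℝ (Fin n) =>
      ENNReal.ofReal ((√(2 * Real.pi))⁻¹ ^ n) * gaussWeight 1 (‖y‖ ^ 2))).symm

/-- In the Gaussian model all weights are Gaussian, since the density is a product of functions of
orthogonal coordinates; the precision of the height grows by `1` with each vertex. -/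
lemma weightFamily_gaussian (n : ℕ) (k : ℝ) :
    WeightFamily (stdGaussian (EuclideanSpace ℝ (Fin n)))
      (ENNReal.ofReal ((√(2 * Real.pi))⁻¹ ^ n)) k (fun _ => gaussWeight 1)
      (fun m => gaussWeight (m + 1))
      (fun m => ∫⁻ y : EuclideanSpace ℝ (Fin m), gaussWeight 1 (‖y‖ ^ 2))
      (fun m => gaussPair ((n : ℝ) - m - 1 + 2 * k) (m + 1)) where
  eq_withDensity := stdGaussian_eq_withDensity n
  measurable_V m := by fun_prop
  measurable_W m := by fun_prop
  W_zero := by simp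
  marginal m q := by
    simp only [gaussWeight_add]
    rw [lintegral_const_mul _ (by fun_prop), mul_comm]
  pair m hm q := by
    rw [lintegral_gaussWeight_pair]
    push_cast
    rfl

/-- The factor of `lintegral_gramVolume_succ` in the Gaussian model. -/
lemma gauss_factor {N k a : ℝ} (hN : 0 < N) (hk : 0 ≤ k) (ha : 0 < a) :
    2 * (gaussMass (N + 2 * k + 1) a / 2 * (gaussMass 1 1 * gaussMass (N + 2 * k) 1) /
      gaussMass (N + 2 * k) (a + 1)) * gaussMass N (a + 1) /
      (gaussMass 1 1 * gaussMass N 1 * gaussMass (N + 1) a) =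
    (2 * ((a + 1) / a)) ^ k * (Real.Gamma ((N + 1) / 2 + k) / Real.Gamma ((N + 1) / 2)) := by
  have hc : gaussMass 1 1 ≠ 0 := (gaussMass_pos one_pos one_pos).ne'
  have p : ∀ {x : ℝ}, 0 < x → Real.Gamma x ≠ 0 := fun h => (Real.Gamma_pos_of_pos h).ne'
  set c := gaussMass 1 1
  have key : ∀ {y : ℝ}, 0 < y → ∀ x : ℝ, y ^ (x + k) = y ^ x * y ^ k :=
    fun hy x => Real.rpow_add hy x k
  have hpow : (2 * ((a + 1) / a)) ^ k = (2 / a) ^ k * (2 / 1 : ℝ) ^ k / (2 / (a + 1)) ^ k := by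
    rw [← Real.mul_rpow (by positivity) (by positivity), ← Real.div_rpow (by positivity)
      (by positivity)]
    congr 1
    field_simp
  rw [hpow]
  simp only [gaussMass]
  rw [show (N + 2 * k + 1) / 2 = (N + 1) / 2 + k by ring,
    show (N + 2 * k) / 2 = N / 2 + k by ring, key (by positivity), key (by positivity),
    key (by positivity)]
  have h1 := p (x := (N + 1) / 2 + k) (by linarith)
  have h2 := p (x := (N + 1) / 2) (by linarith)
  have h3 := p (x := N / 2 + k) (by linarith)
  have h4 := p (x := N / 2) (by linarith)
  have r1 : ∀ x : ℝ, (2 / a) ^ x ≠ 0 := fun x => (Real.rpow_pos_of_pos (by positivity) x).ne'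
  have r2 : ∀ x : ℝ, (2 / (a + 1)) ^ x ≠ 0 := fun x =>
    (Real.rpow_pos_of_pos (by positivity) x).ne'
  have r3 : ∀ x : ℝ, (2 / 1 : ℝ) ^ x ≠ 0 := fun x =>
    (Real.rpow_pos_of_pos (by positivity) x).ne'
  have s1 := r1 k
  have s2 := r2 k
  have s3 := r3 k
  have s4 := r1 ((N + 1) / 2)
  have s5 := r2 (N / 2)
  have s6 := r3 (N / 2)
  generalize Real.Gamma ((N + 1) / 2 + k) = g1 at *
  generalize Real.Gamma ((N + 1) / 2) = g2 at *
  generalize Real.Gamma (N / 2 + k) = g3 at *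
  generalize Real.Gamma (N / 2) = g4 at *
  generalize (2 / a) ^ k = u1 at *
  generalize (2 / (a + 1)) ^ k = u2 at *
  generalize (2 / 1 : ℝ) ^ k = u3 at *
  generalize (2 / a) ^ ((N + 1) / 2) = u4 at *
  generalize (2 / (a + 1)) ^ (N / 2) = u5 at *
  generalize (2 / 1 : ℝ) ^ (N / 2) = u6 at *
  field_simp

/-- The `k`-th moment of the squared normalized volume of a simplex with `m + 1` vertices in the
Gaussian model. -/
noncomputable def gaussMoment (n : ℕ) (k : ℝ) (m : ℕ) : ℝ :=
  ((2 : ℝ) ^ m * (m + 1)) ^ k *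
    ∏ j ∈ Finset.range m, Real.Gamma (((n : ℝ) - j) / 2 + k) / Real.Gamma (((n : ℝ) - j) / 2)

/-- The moments of all nonnegative real orders of the volume in the Gaussian model. -/
theorem lintegral_gramVolume_gaussian {n : ℕ} {k : ℝ} (hk : 0 ≤ k) (m : ℕ) (hm : m < n) :
    ∫⁻ x : Fin (m + 1) → EuclideanSpace ℝ (Fin n), ENNReal.ofReal (gramVolume x ^ k)
        ∂(Measure.pi fun _ => stdGaussian (EuclideanSpace ℝ (Fin n))) =
      ENNReal.ofReal (gaussMoment n k m) := by
  induction m with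
  | zero =>
    have h1 : ∀ x : Fin 1 → EuclideanSpace ℝ (Fin n), gramVolume x = 1 := fun x => by
      simp [gramVolume]
    simp [h1, gaussMoment]
  | succ m ih =>
    have hmn : (m : ℝ) + 1 < n := by exact_mod_cast hm
    have hm0 : (0 : ℝ) ≤ m := Nat.cast_nonneg m
    have hN : 0 < (n : ℝ) - m - 1 := by linarith
    have ha : (0 : ℝ) < m + 1 := by positivity
    have q1 := gaussMass_pos (m := 1) (a := 1) one_pos one_pos
    have q2 := gaussMass_pos (m := (n : ℝ) - m - 1) (a := 1) hN one_pos
    have q3 := gaussMass_pos (m := (n : ℝ) - m) (a := m + 1) (by linarith) ha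
    have q4 := gaussMass_pos (m := (n : ℝ) - m - 1 + 2 * k + 1) (a := m + 1) (by linarith) ha
    have q5 := gaussMass_pos (m := (n : ℝ) - m - 1 + 2 * k) (a := 1) (by linarith) one_pos
    have q6 := gaussMass_pos (m := (n : ℝ) - m - 1 + 2 * k) (a := m + 1 + 1) (by linarith)
      (by linarith)
    have hw := lintegral_gaussWeight (m := (n : ℝ) - m) (a := m + 1) (by linarith) ha
    have hw' := lintegral_gaussWeight (m := (n : ℝ) - m - 1) (a := m + 1 + 1) hN (by linarith)
    have h := (weightFamily_gaussian n k).lintegral_gramVolume_succ hm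
      (gaussPair_eq (by linarith) ha) (mul_pos q1 q2) q3 (by positivity)
      (lintegral_gaussWeight_plane hN) hw (by push_cast; exact hw')
    have hf := gauss_factor (a := m + 1) hN hk ha
    rw [show (n : ℝ) - m - 1 + 1 = n - m by ring] at hf
    have g1 := Real.Gamma_pos_of_pos (s := ((n : ℝ) - m) / 2 + k) (by linarith)
    have g2 := Real.Gamma_pos_of_pos (s := ((n : ℝ) - m) / 2) (by linarith)
    rw [h, ih (by omega), hf, ← ENNReal.ofReal_mul (by positivity)]
    congr 1
    simp only [gaussMoment, Finset.prod_range_succ]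
    have hp : ((2 : ℝ) ^ (m + 1) * ((m + 1 : ℕ) + 1)) ^ k =
        (2 * (((m : ℝ) + 1 + 1) / (m + 1))) ^ k * ((2 : ℝ) ^ m * (m + 1)) ^ k := by
      rw [← Real.mul_rpow (by positivity) (by positivity)]
      congr 1
      push_cast
      field_simp
      ring
    rw [hp]
    ring

/-! ### The spherical model as a limit of Beta models -/

lemma toSphere_univ_eq {n : ℕ} (hn : 1 ≤ n) :
    (volume : Measure (EuclideanSpace ℝ (Fin n))).toSphere Set.univ =
      ENNReal.ofReal (2 * Real.pi ^ ((n : ℝ) / 2) / Real.Gamma (n / 2)) := by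
  have : Nonempty (Fin n) := ⟨⟨0, hn⟩⟩
  have hn0 : (0 : ℝ) < n := by exact_mod_cast hn
  rw [Measure.toSphere_apply_univ, EuclideanSpace.volume_ball, finrank_euclideanSpace_fin,
    Fintype.card_fin, ENNReal.ofReal_one, one_pow, one_mul, ← ENNReal.ofReal_natCast,
    ← ENNReal.ofReal_mul hn0.le, Real.Gamma_add_one (by positivity), Real.sqrt_eq_rpow,
    ← Real.rpow_mul_natCast Real.pi_pos.le]
  congr 1
  have h := (Real.Gamma_pos_of_pos (s := (n : ℝ) / 2) (by positivity)).ne'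
  rw [show (1 / 2 * (n : ℝ)) = n / 2 by ring]
  field_simp

/-- The law of the norm of a point in the Beta model. -/
noncomputable def radialLaw (n : ℕ) (ν : ℝ) : Measure ℝ :=
  (volume.restrict (Set.Ioi 0)).withDensity fun r =>
    ENNReal.ofReal (2 / beta (n / 2) (ν / 2)) *
      (ENNReal.ofReal (r ^ ((n : ℝ) - 1)) * betaWeight ((ν - 2) / 2) (r ^ 2))

lemma lintegral_radialLaw (n : ℕ) (ν : ℝ) {f : ℝ → ℝ≥0∞} (hf : Measurable f) :
    ∫⁻ r, f r ∂(radialLaw n ν) = ENNReal.ofReal (2 / beta (n / 2) (ν / 2)) *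
      ∫⁻ r in Set.Ioi (0 : ℝ), ENNReal.ofReal (r ^ ((n : ℝ) - 1)) *
        betaWeight ((ν - 2) / 2) (r ^ 2) * f r := by
  rw [radialLaw, lintegral_withDensity_eq_lintegral_mul _ (by fun_prop) hf,
    ← lintegral_const_mul _ (by fun_prop)]
  refine lintegral_congr fun r => ?_
  simp only [Pi.mul_apply]
  ring

lemma isProbabilityMeasure_radialLaw {n : ℕ} (hn : 1 ≤ n) {ν : ℝ} (hν : 0 < ν) :
    IsProbabilityMeasure (radialLaw n ν) := by
  have hn0 : (0 : ℝ) < n := by exact_mod_cast hn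
  have hb := beta_pos (α := (n : ℝ) / 2) (β := ν / 2) (by positivity) (by positivity)
  constructor
  rw [← lintegral_one, lintegral_radialLaw _ _ measurable_const]
  simp only [mul_one]
  rw [setLIntegral_betaWeight hn0 (by linarith), ← ENNReal.ofReal_mul (by positivity),
    show (ν - 2) / 2 + 1 = ν / 2 by ring, div_mul_div_cancel₀ hb.ne', div_self two_ne_zero,
    ENNReal.ofReal_one]

/-- The mean of `1 - ‖X‖²` in the Beta model tends to `0` with `ν`. -/
lemma lintegral_one_sub_sq_radialLaw {n : ℕ} (hn : 1 ≤ n) {ν : ℝ} (hν : 0 < ν) :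
    ∫⁻ r, ENNReal.ofReal (1 - r ^ 2) ∂(radialLaw n ν) = ENNReal.ofReal (ν / (n + ν)) := by
  have hn0 : (0 : ℝ) < n := by exact_mod_cast hn
  have hb := beta_pos (α := (n : ℝ) / 2) (β := ν / 2) (by positivity) (by positivity)
  have hw : ∀ r : ℝ, betaWeight ((ν - 2) / 2) (r ^ 2) * ENNReal.ofReal (1 - r ^ 2) =
      betaWeight (ν / 2) (r ^ 2) := by
    intro r
    by_cases hr : r ^ 2 < 1
    · rw [betaWeight, betaWeight, if_pos hr, if_pos hr,
        ← ENNReal.ofReal_mul (Real.rpow_nonneg (by linarith) _)]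
      congr 1
      rw [← Real.rpow_add_one (by linarith)]
      congr 1
      ring
    · rw [betaWeight, betaWeight, if_neg hr, if_neg hr, zero_mul]
  rw [lintegral_radialLaw _ _ (by fun_prop)]
  simp only [mul_assoc, hw]
  rw [setLIntegral_betaWeight hn0 (by linarith), ← ENNReal.ofReal_mul (by positivity)]
  congr 1
  have h1 : (Real.Gamma ((n : ℝ) / 2)) ≠ 0 := (Real.Gamma_pos_of_pos (by positivity)).ne'
  have h2 : (Real.Gamma (ν / 2)) ≠ 0 := (Real.Gamma_pos_of_pos (by positivity)).ne'
  have h3 : (Real.Gamma ((n : ℝ) / 2 + ν / 2)) ≠ 0 := (Real.Gamma_pos_of_pos (by positivity)).ne'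
  simp only [beta]
  rw [← add_assoc, Real.Gamma_add_one (by positivity), Real.Gamma_add_one (by positivity)]
  field_simp

lemma radialLaw_compl_Ioo (n : ℕ) (ν : ℝ) : radialLaw n ν (Set.Ioo 0 1)ᶜ = 0 := by
  rw [← lintegral_indicator_one measurableSet_Ioo.compl,
    lintegral_radialLaw _ _ (measurable_one.indicator measurableSet_Ioo.compl)]
  rw [setLIntegral_congr_fun (g := fun _ => 0) measurableSet_Ioi, lintegral_zero, mul_zero]
  intro r hr
  have hr0 : 0 < r := hr
  by_cases h : r < 1
  · simp [hr0, h]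
  · have : ¬ r ^ 2 < 1 := by nlinarith
    simp [betaWeight, this]

/-- `radialLaw` as a bundled probability measure. -/
noncomputable def radialProba {n : ℕ} (hn : 1 ≤ n) {ν : ℝ} (hν : 0 < ν) : ProbabilityMeasure ℝ :=
  ⟨radialLaw n ν, isProbabilityMeasure_radialLaw hn hν⟩

/-- As `ν → 0`, the norm of a point in the Beta model concentrates at `1`. -/
lemma tendsto_radialLaw {n : ℕ} (hn : 1 ≤ n) {ν : ℕ → ℝ} (hν : ∀ i, 0 < ν i)
    (hlim : Tendsto ν atTop (𝓝 0)) :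
    Tendsto (fun i => radialProba hn (hν i)) atTop (𝓝 (diracProba 1)) := by
  have hn0 : (0 : ℝ) < n := by exact_mod_cast hn
  refine tendsto_of_forall_isOpen_le_liminf_nat' fun G hG => ?_
  by_cases h1 : (1 : ℝ) ∈ G
  · refine (prob_le_one).trans (le_of_eq ?_)
    obtain ⟨ε, hε, hball⟩ := Metric.isOpen_iff.1 hG 1 h1
    have hbound : ∀ i, radialLaw n (ν i) Gᶜ ≤ ENNReal.ofReal (ν i / (n + ν i) / ε) := by
      intro i
      have hsub : Gᶜ ⊆
          (Set.Ioo 0 1)ᶜ ∪ {r : ℝ | ENNReal.ofReal ε ≤ ENNReal.ofReal (1 - r ^ 2)} := by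
        intro r hr
        by_cases h : r ∈ Set.Ioo (0 : ℝ) 1
        · right
          refine ENNReal.ofReal_le_ofReal ?_
          by_contra hlt
          push Not at hlt
          refine hr (hball ?_)
          rw [Metric.mem_ball, Real.dist_eq, abs_lt]
          constructor <;> nlinarith [h.1, h.2]
        · exact Or.inl h
      refine (measure_mono hsub).trans ((measure_union_le _ _).trans ?_)
      rw [radialLaw_compl_Ioo, zero_add, ENNReal.ofReal_div_of_pos hε,
        ENNReal.le_div_iff_mul_le (by simp [hε]) (by simp), mul_comm,
        ← lintegral_one_sub_sq_radialLaw hn (hν i)]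
      exact mul_meas_ge_le_lintegral (by fun_prop) _
    have h0 : Tendsto (fun i => ENNReal.ofReal (ν i / (n + ν i) / ε)) atTop (𝓝 0) := by
      have : Tendsto (fun i => ν i / (n + ν i) / ε) atTop (𝓝 (0 / (n + 0) / ε)) :=
        (hlim.div (tendsto_const_nhds.add hlim) (by simpa using hn0.ne')).div_const _
      simpa using ENNReal.tendsto_ofReal this
    have h2 := tendsto_of_tendsto_of_tendsto_of_le_of_le tendsto_const_nhds h0
      (fun i => zero_le (a := radialLaw n (ν i) Gᶜ)) hbound
    have h3 : Tendsto (fun i => radialLaw n (ν i) G) atTop (𝓝 1) := by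
      have h4 := ENNReal.Tendsto.sub (tendsto_const_nhds (x := (1 : ℝ≥0∞))) h2 (by simp)
      rw [tsub_zero] at h4
      refine h4.congr fun i => ?_
      have := isProbabilityMeasure_radialLaw hn (hν i)
      rw [prob_compl_eq_one_sub hG.measurableSet,
        ENNReal.sub_sub_cancel ENNReal.one_ne_top prob_le_one]
    exact h3.liminf_eq.symm
  · have : (diracProba (1 : ℝ) : Measure ℝ) G = 0 := by
      rw [diracProba_toMeasure_apply' _ hG.measurableSet, Set.indicator_of_notMem h1]
    rw [this]
    exact zero_le

lemma isProbabilityMeasure_cond_toSphere {n : ℕ} (hn : 1 ≤ n) : IsProbabilityMeasure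
    (cond (volume : Measure (EuclideanSpace ℝ (Fin n))).toSphere Set.univ) := by
  refine cond_isProbabilityMeasure ?_
  have hn0 : (0 : ℝ) < n := by exact_mod_cast hn
  rw [toSphere_univ_eq hn]
  have := Real.Gamma_pos_of_pos (s := (n : ℝ) / 2) (by positivity)
  simp only [ne_eq, ENNReal.ofReal_eq_zero, not_le]
  positivity

/-- A point in the Beta model is a uniform point of the sphere, rescaled by an independent norm. -/
lemma betaLaw_eq_map {n : ℕ} (hn : 1 ≤ n) {ν : ℝ} (hν : 0 < ν) :
    (volume.withDensity fun x : EuclideanSpace ℝ (Fin n) => ENNReal.ofReal (betaDensity ν n x)) =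
      ((radialLaw n ν).prod
        (cond (volume : Measure (EuclideanSpace ℝ (Fin n))).toSphere Set.univ)).map
        fun p => p.1 • (p.2 : EuclideanSpace ℝ (Fin n)) := by
  have := isProbabilityMeasure_cond_toSphere hn
  have hn0 : (0 : ℝ) < n := by exact_mod_cast hn
  have hs := toSphere_univ_eq hn
  have hG := Real.Gamma_pos_of_pos (s := (n : ℝ) / 2) (by positivity)
  have hG' := Real.Gamma_pos_of_pos (s := ν / 2) (by positivity)
  have hG'' := Real.Gamma_pos_of_pos (s := (n + ν) / 2) (by positivity)
  refine Measure.ext_of_lintegral _ fun f hf => ?_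
  have := isProbabilityMeasure_radialLaw hn hν
  rw [(weightFamily_beta (n := n) (ν := ν) (k := 0)).eq_withDensity,
    lintegral_map hf (by fun_prop), lintegral_prod_symm _ (by fun_prop),
    lintegral_withDensity_eq_lintegral_mul _ (by fun_prop) hf,
    lintegral_eq_lintegral_toSphere finrank_euclideanSpace_fin hn (by fun_prop),
    ProbabilityTheory.cond,
    lintegral_smul_measure, Measure.restrict_univ, hs, smul_eq_mul,
    ← lintegral_const_mul' _ _ (by simp; positivity)]
  refine lintegral_congr fun u => ?_
  have hu : ‖(u : EuclideanSpace ℝ (Fin n))‖ = 1 := by simp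
  rw [lintegral_radialLaw _ _ (by fun_prop), ← mul_assoc, ← lintegral_const_mul _ (by fun_prop)]
  refine setLIntegral_congr_fun measurableSet_Ioi fun r hr => ?_
  have hr0 : 0 < r := hr
  simp only [Pi.mul_apply, norm_smul, hu, mul_one, Real.norm_of_nonneg hr0.le,
    CharP.cast_eq_zero, zero_div, add_zero]
  have hc : ENNReal.ofReal (1 / Real.pi ^ ((n : ℝ) / 2) *
      (Real.Gamma ((n + ν) / 2) / Real.Gamma (ν / 2))) =
      (ENNReal.ofReal (2 * Real.pi ^ ((n : ℝ) / 2) / Real.Gamma (n / 2)))⁻¹ *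
        ENNReal.ofReal (2 / beta (n / 2) (ν / 2)) := by
    rw [← ENNReal.ofReal_inv_of_pos (by positivity), ← ENNReal.ofReal_mul (by positivity)]
    congr 1
    simp only [beta]
    rw [show (n : ℝ) / 2 + ν / 2 = (n + ν) / 2 by ring]
    field_simp
  have hp : r ^ ((n : ℝ) - 1) = r ^ (n - 1) := by
    rw [← Real.rpow_natCast, Nat.cast_sub hn, Nat.cast_one]
  rw [hc, hp]
  ring

lemma isProbabilityMeasure_betaLaw {n : ℕ} (hn : 1 ≤ n) {ν : ℝ} (hν : 0 < ν) :
    IsProbabilityMeasure (volume.withDensity fun x : EuclideanSpace ℝ (Fin n) =>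
      ENNReal.ofReal (betaDensity ν n x)) := by
  have := isProbabilityMeasure_cond_toSphere hn
  have := isProbabilityMeasure_radialLaw hn hν
  rw [betaLaw_eq_map hn hν]
  exact Measure.isProbabilityMeasure_map (by fun_prop)

lemma isProbabilityMeasure_sphereUniform {n : ℕ} (hn : 1 ≤ n) :
    IsProbabilityMeasure (sphereUniform n) := by
  have := isProbabilityMeasure_cond_toSphere hn
  exact Measure.isProbabilityMeasure_map (by fun_prop)

open scoped Pointwise in
lemma sphereUniform_submodule {n : ℕ} (K : Submodule ℝ (EuclideanSpace ℝ (Fin n))) (hK : K ≠ ⊤) :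
    sphereUniform n K = 0 := by
  have hKm : MeasurableSet (K : Set (EuclideanSpace ℝ (Fin n))) :=
    K.closed_of_finiteDimensional.measurableSet
  rw [sphereUniform, Measure.map_apply (by fun_prop) hKm]
  rw [ProbabilityTheory.cond, Measure.restrict_univ, Measure.smul_apply, smul_eq_mul]
  refine mul_eq_zero_of_right _ ?_
  rw [Measure.toSphere_apply' _ (hKm.preimage (by fun_prop))]
  have hsub : Set.Ioo (0 : ℝ) 1 • (Subtype.val '' ((Subtype.val : Metric.sphere
      (0 : EuclideanSpace ℝ (Fin n)) 1 → EuclideanSpace ℝ (Fin n)) ⁻¹' K)) ⊆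
      (K : Set (EuclideanSpace ℝ (Fin n))) := by
    rintro _ ⟨r, -, _, ⟨u, hu, rfl⟩, rfl⟩
    exact K.smul_mem r hu
  rw [measure_mono_null hsub (Measure.addHaar_submodule volume K hK), mul_zero]

/-- The law of a point in the Beta model as a bundled probability measure. -/
noncomputable def betaProba {n : ℕ} (hn : 1 ≤ n) {ν : ℝ} (hν : 0 < ν) :
    ProbabilityMeasure (EuclideanSpace ℝ (Fin n)) :=
  ⟨volume.withDensity fun x => ENNReal.ofReal (betaDensity ν n x),
    isProbabilityMeasure_betaLaw hn hν⟩

/-- `sphereUniform` as a bundled probability measure. -/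
noncomputable def sphereProba {n : ℕ} (hn : 1 ≤ n) :
    ProbabilityMeasure (EuclideanSpace ℝ (Fin n)) :=
  ⟨sphereUniform n, isProbabilityMeasure_sphereUniform hn⟩

/-- The uniform law on the sphere is the limit of the Beta laws as `ν → 0`. -/
lemma tendsto_betaLaw {n : ℕ} (hn : 1 ≤ n) {ν : ℕ → ℝ} (hν : ∀ i, 0 < ν i)
    (hlim : Tendsto ν atTop (𝓝 0)) :
    Tendsto (fun i => betaProba hn (hν i)) atTop (𝓝 (sphereProba hn)) := by
  let σ : ProbabilityMeasure (Metric.sphere (0 : EuclideanSpace ℝ (Fin n)) 1) :=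
    ⟨cond (volume : Measure (EuclideanSpace ℝ (Fin n))).toSphere Set.univ,
      isProbabilityMeasure_cond_toSphere hn⟩
  have hcont : Continuous fun p : ℝ × Metric.sphere (0 : EuclideanSpace ℝ (Fin n)) 1 =>
    p.1 • (p.2 : EuclideanSpace ℝ (Fin n)) := by fun_prop
  have h1 := (tendsto_radialLaw hn hν hlim).prodMk_nhds (tendsto_const_nhds (x := σ))
  have h2 := (ProbabilityMeasure.continuous_prod.tendsto _).comp h1
  have h3 := ProbabilityMeasure.tendsto_map_of_tendsto_of_continuous _ _ h2 hcont
  convert! h3 using 1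
  · funext i
    apply Subtype.ext
    exact betaLaw_eq_map hn (hν i)
  · congr 1
    apply Subtype.ext
    change sphereUniform n = ((Measure.dirac (1 : ℝ)).prod
      (σ : Measure (Metric.sphere (0 : EuclideanSpace ℝ (Fin n)) 1))).map _
    rw [Measure.dirac_prod, Measure.map_map hcont.measurable (by fun_prop), sphereUniform]
    congr 1
    funext u
    simp

lemma tendsto_betaMoment {n : ℕ} {k : ℝ} (hk : 0 ≤ k) {m : ℕ} (hm : m < n) {ν : ℕ → ℝ}
    (hlim : Tendsto ν atTop (𝓝 0)) :
    Tendsto (fun i => betaMoment n (ν i) k m) atTop (𝓝 (betaMoment n 0 k m)) := by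
  have hn0 : (1 : ℝ) ≤ n := by exact_mod_cast (by omega : 1 ≤ n)
  have hm0 : (0 : ℝ) ≤ m := Nat.cast_nonneg m
  have hA : 0 < ((n : ℝ) + 0) / 2 + m * ((n + 0) / 2 - 1) := by
    rcases Nat.eq_zero_or_pos m with rfl | hm1
    · simp; linarith
    · have : (2 : ℝ) ≤ n := by exact_mod_cast (by omega : 2 ≤ n)
      have : 0 ≤ ((n : ℝ) + 0) / 2 - 1 := by linarith
      positivity
  have hG : ∀ {f : ℝ → ℝ}, Continuous f → 0 < f 0 →
      Tendsto (fun i => Real.Gamma (f (ν i))) atTop (𝓝 (Real.Gamma (f 0))) := by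
    intro f hf h0
    have h1 : ContinuousAt Real.Gamma (f 0) :=
      (Real.differentiableAt_Gamma fun m => by
        have : (0 : ℝ) ≤ m := Nat.cast_nonneg m
        linarith).continuousAt
    exact h1.tendsto.comp ((hf.tendsto 0).comp hlim)
  have e1 := hG (f := fun ν => ((n : ℝ) + ν) / 2) (by fun_prop) (by linarith)
  have e2 := hG (f := fun ν => ((n : ℝ) + ν) / 2 + k) (by fun_prop) (by linarith)
  have e3 := hG (f := fun ν => ((n : ℝ) + ν) / 2 + m * ((n + ν) / 2 - 1) + m * k) (by fun_prop)
    (by positivity)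
  have e4 := hG (f := fun ν => ((n : ℝ) + ν) / 2 + m * ((n + ν) / 2 - 1) + (m + 1) * k)
    (by fun_prop) (by positivity)
  have p2 := (Real.Gamma_pos_of_pos (s := ((n : ℝ) + 0) / 2 + k) (by linarith)).ne'
  have p3 := (Real.Gamma_pos_of_pos (s := ((n : ℝ) + 0) / 2 + m * ((n + 0) / 2 - 1) + m * k)
    (by positivity)).ne'
  have e12 := e1.div e2 p2
  exact (tendsto_finsetProd _ fun j _ => tendsto_const_nhds.mul e12).mul ((e4.div e3 p3).mul e12)

/-- A continuous nonnegative function, truncated at the height `K`. -/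
noncomputable def truncation {X : Type*} [TopologicalSpace X] {g : X → NNReal} (hg : Continuous g)
    (K : NNReal) : BoundedContinuousFunction X NNReal :=
  BoundedContinuousFunction.mkOfBound ⟨fun x => min (g x) K, by fun_prop⟩ K fun x y => by
    rw [NNReal.dist_eq, abs_le]
    have h1 : ∀ z, ((min (g z) K : NNReal) : ℝ) ≤ K := fun z =>
      NNReal.coe_le_coe.2 (min_le_right _ _)
    have h2 := NNReal.coe_nonneg (min (g x) K)
    have h3 := NNReal.coe_nonneg (min (g y) K)
    exact ⟨(neg_le_sub_iff_le_add.2 ((h1 y).trans (le_add_of_nonneg_left h2))),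
      (sub_le_self _ h3).trans (h1 x)⟩

lemma truncation_apply {X : Type*} [TopologicalSpace X] {g : X → NNReal} (hg : Continuous g)
    (K : NNReal) (x : X) : truncation hg K x = min (g x) K := rfl

/-- The moments of the volume in the spherical model, by passage to the limit `ν → 0`: the product
laws converge weakly, and the integrand is continuous and bounded on the product of the unit balls.
-/
theorem lintegral_gramVolume_sphere {n : ℕ} {k : ℝ} (hk : 0 ≤ k) (m : ℕ) (hm : m < n) :
    ∫⁻ x : Fin (m + 1) → EuclideanSpace ℝ (Fin n), ENNReal.ofReal (gramVolume x ^ k)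
        ∂(Measure.pi fun _ => sphereUniform n) = ENNReal.ofReal (betaMoment n 0 k m) := by
  have hn : 1 ≤ n := by omega
  have hcont : Continuous fun x : Fin (m + 1) → EuclideanSpace ℝ (Fin n) => gramVolume x ^ k :=
    continuous_gramVolume.rpow_const fun _ => Or.inr hk
  -- on the product of the unit balls the integrand is bounded, hence may be truncated
  obtain ⟨C, hC⟩ : ∃ C, ∀ x : Fin (m + 1) → EuclideanSpace ℝ (Fin n), (∀ i, ‖x i‖ ≤ 1) →
      gramVolume x ^ k ≤ C := by
    have hK : IsCompact (Set.univ.pi fun _ : Fin (m + 1) =>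
        Metric.closedBall (0 : EuclideanSpace ℝ (Fin n)) 1) :=
      isCompact_univ_pi fun _ => isCompact_closedBall _ _
    obtain ⟨C, hC⟩ := hK.bddAbove_image hcont.continuousOn
    exact ⟨C, fun x hx => hC ⟨x, fun i _ => by simpa using hx i, rfl⟩⟩
  let F : BoundedContinuousFunction (Fin (m + 1) → EuclideanSpace ℝ (Fin n)) NNReal :=
    truncation (g := fun x => (gramVolume x ^ k).toNNReal) (by fun_prop) C.toNNReal
  have hF : ∀ (μ : Measure (EuclideanSpace ℝ (Fin n))) [IsProbabilityMeasure μ],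
      (∀ᵐ x ∂μ, ‖x‖ ≤ 1) → ∫⁻ x, F x ∂(Measure.pi fun _ : Fin (m + 1) => μ) =
        ∫⁻ x, ENNReal.ofReal (gramVolume x ^ k) ∂(Measure.pi fun _ : Fin (m + 1) => μ) := by
    intro μ _ hμ
    refine lintegral_congr_ae ?_
    have h1 : ∀ᵐ x ∂(Measure.pi fun _ : Fin (m + 1) => μ), ∀ i, ‖x i‖ ≤ 1 :=
      ae_all_iff.2 fun i => (Measure.quasiMeasurePreserving_eval (fun _ => μ) i).ae hμ
    filter_upwards [h1] with x hx
    rw [truncation_apply, min_eq_left (Real.toNNReal_le_toNNReal (hC x hx))]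
    rfl
  let ν : ℕ → ℝ := fun i => 1 / ((i : ℝ) + 1)
  have hν : ∀ i, 0 < ν i := fun i => by positivity
  have hlim : Tendsto ν atTop (𝓝 0) := tendsto_one_div_add_atTop_nhds_zero_nat
  have h1 := tendsto_betaLaw hn hν hlim
  have h2 := (ProbabilityMeasure.continuous_pi.tendsto _).comp
    (tendsto_pi_nhds.2 fun _ : Fin (m + 1) => h1)
  have h3 := ProbabilityMeasure.tendsto_iff_forall_lintegral_tendsto.1 h2 F
  have h4 : Tendsto (fun i => ENNReal.ofReal (betaMoment n (ν i) k m)) atTop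
      (𝓝 (∫⁻ x, F x ∂(Measure.pi fun _ : Fin (m + 1) => sphereUniform n))) := by
    refine h3.congr fun i => ?_
    have := isProbabilityMeasure_betaLaw hn (hν i)
    rw [← lintegral_gramVolume_beta (hν i) hk m hm]
    refine hF (volume.withDensity fun x => ENNReal.ofReal (betaDensity (ν i) n x)) ?_
    have hm' : MeasurableSet {x : EuclideanSpace ℝ (Fin n) | ¬ ‖x‖ ≤ 1} :=
      (measurableSet_le measurable_norm measurable_const).compl
    rw [ae_iff, withDensity_apply _ hm']
    refine (setLIntegral_congr_fun (g := fun _ => 0) hm' fun x hx => ?_).trans lintegral_zero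
    have : ¬ ‖x‖ < 1 := fun h => hx h.le
    simp [betaDensity, this]
  have := isProbabilityMeasure_sphereUniform hn
  rw [← hF]
  · exact tendsto_nhds_unique h4 (ENNReal.tendsto_ofReal (tendsto_betaMoment hk hm hlim))
  · rw [sphereUniform, ae_map_iff (by fun_prop) (measurableSet_le (by fun_prop) (by fun_prop))]
    exact ae_of_all _ fun u => by simp

/-! ### A third order expansion of ratios of Gamma functions -/

/-- A decreasing function vanishing at infinity is the sum of its unit decrements. It is applied to
rational functions whose decrements bound the terms of the series for the trigamma function. -/
lemma hasSum_telescope {f : ℝ → ℝ} (hf : ∀ x, 0 < x → f (x + 1) ≤ f x)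
    (hlim : Tendsto f atTop (𝓝 0)) {a : ℝ} (ha : 0 < a) :
    HasSum (fun m : ℕ => f (a + m) - f (a + m + 1)) (f a) := by
  rw [hasSum_iff_tendsto_nat_of_nonneg fun m => sub_nonneg.2 (hf _ (by positivity))]
  have h1 : ∀ N : ℕ, ∑ m ∈ Finset.range N, (f (a + m) - f (a + m + 1)) = f a - f (a + N) := by
    intro N
    have := Finset.sum_range_sub' (fun m : ℕ => f (a + m)) N
    simp only [Nat.cast_add, Nat.cast_one, Nat.cast_zero, add_zero, ← add_assoc] at this
    exact this
  simp only [h1]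
  have h2 : Tendsto (fun N : ℕ => f (a + N)) atTop (𝓝 0) :=
    hlim.comp (tendsto_atTop_add_const_left _ _ tendsto_natCast_atTop_atTop)
  simpa using h2.const_sub (f a)

lemma tendsto_inv_add_inv_sq : Tendsto (fun x : ℝ => 1 / x + 1 / x ^ 2) atTop (𝓝 0) := by
  have h1 : Tendsto (fun x : ℝ => x⁻¹) atTop (𝓝 0) := tendsto_inv_atTop_zero
  have h2 := h1.add (h1.pow 2)
  simpa using h2

/-- The trigamma function, as a series. -/
noncomputable def trigamma (a : ℝ) : ℝ := ∑' m : ℕ, 1 / (a + m) ^ 2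

lemma hasSum_trigamma_upper {a : ℝ} (ha : 0 < a) :
    HasSum (fun m : ℕ => (1 / (a + m) + 1 / (a + m) ^ 2) -
      (1 / (a + m + 1) + 1 / (a + m + 1) ^ 2)) (1 / a + 1 / a ^ 2) := by
  refine hasSum_telescope (f := fun x => 1 / x + 1 / x ^ 2) (fun x hx => ?_)
    tendsto_inv_add_inv_sq ha
  gcongr <;> linarith

lemma trigamma_term_le {x : ℝ} (hx : 0 < x) :
    1 / x ^ 2 ≤ (1 / x + 1 / x ^ 2) - (1 / (x + 1) + 1 / (x + 1) ^ 2) := by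
  have : (1 / x + 1 / x ^ 2) - (1 / (x + 1) + 1 / (x + 1) ^ 2) - 1 / x ^ 2 =
      1 / (x * (x + 1) ^ 2) := by
    field_simp
    ring
  have h : 0 ≤ 1 / (x * (x + 1) ^ 2) := by positivity
  linarith

lemma summable_trigamma {a : ℝ} (ha : 0 < a) : Summable fun m : ℕ => 1 / (a + m) ^ 2 :=
  Summable.of_nonneg_of_le (fun m => by positivity) (fun m => trigamma_term_le (by positivity))
    (hasSum_trigamma_upper ha).summable

lemma trigamma_le {a : ℝ} (ha : 0 < a) : trigamma a ≤ 1 / a + 1 / a ^ 2 :=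
  hasSum_le (fun m => trigamma_term_le (by positivity)) (summable_trigamma ha).hasSum
    (hasSum_trigamma_upper ha)

lemma le_trigamma {a : ℝ} (ha : 0 < a) : 1 / a ≤ trigamma a := by
  refine hasSum_le (fun m : ℕ => ?_) (hasSum_telescope (f := fun x => 1 / x) (fun x hx => ?_)
    (by simpa using tendsto_inv_atTop_zero) ha) (summable_trigamma ha).hasSum
  · have hx : 0 < a + m := by positivity
    have : 1 / (a + m) ^ 2 - (1 / (a + m) - 1 / (a + m + 1)) = 1 / ((a + m) ^ 2 * (a + m + 1)) := by
      field_simp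
      ring
    have h : 0 ≤ 1 / ((a + m) ^ 2 * (a + m + 1)) := by positivity
    linarith
  · gcongr
    linarith

lemma summable_pow_of_two_le {a : ℝ} (ha : 0 < a) (p : ℕ) :
    Summable fun m : ℕ => 1 / (a + m) ^ (p + 2) := by
  refine Summable.of_nonneg_of_le (fun m => by positivity) (fun m => ?_)
    ((summable_trigamma ha).mul_left (1 / a ^ p))
  rw [pow_add, one_div_mul_one_div]
  gcongr
  linarith [(Nat.cast_nonneg m : (0 : ℝ) ≤ m)]

lemma tsum_pow_le {a : ℝ} (ha : 1 / 2 ≤ a) (p : ℕ) :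
    ∑' m : ℕ, 1 / (a + m) ^ (p + 2) ≤ 3 / a ^ (p + 1) := by
  have ha0 : 0 < a := by linarith
  calc ∑' m : ℕ, 1 / (a + m) ^ (p + 2) ≤ ∑' m : ℕ, 1 / a ^ p * (1 / (a + m) ^ 2) := by
        refine (summable_pow_of_two_le ha0 p).tsum_le_tsum (fun m => ?_)
          ((summable_trigamma ha0).mul_left _)
        rw [pow_add, one_div_mul_one_div]
        gcongr
        linarith [(Nat.cast_nonneg m : (0 : ℝ) ≤ m)]
    _ = 1 / a ^ p * trigamma a := tsum_mul_left
    _ ≤ 1 / a ^ p * (3 / a) := by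
        have h := trigamma_le ha0
        gcongr
        refine h.trans ?_
        have : 1 / a ^ 2 ≤ 2 / a := by
          rw [div_le_div_iff₀ (by positivity) ha0]
          nlinarith
        have h3 : 3 / a = 1 / a + 2 / a := by ring
        linarith
    _ = 3 / a ^ (p + 1) := by
        rw [pow_succ]
        field_simp

/-- The derivative of the trigamma function at `x` is at most `-1 / x²`. -/
lemma trigamma_sub_ge {a b : ℝ} (ha : 0 < a) (hab : a ≤ b) :
    (b - a) / b ^ 2 ≤ trigamma a - trigamma b := by
  have hb : 0 < b := by linarith
  have h1 := (hasSum_telescope (f := fun x => 1 / x ^ 2) (fun x hx => by gcongr; linarith)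
    (by simpa using (tendsto_inv_atTop_zero (𝕜 := ℝ)).pow 2) hb).mul_left (b - a)
  have h2 := (summable_trigamma ha).hasSum.sub (summable_trigamma hb).hasSum
  rw [mul_one_div] at h1
  refine hasSum_le (fun m => ?_) h1 h2
  set x := a + (m : ℝ)
  have hx : 0 < x := by positivity
  set y := b + (m : ℝ) with hy
  have hxy : x ≤ y := by simp only [x, y]; linarith
  have hy0 : 0 < y := by linarith
  have e1 : b - a = y - x := by simp only [x, y]; ring
  have e2 : 1 / x ^ 2 - 1 / y ^ 2 = (y - x) * ((x + y) / (x ^ 2 * y ^ 2)) := by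
    field_simp
    ring
  rw [e1, e2]
  refine mul_le_mul_of_nonneg_left ?_ (by linarith)
  calc 1 / y ^ 2 - 1 / (y + 1) ^ 2 ≤ 2 / y ^ 3 := by
        rw [div_sub_div _ _ (by positivity) (by positivity), div_le_div_iff₀ (by positivity)
          (by positivity)]
        nlinarith [pow_pos hy0 2, pow_pos hy0 3, pow_pos hy0 4]
    _ ≤ (x + y) / (x ^ 2 * y ^ 2) := by
        rw [div_le_div_iff₀ (by positivity) (by positivity)]
        have h3 : x ^ 2 ≤ y ^ 2 := by gcongr
        have h4 : x * x ≤ x * y := by gcongr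
        have h5 : 2 * x ^ 2 ≤ (x + y) * y := by nlinarith
        nlinarith [mul_le_mul_of_nonneg_right h5 (sq_nonneg y)]

/-- The remainder of the second order expansion of `x - log (1 + x)` at `0`. -/
noncomputable def cubicRemainder (x : ℝ) : ℝ := x - Real.log (1 + x) - x ^ 2 / 2

/-- The derivative of the remainder at `x ≥ 0` is `-x² / (1 + x)`, which is at most `x²` in absolute
value. -/
lemma cubicRemainder_sub_le {x y M : ℝ} (hx : 0 ≤ x) (hy : 0 ≤ y) (hxM : x ≤ M) (hyM : y ≤ M) :
    |cubicRemainder x - cubicRemainder y| ≤ M ^ 2 * |x - y| := by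
  have hd : ∀ z ∈ Set.Icc (0 : ℝ) M,
      HasDerivWithinAt cubicRemainder (-z ^ 2 / (1 + z)) (Set.Icc 0 M) z := by
    intro z hz
    have hz1 : 1 + z ≠ 0 := by linarith [hz.1]
    have h1 : HasDerivAt cubicRemainder (1 - 1 / (1 + z) - 2 * z / 2) z := by
      have e1 := ((hasDerivAt_id z).const_add 1).log hz1
      have e2 := (hasDerivAt_pow 2 z).div_const 2
      have e3 := ((hasDerivAt_id z).sub e1).sub e2
      norm_num at e3 ⊢
      exact e3
    have h2 : 1 - 1 / (1 + z) - 2 * z / 2 = -z ^ 2 / (1 + z) := by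
      field_simp
      ring
    exact h2 ▸ h1.hasDerivWithinAt
  have h := (convex_Icc (0 : ℝ) M).norm_image_sub_le_of_norm_hasDerivWithin_le (C := M ^ 2) hd
    (fun z hz => ?_) ⟨hy, hyM⟩ ⟨hx, hxM⟩
  · simpa [Real.norm_eq_abs] using h
  · rw [norm_div, norm_neg, Real.norm_of_nonneg (sq_nonneg z),
      Real.norm_of_nonneg (by linarith [hz.1])]
    refine (div_le_self (sq_nonneg z) (by linarith [hz.1])).trans ?_
    have := hz.2
    have := hz.1
    gcongr

lemma cubicRemainder_zero : cubicRemainder 0 = 0 := by simp [cubicRemainder]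

lemma abs_cubicRemainder_le {x : ℝ} (hx : 0 ≤ x) : |cubicRemainder x| ≤ x ^ 3 := by
  have h := cubicRemainder_sub_le hx le_rfl le_rfl hx
  rw [cubicRemainder_zero, sub_zero, sub_zero, abs_of_nonneg hx] at h
  linarith [pow_succ x 2]

/-- The remainder of the second order expansion of `k ↦ log Γ (a + k)` at `k = 0`. -/
noncomputable def gammaRemainder (a k : ℝ) : ℝ := ∑' m : ℕ, cubicRemainder (k / (a + m))

lemma summable_gammaRemainder {a k : ℝ} (ha : 0 < a) (hk : 0 ≤ k) :
    Summable fun m : ℕ => cubicRemainder (k / (a + m)) := by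
  refine Summable.of_norm_bounded ((summable_pow_of_two_le ha 1).mul_left (k ^ 3)) fun m => ?_
  rw [mul_one_div, ← div_pow]
  exact abs_cubicRemainder_le (by positivity)

/-- The digamma function, as the linear coefficient of the expansion of `log Γ`. -/
noncomputable def digammaCoeff (a : ℝ) : ℝ :=
  Real.log (Real.Gamma (a + 1)) - Real.log (Real.Gamma a) -
    (trigamma a / 2 + gammaRemainder a 1)

/-- The second order expansion of `log Γ`. -/
theorem log_Gamma_expansion {a k : ℝ} (ha : 0 < a) (hk : 0 ≤ k) :
    Real.log (Real.Gamma (a + k)) - Real.log (Real.Gamma a) =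
      k * digammaCoeff a + k ^ 2 / 2 * trigamma a + gammaRemainder a k := by
  have key : ∀ {k : ℝ}, 0 ≤ k → Tendsto (fun n : ℕ => k * (Real.log n -
      ∑ m ∈ Finset.range (n + 1), 1 / (a + m))) atTop
      (𝓝 (Real.log (Real.Gamma (a + k)) - Real.log (Real.Gamma a) -
        (k ^ 2 / 2 * trigamma a + gammaRemainder a k))) := by
    intro k hk
    have h1 := (Real.BohrMollerup.tendsto_log_gamma (x := a + k) (by linarith)).sub
      (Real.BohrMollerup.tendsto_log_gamma ha)
    have h2 := ((((summable_trigamma ha).hasSum.mul_left (k ^ 2 / 2)).add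
      (summable_gammaRemainder ha hk).hasSum).tendsto_sum_nat).comp (tendsto_add_atTop_nat 1)
    refine (h1.sub h2).congr fun n => ?_
    simp only [Real.BohrMollerup.logGammaSeq, Function.comp_apply]
    have h3 : ∀ m : ℕ, k ^ 2 / 2 * (1 / (a + m) ^ 2) + cubicRemainder (k / (a + m)) =
        k * (1 / (a + m)) - (Real.log (a + k + m) - Real.log (a + m)) := by
      intro m
      have hm : 0 < a + m := by positivity
      have h4 : 1 + k / (a + m) = (a + k + m) / (a + m) := by field_simp; ring
      rw [cubicRemainder, h4, Real.log_div (by positivity) hm.ne']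
      field_simp
      ring
    simp only [h3, Finset.sum_sub_distrib, ← Finset.mul_sum]
    ring
  have h1 := (key zero_le_one).const_mul k
  have h2 := key hk
  simp only [one_mul] at h1
  have h3 := tendsto_nhds_unique h1 h2
  rw [digammaCoeff]
  linarith

lemma abs_gammaRemainder_le {a k : ℝ} (ha : 1 / 2 ≤ a) (hk : 0 ≤ k) :
    |gammaRemainder a k| ≤ 3 * k ^ 3 / a ^ 2 := by
  have ha0 : 0 < a := by linarith
  have h := tsum_of_norm_bounded (f := fun m : ℕ => cubicRemainder (k / (a + m)))
    ((summable_pow_of_two_le ha0 1).mul_left (k ^ 3)).hasSum fun m => by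
      rw [mul_one_div, ← div_pow]
      exact abs_cubicRemainder_le (by positivity)
  rw [tsum_mul_left] at h
  refine h.trans ?_
  calc k ^ 3 * ∑' m : ℕ, 1 / (a + m) ^ (1 + 2) ≤ k ^ 3 * (3 / a ^ (1 + 1)) := by
        gcongr
        exact tsum_pow_le ha 1
    _ = _ := by norm_num; ring

/-- In the Beta model the remainders enter in differences, and these are smaller than the single
remainders by the factor `(b - a) / a`. The gain is needed for `r = o(n)`, where the variance in the
Beta model is only of order `1 / n + r² / n²`. -/
lemma abs_gammaRemainder_sub_le {a b k : ℝ} (ha : 1 / 2 ≤ a) (hab : a ≤ b) (hk : 0 ≤ k) :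
    |gammaRemainder a k - gammaRemainder b k| ≤ 3 * k ^ 3 * (b - a) / a ^ 3 := by
  have ha0 : 0 < a := by linarith
  have hb0 : 0 < b := by linarith
  have hba : 0 ≤ b - a := by linarith
  rw [gammaRemainder, gammaRemainder,
    ← (summable_gammaRemainder ha0 hk).tsum_sub (summable_gammaRemainder hb0 hk)]
  have h := tsum_of_norm_bounded
    (f := fun m : ℕ => cubicRemainder (k / (a + m)) - cubicRemainder (k / (b + m)))
    ((summable_pow_of_two_le ha0 2).mul_left (k ^ 3 * (b - a))).hasSum fun m => by
      have hx : 0 < a + m := by positivity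
      have hy : 0 < b + m := by positivity
      have h1 := cubicRemainder_sub_le (x := k / (a + m)) (y := k / (b + m)) (M := k / (a + m))
        (by positivity) (by positivity) le_rfl (by gcongr)
      refine h1.trans ?_
      have h2 : k / (a + m) - k / (b + m) = k * (b - a) / ((a + m) * (b + m)) := by
        field_simp
        ring
      rw [h2, abs_of_nonneg (by positivity)]
      calc (k / (a + m)) ^ 2 * (k * (b - a) / ((a + m) * (b + m)))
          ≤ (k / (a + m)) ^ 2 * (k * (b - a) / ((a + m) * (a + m))) := by gcongr
        _ = _ := by field_simp; ring
  rw [tsum_mul_left] at h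
  refine h.trans ?_
  calc k ^ 3 * (b - a) * ∑' m : ℕ, 1 / (a + m) ^ (2 + 2)
      ≤ k ^ 3 * (b - a) * (3 / a ^ (2 + 1)) := by
        gcongr
        exact tsum_pow_le ha 2
    _ = _ := by norm_num; ring

/-- The same gain for a change of the increment, as in the last factor of `betaMoment`: the
difference is of order `(j + 1)² k³ / a²` instead of `(j + 1)³ k³ / a²`. -/
lemma abs_gammaRemainder_mul_sub_le {a k j : ℝ} (ha : 1 / 2 ≤ a) (hk : 0 ≤ k) (hj : 0 ≤ j) :
    |gammaRemainder a ((j + 1) * k) - gammaRemainder a (j * k)| ≤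
      3 * k ^ 3 * (j + 1) ^ 2 / a ^ 2 := by
  have ha0 : 0 < a := by linarith
  rw [gammaRemainder, gammaRemainder,
    ← (summable_gammaRemainder ha0 (by positivity)).tsum_sub
      (summable_gammaRemainder ha0 (by positivity))]
  have h := tsum_of_norm_bounded
    (f := fun m : ℕ => cubicRemainder ((j + 1) * k / (a + m)) - cubicRemainder (j * k / (a + m)))
    ((summable_pow_of_two_le ha0 1).mul_left (k ^ 3 * (j + 1) ^ 2)).hasSum fun m => by
      have hx : 0 < a + m := by positivity
      have h1 := cubicRemainder_sub_le (x := (j + 1) * k / (a + m)) (y := j * k / (a + m))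
        (M := (j + 1) * k / (a + m)) (by positivity) (by positivity) le_rfl
        (by gcongr; linarith)
      refine h1.trans (le_of_eq ?_)
      have h2 : (j + 1) * k / (a + m) - j * k / (a + m) = k / (a + m) := by
        field_simp
        ring
      rw [h2, abs_of_nonneg (by positivity)]
      field_simp
  rw [tsum_mul_left] at h
  refine h.trans ?_
  calc k ^ 3 * (j + 1) ^ 2 * ∑' m : ℕ, 1 / (a + m) ^ (1 + 2)
      ≤ k ^ 3 * (j + 1) ^ 2 * (3 / a ^ (1 + 1)) := by
        gcongr
        exact tsum_pow_le ha 1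
    _ = _ := by norm_num; ring

/-! ### Asymptotics of the moments -/

/-- The linear coefficient of `log (gaussMoment n k m)` in `k`. -/
noncomputable def gaussMean (n m : ℕ) : ℝ :=
  Real.log (2 ^ m * (m + 1)) + ∑ j ∈ Finset.range m, digammaCoeff (((n : ℝ) - j) / 2)

/-- Twice the quadratic coefficient of `log (gaussMoment n k m)` in `k`. -/
noncomputable def gaussVar (n m : ℕ) : ℝ :=
  ∑ j ∈ Finset.range m, trigamma (((n : ℝ) - j) / 2)

/-- The linear coefficient of `log (betaMoment n ν k m)` in `k`. -/
noncomputable def betaMean (n : ℕ) (ν : ℝ) (m : ℕ) : ℝ :=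
  ∑ j ∈ Finset.range m, (digammaCoeff (((n : ℝ) - j) / 2) - digammaCoeff ((n + ν) / 2)) +
    (digammaCoeff ((n + ν) / 2 + m * ((n + ν) / 2 - 1)) - digammaCoeff ((n + ν) / 2))

/-- Twice the quadratic coefficient of `log (betaMoment n ν k m)` in `k`. -/
noncomputable def betaVar (n : ℕ) (ν : ℝ) (m : ℕ) : ℝ :=
  ∑ j ∈ Finset.range m, (trigamma (((n : ℝ) - j) / 2) - trigamma ((n + ν) / 2)) +
    ((2 * m + 1) * trigamma ((n + ν) / 2 + m * ((n + ν) / 2 - 1)) - trigamma ((n + ν) / 2))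

lemma gaussMoment_pos {n m : ℕ} {k : ℝ} (hm : m < n) (hk : 0 ≤ k) : 0 < gaussMoment n k m := by
  refine mul_pos (Real.rpow_pos_of_pos (by positivity) _) (Finset.prod_pos fun j hj => ?_)
  have : (j : ℝ) < n := by exact_mod_cast (Finset.mem_range.1 hj).trans hm
  exact div_pos (Real.Gamma_pos_of_pos (by linarith)) (Real.Gamma_pos_of_pos (by linarith))

lemma log_gaussMoment {n m : ℕ} {k : ℝ} (hm : m < n) (hk : 0 ≤ k) :
    Real.log (gaussMoment n k m) = k * gaussMean n m + k ^ 2 / 2 * gaussVar n m +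
      ∑ j ∈ Finset.range m, gammaRemainder (((n : ℝ) - j) / 2) k := by
  have hj : ∀ j ∈ Finset.range m, (0 : ℝ) < ((n : ℝ) - j) / 2 := fun j hj => by
    have : (j : ℝ) < n := by exact_mod_cast (Finset.mem_range.1 hj).trans hm
    linarith
  have hG : ∀ j ∈ Finset.range m, Real.Gamma (((n : ℝ) - j) / 2 + k) ≠ 0 := fun j h =>
    (Real.Gamma_pos_of_pos (by linarith [hj j h])).ne'
  have hG' : ∀ j ∈ Finset.range m, Real.Gamma (((n : ℝ) - j) / 2) ≠ 0 := fun j h =>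
    (Real.Gamma_pos_of_pos (hj j h)).ne'
  rw [gaussMoment, Real.log_mul (Real.rpow_pos_of_pos (by positivity) _).ne'
    (Finset.prod_ne_zero_iff.2 fun j h => div_ne_zero (hG j h) (hG' j h)),
    Real.log_rpow (by positivity), Real.log_prod fun j h => div_ne_zero (hG j h) (hG' j h)]
  have h1 : ∀ j ∈ Finset.range m, Real.log (Real.Gamma (((n : ℝ) - j) / 2 + k) /
      Real.Gamma (((n : ℝ) - j) / 2)) = k * digammaCoeff (((n : ℝ) - j) / 2) +
        k ^ 2 / 2 * trigamma (((n : ℝ) - j) / 2) + gammaRemainder (((n : ℝ) - j) / 2) k :=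
    fun j h => by
      rw [Real.log_div (hG j h) (hG' j h), log_Gamma_expansion (hj j h) hk]
  rw [Finset.sum_congr rfl h1, gaussMean, gaussVar, Finset.sum_add_distrib,
    Finset.sum_add_distrib, ← Finset.mul_sum, ← Finset.mul_sum]
  ring

lemma betaExponent_sum_pos {n m : ℕ} {ν : ℝ} (hm : m < n) (hν : 0 ≤ ν) :
    0 < ((n : ℝ) + ν) / 2 + m * ((n + ν) / 2 - 1) := by
  have hn : (1 : ℝ) ≤ n := by exact_mod_cast (by omega : 1 ≤ n)
  rcases Nat.eq_zero_or_pos m with rfl | hm1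
  · simp; linarith
  · have : (2 : ℝ) ≤ n := by exact_mod_cast (by omega : 2 ≤ n)
    have h2 : 0 ≤ ((n : ℝ) + ν) / 2 - 1 := by linarith
    have h3 : 0 ≤ (m : ℝ) * (((n : ℝ) + ν) / 2 - 1) := by positivity
    linarith

lemma betaMoment_pos {n m : ℕ} {ν k : ℝ} (hm : m < n) (hν : 0 ≤ ν) (hk : 0 ≤ k) :
    0 < betaMoment n ν k m := by
  have hA := betaExponent_sum_pos hm hν
  have hn : (1 : ℝ) ≤ n := by exact_mod_cast (by omega : 1 ≤ n)
  have g1 := Real.Gamma_pos_of_pos (s := ((n : ℝ) + ν) / 2) (by linarith)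
  have g2 := Real.Gamma_pos_of_pos (s := ((n : ℝ) + ν) / 2 + k) (by linarith)
  have g3 := Real.Gamma_pos_of_pos (s := ((n : ℝ) + ν) / 2 + m * ((n + ν) / 2 - 1) + m * k)
    (by positivity)
  have g4 := Real.Gamma_pos_of_pos (s := ((n : ℝ) + ν) / 2 + m * ((n + ν) / 2 - 1) + (m + 1) * k)
    (by positivity)
  refine mul_pos (Finset.prod_pos fun j hj => ?_) (by positivity)
  have : (j : ℝ) < n := by exact_mod_cast (Finset.mem_range.1 hj).trans hm
  have g5 := Real.Gamma_pos_of_pos (s := ((n : ℝ) - j) / 2) (by linarith)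
  have g6 := Real.Gamma_pos_of_pos (s := ((n : ℝ) - j) / 2 + k) (by linarith)
  positivity

lemma log_betaMoment {n m : ℕ} {ν k : ℝ} (hm : m < n) (hν : 0 ≤ ν) (hk : 0 ≤ k) :
    Real.log (betaMoment n ν k m) = k * betaMean n ν m + k ^ 2 / 2 * betaVar n ν m +
      (∑ j ∈ Finset.range m,
        (gammaRemainder (((n : ℝ) - j) / 2) k - gammaRemainder ((n + ν) / 2) k) +
      ((gammaRemainder ((n + ν) / 2 + m * ((n + ν) / 2 - 1)) ((m + 1) * k) -
        gammaRemainder ((n + ν) / 2 + m * ((n + ν) / 2 - 1)) (m * k)) -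
        gammaRemainder ((n + ν) / 2) k)) := by
  have hA := betaExponent_sum_pos hm hν
  have hn : (1 : ℝ) ≤ n := by exact_mod_cast (by omega : 1 ≤ n)
  have hb : 0 < ((n : ℝ) + ν) / 2 := by linarith
  have hj : ∀ j ∈ Finset.range m, (0 : ℝ) < ((n : ℝ) - j) / 2 := fun j hj => by
    have : (j : ℝ) < n := by exact_mod_cast (Finset.mem_range.1 hj).trans hm
    linarith
  have hG : ∀ j ∈ Finset.range m, Real.Gamma (((n : ℝ) - j) / 2 + k) /
      Real.Gamma (((n : ℝ) - j) / 2) ≠ 0 := fun j h =>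
    (div_pos (Real.Gamma_pos_of_pos (by linarith [hj j h]))
      (Real.Gamma_pos_of_pos (hj j h))).ne'
  have hlog : ∀ {a : ℝ}, 0 < a → Real.log (Real.Gamma (a + k) / Real.Gamma a) =
      k * digammaCoeff a + k ^ 2 / 2 * trigamma a + gammaRemainder a k := fun ha => by
    rw [Real.log_div (Real.Gamma_pos_of_pos (by linarith)).ne' (Real.Gamma_pos_of_pos ha).ne',
      log_Gamma_expansion ha hk]
  have hlog' : Real.log (Real.Gamma ((n + ν) / 2) / Real.Gamma ((n + ν) / 2 + k)) =
      -(k * digammaCoeff ((n + ν) / 2) + k ^ 2 / 2 * trigamma ((n + ν) / 2) +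
        gammaRemainder ((n + ν) / 2) k) := by
    rw [← hlog hb, ← Real.log_inv, inv_div]
  have hB : Real.Gamma ((n + ν) / 2) / Real.Gamma ((n + ν) / 2 + k) ≠ 0 :=
    (div_pos (Real.Gamma_pos_of_pos hb) (Real.Gamma_pos_of_pos (by linarith))).ne'
  have g3 := Real.Gamma_pos_of_pos (s := ((n : ℝ) + ν) / 2 + m * ((n + ν) / 2 - 1) + m * k)
    (by positivity)
  have g4 := Real.Gamma_pos_of_pos (s := ((n : ℝ) + ν) / 2 + m * ((n + ν) / 2 - 1) + (m + 1) * k)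
    (by positivity)
  have e3 := log_Gamma_expansion (k := m * k) hA (by positivity)
  have e4 := log_Gamma_expansion (k := (m + 1) * k) hA (by positivity)
  have h1 : ∀ j ∈ Finset.range m, Real.log (Real.Gamma (((n : ℝ) - j) / 2 + k) /
      Real.Gamma (((n : ℝ) - j) / 2) *
      (Real.Gamma ((n + ν) / 2) / Real.Gamma ((n + ν) / 2 + k))) =
      k * (digammaCoeff (((n : ℝ) - j) / 2) - digammaCoeff ((n + ν) / 2)) +
      k ^ 2 / 2 * (trigamma (((n : ℝ) - j) / 2) - trigamma ((n + ν) / 2)) +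
      (gammaRemainder (((n : ℝ) - j) / 2) k - gammaRemainder ((n + ν) / 2) k) := fun j h => by
    rw [Real.log_mul (hG j h) hB, hlog (hj j h), hlog']
    ring
  rw [betaMoment, Real.log_mul (Finset.prod_ne_zero_iff.2 fun j h => mul_ne_zero (hG j h) hB)
    (mul_ne_zero (div_pos g4 g3).ne' hB), Real.log_mul (div_pos g4 g3).ne' hB,
    Real.log_div g4.ne' g3.ne', hlog', Real.log_prod fun j h => mul_ne_zero (hG j h) hB,
    Finset.sum_congr rfl h1, Finset.sum_add_distrib, Finset.sum_add_distrib, ← Finset.mul_sum,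
    ← Finset.mul_sum, betaMean, betaVar]
  linear_combination e4 - e3

lemma le_gaussVar {n m : ℕ} (hm : m < n) : 2 * m / n ≤ gaussVar n m := by
  have h1 : ∀ j ∈ Finset.range m, (2 : ℝ) / n ≤ trigamma (((n : ℝ) - j) / 2) := fun j hj => by
    have : (j : ℝ) < n := by exact_mod_cast (Finset.mem_range.1 hj).trans hm
    have h0 : (0 : ℝ) ≤ j := Nat.cast_nonneg j
    refine le_trans ?_ (le_trigamma (by linarith))
    rw [one_div_div]
    exact div_le_div_of_nonneg_left zero_le_two (by linarith) (by linarith)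
  have h2 := Finset.card_nsmul_le_sum _ _ _ h1
  rw [Finset.card_range, nsmul_eq_mul] at h2
  refine le_trans (le_of_eq ?_) h2
  ring

/-- The error of the quadratic expansion is a cubic power of `k` times the variance, divided by `n`.
-/
lemma abs_log_gaussMoment_sub_le {n m : ℕ} {k δ : ℝ} (hm : m < n) (hδ : 0 < δ)
    (hmδ : δ * n ≤ n - m) (hk : 0 ≤ k) :
    |Real.log (gaussMoment n k m) - (k * gaussMean n m + k ^ 2 / 2 * gaussVar n m)| ≤
      6 / δ ^ 2 * k ^ 3 * gaussVar n m / n := by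
  have hn0 : (0 : ℝ) < n := by exact_mod_cast (by omega : 0 < n)
  rw [log_gaussMoment hm hk, add_sub_cancel_left]
  have h1 : ∀ j ∈ Finset.range m, |gammaRemainder (((n : ℝ) - j) / 2) k| ≤
      3 * k ^ 3 / (δ * n / 2) ^ 2 := fun j hj => by
    have h0 : (j : ℝ) + 1 ≤ m := by exact_mod_cast Finset.mem_range.1 hj
    have h0' : (m : ℝ) + 1 ≤ n := by exact_mod_cast hm
    refine (abs_gammaRemainder_le (by linarith) hk).trans ?_
    gcongr
    linarith
  refine (Finset.abs_sum_le_sum_abs _ _).trans ((Finset.sum_le_card_nsmul _ _ _ h1).trans ?_)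
  rw [Finset.card_range, nsmul_eq_mul]
  have h2 := le_gaussVar hm
  calc (m : ℝ) * (3 * k ^ 3 / (δ * n / 2) ^ 2) = 6 / δ ^ 2 * k ^ 3 * (2 * m / n) / n := by
        field_simp
        ring
    _ ≤ _ := by gcongr

/-- The size of the argument `b + m (b - 1)` of the last factor of the moment in the Beta model,
where `b = (n + ν) / 2`. -/
lemma betaExponent_sum_bounds {b m : ℝ} (hb : 4 ≤ b) (hm : 0 ≤ m) :
    (m + 1) * b / 2 ≤ b + m * (b - 1) ∧ b + m * (b - 1) ≤ (m + 1) * b := by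
  constructor <;> nlinarith

lemma sum_trigamma_sub_ge {n m : ℕ} {ν : ℝ} (hm : m < n) (hν : 0 ≤ ν) :
    (m : ℝ) * (m - 1) / (4 * ((n + ν) / 2) ^ 2) ≤
      ∑ j ∈ Finset.range m, (trigamma (((n : ℝ) - j) / 2) - trigamma ((n + ν) / 2)) := by
  have hn0 : (0 : ℝ) < n := by exact_mod_cast (by omega : 0 < n)
  have hsum : ∑ j ∈ Finset.range m, (j : ℝ) = m * (m - 1) / 2 := by
    clear hm
    induction m with
    | zero => simp
    | succ m ih => rw [Finset.sum_range_succ, ih]; push_cast; ring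
  have h1 : ∀ j ∈ Finset.range m, (j : ℝ) / 2 / ((n + ν) / 2) ^ 2 ≤
      trigamma (((n : ℝ) - j) / 2) - trigamma ((n + ν) / 2) := fun j hj => by
    have : (j : ℝ) < n := by exact_mod_cast (Finset.mem_range.1 hj).trans hm
    have h0 : (0 : ℝ) ≤ j := Nat.cast_nonneg j
    refine le_trans ?_ (trigamma_sub_ge (by linarith) (by linarith))
    gcongr
    linarith
  refine le_trans (le_of_eq ?_) (Finset.sum_le_sum h1)
  rw [← Finset.sum_div, ← Finset.sum_div, hsum]
  field_simp
  ring

lemma trigamma_last_ge {b m : ℝ} (hb : 4 ≤ b) (hm : 1 ≤ m) :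
    1 / (4 * b) ≤ (2 * m + 1) * trigamma (b + m * (b - 1)) - trigamma b := by
  obtain ⟨h1, h2⟩ := betaExponent_sum_bounds hb (by linarith : 0 ≤ m)
  have hb0 : 0 < b := by linarith
  have hA : 0 < b + m * (b - 1) := lt_of_lt_of_le (by positivity) h1
  have h3 : 1 / ((m + 1) * b) ≤ trigamma (b + m * (b - 1)) :=
    le_trans (by gcongr) (le_trigamma hA)
  have h4 := trigamma_le hb0
  have h5 : (2 * m + 1) * (1 / ((m + 1) * b)) ≤ (2 * m + 1) * trigamma (b + m * (b - 1)) := by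
    gcongr
  have h6 : 3 / (2 * b) ≤ (2 * m + 1) * (1 / ((m + 1) * b)) := by
    rw [mul_one_div, div_le_div_iff₀ (by positivity) (by positivity)]
    nlinarith
  have h7 : 1 / b ^ 2 ≤ 1 / (4 * b) := by
    gcongr
    nlinarith
  have h8 : 3 / (2 * b) = 1 / b + 1 / (4 * b) + 1 / (4 * b) := by
    field_simp
    norm_num
  linarith

/-- The variance in the Beta model is at least of order `1 / n + m² / n²`. The second term comes
from the sum of differences, the first one from the last factor of the moment. -/
lemma le_betaVar {n m : ℕ} {ν : ℝ} (hm : m < n) (hm1 : 1 ≤ m) (hn : 8 ≤ n) (hν : 0 ≤ ν)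
    (hνn : ν ≤ n) : 1 / 8 * (1 / n + m ^ 2 / n ^ 2) ≤ betaVar n ν m := by
  have hn8 : (8 : ℝ) ≤ n := by exact_mod_cast hn
  have hm' : (1 : ℝ) ≤ m := by exact_mod_cast hm1
  have h1 := sum_trigamma_sub_ge hm hν
  set b := ((n : ℝ) + ν) / 2 with hb
  have hb4 : 4 ≤ b := by rw [hb]; linarith
  have hbn : b ≤ n := by rw [hb]; linarith
  have h2 := trigamma_last_ge hb4 hm'
  have h3 : 1 / 8 * (1 / (n : ℝ) + m ^ 2 / n ^ 2) ≤ 1 / 8 * (1 / b + m ^ 2 / b ^ 2) := by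
    gcongr
  have h4 : 1 / 8 * (1 / b + m ^ 2 / b ^ 2) ≤
      (m : ℝ) * (m - 1) / (4 * b ^ 2) + 1 / (4 * b) := by
    rw [show 1 / 8 * (1 / b + (m : ℝ) ^ 2 / b ^ 2) = (b + m ^ 2) / (8 * b ^ 2) by field_simp,
      show (m : ℝ) * (m - 1) / (4 * b ^ 2) + 1 / (4 * b) =
        (2 * (m * (m - 1)) + 2 * b) / (8 * b ^ 2) by field_simp; ring]
    refine div_le_div_of_nonneg_right ?_ (by positivity)
    nlinarith [sq_nonneg ((m : ℝ) - 1)]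
  rw [betaVar]
  linarith

/-- The analogue of `abs_log_gaussMoment_sub_le` in the Beta model. The product contributes an error
of order `m² / n³` and the last factor one of order `1 / n²`; both are bounded by the variance
divided by `n`, by `le_betaVar`. -/
lemma abs_log_betaMoment_sub_le {n m : ℕ} {ν k δ : ℝ} (hm : m < n) (hm1 : 1 ≤ m) (hn : 8 ≤ n)
    (hν : 0 ≤ ν) (hνn : ν ≤ n) (hδ : 0 < δ) (hmδ : δ * n ≤ n - m) (hk : 0 ≤ k) :
    |Real.log (betaMoment n ν k m) - (k * betaMean n ν m + k ^ 2 / 2 * betaVar n ν m)| ≤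
      8 * (12 * (1 + ν) / δ ^ 3 + 60) * k ^ 3 * betaVar n ν m / n := by
  have hn8 : (8 : ℝ) ≤ n := by exact_mod_cast hn
  have hm' : (1 : ℝ) ≤ m := by exact_mod_cast hm1
  have hn0 : (0 : ℝ) < n := by linarith
  have hv := le_betaVar hm hm1 hn hν hνn
  rw [log_betaMoment hm hν hk, add_sub_cancel_left]
  set b := ((n : ℝ) + ν) / 2 with hb
  have hb4 : 4 ≤ b := by rw [hb]; linarith
  have hbn : (n : ℝ) / 2 ≤ b := by rw [hb]; linarith
  obtain ⟨hA1, hA2⟩ := betaExponent_sum_bounds (m := m) hb4 (by linarith)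
  have h1 : ∀ j ∈ Finset.range m, |gammaRemainder (((n : ℝ) - j) / 2) k - gammaRemainder b k| ≤
      12 * (1 + ν) / δ ^ 3 * k ^ 3 * m / n ^ 3 := fun j hj => by
    have h0 : (j : ℝ) + 1 ≤ m := by exact_mod_cast Finset.mem_range.1 hj
    have h0' : (m : ℝ) + 1 ≤ n := by exact_mod_cast hm
    have hj0 : (0 : ℝ) ≤ j := Nat.cast_nonneg j
    refine (abs_gammaRemainder_sub_le (by linarith) (by rw [hb]; linarith) hk).trans ?_
    have e1 : b - ((n : ℝ) - j) / 2 ≤ (1 + ν) * m / 2 := by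
      rw [hb]
      nlinarith
    have e2 : δ * n / 2 ≤ ((n : ℝ) - j) / 2 := by linarith
    calc 3 * k ^ 3 * (b - ((n : ℝ) - j) / 2) / (((n : ℝ) - j) / 2) ^ 3
        ≤ 3 * k ^ 3 * ((1 + ν) * m / 2) / (δ * n / 2) ^ 3 := by gcongr
      _ = _ := by field_simp; ring
  have h2 : |∑ j ∈ Finset.range m, (gammaRemainder (((n : ℝ) - j) / 2) k - gammaRemainder b k)| ≤
      12 * (1 + ν) / δ ^ 3 * k ^ 3 * (m ^ 2 / n ^ 3) := by
    refine (Finset.abs_sum_le_sum_abs _ _).trans ((Finset.sum_le_card_nsmul _ _ _ h1).trans ?_)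
    rw [Finset.card_range, nsmul_eq_mul]
    refine le_of_eq ?_
    ring
  have h3 : |gammaRemainder (b + m * (b - 1)) ((m + 1) * k) -
      gammaRemainder (b + m * (b - 1)) (m * k)| ≤ 48 * k ^ 3 * (1 / n ^ 2) := by
    refine (abs_gammaRemainder_mul_sub_le (le_trans (by nlinarith) hA1) hk (by linarith)).trans ?_
    calc 3 * k ^ 3 * ((m : ℝ) + 1) ^ 2 / (b + m * (b - 1)) ^ 2
        ≤ 3 * k ^ 3 * ((m : ℝ) + 1) ^ 2 / ((m + 1) * (n / 2) / 2) ^ 2 := by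
          gcongr
          exact le_trans (by gcongr) hA1
      _ = _ := by field_simp; ring
  have h4 : |gammaRemainder b k| ≤ 12 * k ^ 3 * (1 / n ^ 2) := by
    refine (abs_gammaRemainder_le (by linarith) hk).trans ?_
    calc 3 * k ^ 3 / b ^ 2 ≤ 3 * k ^ 3 / (n / 2) ^ 2 := by gcongr
      _ = _ := by field_simp; ring
  refine (abs_add_le _ _).trans (le_trans (add_le_add h2
    ((abs_sub _ _).trans (add_le_add h3 h4))) ?_)
  calc 12 * (1 + ν) / δ ^ 3 * k ^ 3 * ((m : ℝ) ^ 2 / n ^ 3) +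
        (48 * k ^ 3 * (1 / n ^ 2) + 12 * k ^ 3 * (1 / n ^ 2))
      = k ^ 3 * (12 * (1 + ν) / δ ^ 3 * ((m : ℝ) ^ 2 / n ^ 3) + 60 * (1 / n ^ 2)) := by ring
    _ ≤ k ^ 3 * ((12 * (1 + ν) / δ ^ 3 + 60) * ((m : ℝ) ^ 2 / n ^ 3) +
        (12 * (1 + ν) / δ ^ 3 + 60) * (1 / n ^ 2)) := by
        have : 0 ≤ 12 * (1 + ν) / δ ^ 3 := by positivity
        gcongr <;> linarith
    _ = 8 * (12 * (1 + ν) / δ ^ 3 + 60) * k ^ 3 * (1 / 8 * (1 / n + m ^ 2 / n ^ 2)) / n := by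
        field_simp
        ring
    _ ≤ _ := by gcongr

/-! ### Limits of the variances -/

lemma sum_inv_sub_le_log {n m : ℕ} (hm : m < n) :
    ∑ j ∈ Finset.range m, 1 / ((n : ℝ) - j) ≤ Real.log (n / (n - m)) := by
  induction m with
  | zero =>
    have : (n : ℝ) ≠ 0 := by exact_mod_cast (by omega : n ≠ 0)
    simp [this]
  | succ m ih =>
    have h1 : (m : ℝ) + 1 < n := by exact_mod_cast hm
    have h0 : (0 : ℝ) ≤ m := Nat.cast_nonneg m
    rw [Finset.sum_range_succ]
    have hx : 0 < (n : ℝ) - m - 1 := by linarith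
    have h2 : 1 / ((n : ℝ) - m) ≤ Real.log ((n - m) / (n - m - 1)) := by
      have h3 := Real.one_sub_inv_le_log_of_pos (x := ((n : ℝ) - m) / (n - m - 1))
        (div_pos (by linarith) hx)
      rw [inv_div] at h3
      refine le_trans (le_of_eq ?_) h3
      have : (n : ℝ) - m ≠ 0 := by linarith
      field_simp
      ring
    have h4 : Real.log ((n : ℝ) / (n - (m + 1 : ℕ))) =
        Real.log (n / (n - m)) + Real.log ((n - m) / (n - m - 1)) := by
      rw [← Real.log_mul (div_pos (by linarith) (by linarith)).ne'
        (div_pos (by linarith) hx).ne']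
      congr 1
      have : (n : ℝ) - m ≠ 0 := by linarith
      push_cast
      rw [← sub_sub]
      field_simp
    linarith [ih (by omega)]

lemma log_le_sum_inv_sub {n m : ℕ} (hm : m < n) :
    Real.log ((n + 1) / (n - m + 1)) ≤ ∑ j ∈ Finset.range m, 1 / ((n : ℝ) - j) := by
  induction m with
  | zero =>
    have : (n : ℝ) + 1 ≠ 0 := by positivity
    simp [this]
  | succ m ih =>
    have h1 : (m : ℝ) + 1 < n := by exact_mod_cast hm
    have h0 : (0 : ℝ) ≤ m := Nat.cast_nonneg m
    rw [Finset.sum_range_succ]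
    have hx : 0 < (n : ℝ) - m := by linarith
    have h2 : Real.log ((n - m + 1) / (n - m)) ≤ 1 / ((n : ℝ) - m) := by
      have h3 := Real.log_le_sub_one_of_pos (x := ((n : ℝ) - m + 1) / (n - m))
        (div_pos (by linarith) hx)
      refine h3.trans (le_of_eq ?_)
      field_simp
      ring
    have h4 : Real.log (((n : ℝ) + 1) / (n - (m + 1 : ℕ) + 1)) =
        Real.log ((n + 1) / (n - m + 1)) + Real.log ((n - m + 1) / (n - m)) := by
      rw [← Real.log_mul (div_pos (by linarith) (by linarith)).ne'
        (div_pos (by linarith) hx).ne']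
      congr 1
      have : (n : ℝ) - m + 1 ≠ 0 := by linarith
      push_cast
      rw [show (n : ℝ) - (m + 1) + 1 = n - m by ring]
      field_simp
    linarith [ih (by omega)]

/-- The variance in the Gaussian model is a Riemann sum for `2 ∫ dx / (1 - x)`. -/
lemma gaussVar_bounds {n m : ℕ} (hm : m < n) :
    2 * Real.log ((n + 1) / (n - m + 1)) ≤ gaussVar n m ∧
    gaussVar n m ≤ 2 * Real.log (n / (n - m)) + m * (4 / ((n : ℝ) - m) ^ 2) := by
  have hj : ∀ j ∈ Finset.range m, (j : ℝ) + 1 ≤ m ∧ (m : ℝ) < n := fun j hj =>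
    ⟨by exact_mod_cast Finset.mem_range.1 hj, by exact_mod_cast hm⟩
  constructor
  · refine le_trans (mul_le_mul_of_nonneg_left (log_le_sum_inv_sub hm) zero_le_two) ?_
    rw [Finset.mul_sum]
    refine Finset.sum_le_sum fun j h => ?_
    refine le_trans (le_of_eq ?_) (le_trigamma (by linarith [hj j h]))
    rw [one_div_div, mul_one_div]
  · have h1 : ∀ j ∈ Finset.range m, trigamma (((n : ℝ) - j) / 2) ≤
        2 * (1 / ((n : ℝ) - j)) + 4 / ((n : ℝ) - m) ^ 2 := fun j h => by
      obtain ⟨h2, h3⟩ := hj j h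
      refine (trigamma_le (by linarith)).trans ?_
      have h4 : 1 / (((n : ℝ) - j) / 2) ^ 2 ≤ 1 / ((n - m) / 2) ^ 2 := by
        have h0 : 0 < ((n : ℝ) - m) / 2 := by linarith
        exact one_div_le_one_div_of_le (by positivity) (pow_le_pow_left₀ h0.le (by linarith) 2)
      have h5 : 1 / (((n : ℝ) - m) / 2) ^ 2 = 4 / (n - m) ^ 2 := by
        rw [div_pow, one_div_div]
        norm_num
      have h6 : 1 / (((n : ℝ) - j) / 2) = 2 * (1 / (n - j)) := by
        rw [one_div_div, mul_one_div]
      linarith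
    refine (Finset.sum_le_sum h1).trans ?_
    rw [Finset.sum_add_distrib, ← Finset.mul_sum, Finset.sum_const, Finset.card_range,
      nsmul_eq_mul]
    linarith [sum_inv_sub_le_log hm]

section Limits

variable {r : ℕ → ℕ} {α : ℝ}

lemma eventually_lt_and_le_sub (hα1 : α < 1)
    (hr : Tendsto (fun n : ℕ => (r n : ℝ) / n) atTop (𝓝 α)) :
    ∀ᶠ n : ℕ in atTop, r n < n ∧ (1 - α) / 2 * n ≤ (n : ℝ) - r n := by
  filter_upwards [hr.eventually_lt_const (show α < 1 - (1 - α) / 2 by linarith),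
    eventually_gt_atTop 0] with n hn h0
  have hn0 : (0 : ℝ) < n := by exact_mod_cast h0
  rw [div_lt_iff₀ hn0] at hn
  have h1 : 0 < (1 - α) / 2 * n := by
    have : 0 < 1 - α := by linarith
    positivity
  refine ⟨?_, by linarith⟩
  have : (r n : ℝ) < n := by linarith
  exact_mod_cast this

lemma tendsto_gaussVar (hα1 : α < 1)
    (hr : Tendsto (fun n : ℕ => (r n : ℝ) / n) atTop (𝓝 α)) :
    Tendsto (fun n => gaussVar n (r n)) atTop (𝓝 (2 * Real.log (1 / (1 - α)))) := by
  have hα : (0 : ℝ) < 1 - α := by linarith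
  have hinv : Tendsto (fun n : ℕ => (1 : ℝ) / n) atTop (𝓝 0) := tendsto_one_div_atTop_nhds_zero_nat
  have hev := eventually_lt_and_le_sub hα1 hr
  have hlow : Tendsto (fun n : ℕ => 2 * Real.log (((n : ℝ) + 1) / (n - r n + 1))) atTop
      (𝓝 (2 * Real.log (1 / (1 - α)))) := by
    have h1 : Tendsto (fun n : ℕ => (1 + (1 : ℝ) / n) / (1 - r n / n + 1 / n)) atTop
        (𝓝 ((1 + 0) / (1 - α + 0))) :=
      (hinv.const_add 1).div ((hr.const_sub 1).add hinv) (by simpa using hα.ne')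
    simp only [add_zero] at h1
    refine (h1.log (by positivity)).const_mul 2 |>.congr' ?_
    filter_upwards [eventually_gt_atTop 0] with n hn
    have hn0 : (n : ℝ) ≠ 0 := by exact_mod_cast hn.ne'
    congr 2
    field_simp
  have hupp : Tendsto (fun n : ℕ => 2 * Real.log ((n : ℝ) / (n - r n)) +
      r n * (4 / ((n : ℝ) - r n) ^ 2)) atTop (𝓝 (2 * Real.log (1 / (1 - α)))) := by
    have h1 : Tendsto (fun n : ℕ => (1 : ℝ) / (1 - r n / n)) atTop (𝓝 (1 / (1 - α))) :=
      tendsto_const_nhds.div (hr.const_sub 1) hα.ne'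
    have h2 : Tendsto (fun n : ℕ => 4 * ((r n : ℝ) / n * (1 / n)) * (1 / (1 - r n / n)) ^ 2) atTop
        (𝓝 (4 * (α * 0) * (1 / (1 - α)) ^ 2)) := ((hr.mul hinv).const_mul 4).mul (h1.pow 2)
    have h3 := ((h1.log (by positivity)).const_mul 2).add h2
    simp only [mul_zero, zero_mul, add_zero] at h3
    refine h3.congr' ?_
    filter_upwards [eventually_gt_atTop 0, hev] with n hn hnr
    have hn0 : (n : ℝ) ≠ 0 := by exact_mod_cast hn.ne'
    have hnr0 : (n : ℝ) - r n ≠ 0 := by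
      have : (r n : ℝ) < n := by exact_mod_cast hnr.1
      linarith
    have h4 : (1 : ℝ) / (1 - r n / n) = n / (n - r n) := by
      rw [one_sub_div hn0, one_div_div]
    rw [h4]
    congr 1
    field_simp
  refine tendsto_of_tendsto_of_tendsto_of_le_of_le' hlow hupp ?_ ?_
  · filter_upwards [hev] with n hn using (gaussVar_bounds hn.1).1
  · filter_upwards [hev] with n hn using (gaussVar_bounds hn.1).2

lemma betaVar_eq (n : ℕ) (ν : ℝ) (m : ℕ) :
    betaVar n ν m = gaussVar n m - m * trigamma ((n + ν) / 2) +
      ((2 * m + 1) * trigamma ((n + ν) / 2 + m * ((n + ν) / 2 - 1)) - trigamma ((n + ν) / 2)) := by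
  rw [betaVar, Finset.sum_sub_distrib, gaussVar, Finset.sum_const, Finset.card_range,
    nsmul_eq_mul]

/-- The part of the variance that comes from the last factor of the moment tends to `0`. -/
lemma trigamma_last_le {b m : ℝ} (hb : 4 ≤ b) (hm : 1 ≤ m) :
    (2 * m + 1) * trigamma (b + m * (b - 1)) - trigamma b ≤ 8 / b := by
  obtain ⟨h1, -⟩ := betaExponent_sum_bounds hb (by linarith : 0 ≤ m)
  have hb0 : 0 < b := by linarith
  have hA1 : 1 ≤ (m + 1) * b / 2 := by nlinarith
  have h2 : 0 ≤ trigamma b := le_trans (by positivity) (le_trigamma hb0)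
  set A := b + m * (b - 1)
  have hA0 : 0 < A := by linarith
  have h3 : trigamma A ≤ 2 / A := by
    refine (trigamma_le hA0).trans ?_
    have : 1 / A ^ 2 ≤ 1 / A := by
      gcongr
      nlinarith
    have h4 : 2 / A = 1 / A + 1 / A := by ring
    linarith
  have h5 : (2 * m + 1) * trigamma A ≤ 2 * (m + 1) * (2 / ((m + 1) * b / 2)) := by
    have : 0 ≤ trigamma A := le_trans (by positivity) (le_trigamma hA0)
    gcongr
    · linarith
    · exact h3.trans (by gcongr)
  have h6 : 2 * (m + 1) * (2 / ((m + 1) * b / 2)) = 8 / b := by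
    field_simp
    norm_num
  linarith

lemma tendsto_betaVar {ν : ℝ} (hν : 0 ≤ ν) (hα1 : α < 1)
    (hr1 : ∀ᶠ n in atTop, 1 ≤ r n)
    (hr : Tendsto (fun n : ℕ => (r n : ℝ) / n) atTop (𝓝 α)) :
    Tendsto (fun n => betaVar n ν (r n)) atTop (𝓝 (2 * Real.log (1 / (1 - α)) - 2 * α)) := by
  have hinv : Tendsto (fun n : ℕ => (1 : ℝ) / n) atTop (𝓝 0) := tendsto_one_div_atTop_nhds_zero_nat
  have hb : Tendsto (fun n : ℕ => 2 / (1 + ν * (1 / (n : ℝ)))) atTop (𝓝 (2 / (1 + ν * 0))) :=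
    tendsto_const_nhds.div ((hinv.const_mul ν).const_add 1) (by simp)
  rw [mul_zero, add_zero, div_one] at hb
  have hinvb : ∀ᶠ n : ℕ in atTop,
      1 / (((n : ℝ) + ν) / 2) = 1 / n * (2 / (1 + ν * (1 / (n : ℝ)))) := by
    filter_upwards [eventually_gt_atTop 0] with n hn
    have hn0 : (0 : ℝ) < n := by exact_mod_cast hn
    field_simp
  have hb4 : ∀ᶠ n : ℕ in atTop, 4 ≤ ((n : ℝ) + ν) / 2 := by
    filter_upwards [eventually_ge_atTop 8] with n hn
    have hn0 : (8 : ℝ) ≤ n := by exact_mod_cast hn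
    linarith
  have hinv0 : Tendsto (fun n : ℕ => 1 / (((n : ℝ) + ν) / 2)) atTop (𝓝 0) := by
    have := (hinv.mul hb)
    rw [zero_mul] at this
    exact this.congr' (hinvb.mono fun n h => h.symm)
  have h1 : Tendsto (fun n : ℕ => (r n : ℝ) * (1 / (((n : ℝ) + ν) / 2))) atTop (𝓝 (α * 2)) := by
    refine (hr.mul hb).congr' ?_
    filter_upwards [hinvb] with n hn
    rw [hn]
    ring
  have h2 : Tendsto (fun n : ℕ => (r n : ℝ) * trigamma (((n : ℝ) + ν) / 2)) atTop (𝓝 (α * 2)) := by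
    have h3 : Tendsto (fun n : ℕ => (r n : ℝ) * (1 / (((n : ℝ) + ν) / 2)) +
        (r n : ℝ) * (1 / (((n : ℝ) + ν) / 2)) * (1 / (((n : ℝ) + ν) / 2))) atTop
        (𝓝 (α * 2 + α * 2 * 0)) := h1.add (h1.mul hinv0)
    rw [mul_zero, add_zero] at h3
    refine tendsto_of_tendsto_of_tendsto_of_le_of_le' h1 h3 ?_ ?_
    · filter_upwards [hb4] with n hn
      have := le_trigamma (a := ((n : ℝ) + ν) / 2) (by linarith)
      gcongr
    · filter_upwards [hb4] with n hn
      have := trigamma_le (a := ((n : ℝ) + ν) / 2) (by linarith)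
      calc (r n : ℝ) * trigamma (((n : ℝ) + ν) / 2)
          ≤ r n * (1 / (((n : ℝ) + ν) / 2) + 1 / (((n : ℝ) + ν) / 2) ^ 2) := by gcongr
        _ = _ := by rw [← one_div_pow]; ring
  have h4 : Tendsto (fun n : ℕ => (2 * (r n : ℝ) + 1) * trigamma (((n : ℝ) + ν) / 2 +
      r n * ((n + ν) / 2 - 1)) - trigamma ((n + ν) / 2)) atTop (𝓝 0) := by
    have h8 := hinv0.const_mul 8
    rw [mul_zero] at h8
    refine tendsto_of_tendsto_of_tendsto_of_le_of_le' tendsto_const_nhds h8 ?_ ?_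
    · filter_upwards [hb4, hr1] with n hn hn1
      have hb0 : 0 < ((n : ℝ) + ν) / 2 := by linarith
      exact le_trans (by positivity) (trigamma_last_ge hn (by exact_mod_cast hn1))
    · filter_upwards [hb4, hr1] with n hn hn1
      rw [mul_one_div]
      exact trigamma_last_le hn (by exact_mod_cast hn1)
  have h5 := ((tendsto_gaussVar hα1 hr).sub h2).add h4
  simp only [betaVar_eq]
  convert h5 using 2
  ring

end Limits

namespace VertexModel

/-- The `k`-th moment of the squared normalized volume. -/
noncomputable def moment (M : VertexModel) (n : ℕ) (k : ℝ) (m : ℕ) : ℝ :=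
  match M with
  | gaussian => gaussMoment n k m
  | beta ν _ => betaMoment n ν k m
  | spherical => betaMoment n 0 k m

/-- The centering of the logarithm of the squared normalized volume. -/
noncomputable def logMean (M : VertexModel) (n m : ℕ) : ℝ :=
  match M with
  | gaussian => gaussMean n m
  | beta ν _ => betaMean n ν m
  | spherical => betaMean n 0 m

/-- The variance scale of the logarithm of the squared normalized volume. -/
noncomputable def logVar (M : VertexModel) (n m : ℕ) : ℝ :=
  match M with
  | gaussian => gaussVar n m
  | beta ν _ => betaVar n ν m
  | spherical => betaVar n 0 m

theorem law_submodule (M : VertexModel) {n : ℕ} (K : Submodule ℝ (EuclideanSpace ℝ (Fin n)))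
    (hK : K ≠ ⊤) : M.law n K = 0 := by
  match M with
  | gaussian => exact (weightFamily_gaussian n 0).measure_submodule_eq_zero K hK
  | beta ν _ => exact (weightFamily_beta (ν := ν) (k := 0)).measure_submodule_eq_zero K hK
  | spherical => exact sphereUniform_submodule K hK

theorem isProbabilityMeasure_law (M : VertexModel) {n : ℕ} (hn : 1 ≤ n) :
    IsProbabilityMeasure (M.law n) := by
  match M with
  | gaussian => simp only [law]; infer_instance
  | beta ν hν => exact isProbabilityMeasure_betaLaw hn hν
  | spherical => exact isProbabilityMeasure_sphereUniform hn

theorem lintegral_gramVolume (M : VertexModel) {n : ℕ} {k : ℝ} (hk : 0 ≤ k) {m : ℕ} (hm : m < n) :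
    ∫⁻ x : Fin (m + 1) → EuclideanSpace ℝ (Fin n), ENNReal.ofReal (gramVolume x ^ k)
        ∂(Measure.pi fun _ => M.law n) = ENNReal.ofReal (M.moment n k m) := by
  match M with
  | gaussian => exact lintegral_gramVolume_gaussian hk m hm
  | beta ν hν =>
    have := isProbabilityMeasure_betaLaw (n := n) (by omega) hν
    exact lintegral_gramVolume_beta hν hk m hm
  | spherical => exact lintegral_gramVolume_sphere hk m hm

theorem moment_pos (M : VertexModel) {n : ℕ} {k : ℝ} (hk : 0 ≤ k) {m : ℕ} (hm : m < n) :
    0 < M.moment n k m := by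
  match M with
  | gaussian => exact gaussMoment_pos hm hk
  | beta ν hν => exact betaMoment_pos hm hν.le hk
  | spherical => exact betaMoment_pos hm le_rfl hk

/-- The quadratic expansion of the logarithm of the moments, for all three models: as long as `n -
m` is at least `δ n`, the error is `O(k³ v / n)` and the variance `v` is at least `1 / (8 n)`. -/
theorem abs_log_moment_sub_le (M : VertexModel) {δ : ℝ} (hδ : 0 < δ) :
    ∃ C : ℝ, 0 ≤ C ∧ ∃ N : ℕ, ∀ n ≥ N, ∀ m : ℕ, 1 ≤ m → m < n → δ * n ≤ (n : ℝ) - m →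
      1 / (8 * (n : ℝ)) ≤ M.logVar n m ∧ ∀ k : ℝ, 0 ≤ k →
      |Real.log (M.moment n k m) - (k * M.logMean n m + k ^ 2 / 2 * M.logVar n m)| ≤
        C * k ^ 3 * M.logVar n m / n := by
  have hbeta : ∀ ν : ℝ, 0 ≤ ν → ∃ C : ℝ, 0 ≤ C ∧ ∃ N : ℕ, ∀ n ≥ N, ∀ m : ℕ, 1 ≤ m → m < n →
      δ * n ≤ (n : ℝ) - m →
      1 / (8 * (n : ℝ)) ≤ betaVar n ν m ∧ ∀ k : ℝ, 0 ≤ k →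
      |Real.log (betaMoment n ν k m) - (k * betaMean n ν m + k ^ 2 / 2 * betaVar n ν m)| ≤
        C * k ^ 3 * betaVar n ν m / n := by
    intro ν hν
    refine ⟨_, ?_, max 8 ⌈ν⌉₊, fun n hn m hm1 hm hmδ => ⟨?_, fun k hk =>
      abs_log_betaMoment_sub_le hm hm1 (le_trans (le_max_left _ _) hn) hν
        (le_trans (Nat.le_ceil ν) (by exact_mod_cast le_trans (le_max_right _ _) hn))
        hδ hmδ hk⟩⟩
    · positivity
    · refine le_trans ?_ (le_betaVar hm hm1 (le_trans (le_max_left _ _) hn) hν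
        (le_trans (Nat.le_ceil ν) (by exact_mod_cast le_trans (le_max_right _ _) hn)))
      have : (0 : ℝ) ≤ (m : ℝ) ^ 2 / n ^ 2 := by positivity
      rw [← one_div_mul_one_div]
      linarith
  match M with
  | gaussian =>
    refine ⟨6 / δ ^ 2, by positivity, 1, fun n hn m hm1 hm hmδ => ⟨?_, fun k hk =>
      abs_log_gaussMoment_sub_le hm hδ hmδ hk⟩⟩
    refine le_trans ?_ (le_gaussVar hm)
    have hn0 : (0 : ℝ) < n := by exact_mod_cast (by omega : 0 < n)
    have hm' : (1 : ℝ) ≤ m := by exact_mod_cast hm1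
    rw [div_le_div_iff₀ (by positivity) hn0]
    nlinarith
  | beta ν hν => exact hbeta ν hν.le
  | spherical => exact hbeta 0 le_rfl

/-- The variance scale of `log S`, where `S` is the squared volume, tends to `4` times the variance
of the limit law: the logarithm of the volume is `log S / 2`, up to a constant. -/
theorem tendsto_logVar (M : VertexModel) {r : ℕ → ℕ} {α : ℝ} (hα1 : α < 1)
    (hr1 : ∀ᶠ n in atTop, 1 ≤ r n)
    (hr : Tendsto (fun n : ℕ => (r n : ℝ) / n) atTop (𝓝 α)) :
    Tendsto (fun n => M.logVar n (r n)) atTop (𝓝 (4 * M.limitVariance α)) := by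
  match M with
  | gaussian =>
    have h : 4 * (gaussian).limitVariance α = 2 * Real.log (1 / (1 - α)) := by
      simp only [limitVariance]
      ring
    rw [h]
    exact tendsto_gaussVar hα1 hr
  | beta ν hν =>
    have h : 4 * (beta ν hν).limitVariance α = 2 * Real.log (1 / (1 - α)) - 2 * α := by
      simp only [limitVariance]
      ring
    rw [h]
    exact tendsto_betaVar hν.le hα1 hr1 hr
  | spherical =>
    have h : 4 * (spherical).limitVariance α = 2 * Real.log (1 / (1 - α)) - 2 * α := by
      simp only [limitVariance]
      ring
    rw [h]
    exact tendsto_betaVar le_rfl hα1 hr1 hr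

/-- With the scale `√(logVar)`, the logarithms of the normalized moments converge to those of a
standard normal random variable. -/
theorem tendsto_log_moment (M : VertexModel) {r : ℕ → ℕ} {α : ℝ} (hα1 : α < 1)
    (hr1 : ∀ᶠ n in atTop, 1 ≤ r n)
    (hr : Tendsto (fun n : ℕ => (r n : ℝ) / n) atTop (𝓝 α)) {t : ℝ} (ht : 0 ≤ t) :
    Tendsto (fun n => Real.log (M.moment n (t / √(M.logVar n (r n))) (r n)) -
      t / √(M.logVar n (r n)) * M.logMean n (r n)) atTop (𝓝 (t ^ 2 / 2)) := by
  obtain ⟨C, hC, N, hN⟩ := M.abs_log_moment_sub_le (δ := (1 - α) / 2) (by linarith)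
  have hev : ∀ᶠ n : ℕ in atTop, |Real.log (M.moment n (t / √(M.logVar n (r n))) (r n)) -
      t / √(M.logVar n (r n)) * M.logMean n (r n) - t ^ 2 / 2| ≤
      C * t ^ 3 * √8 * √(1 / n) := by
    filter_upwards [hr1, eventually_lt_and_le_sub hα1 hr, eventually_ge_atTop N,
      eventually_gt_atTop 0] with n h1 h2 h3 h4
    have hn0 : (0 : ℝ) < n := by exact_mod_cast h4
    obtain ⟨h5, h6⟩ := hN n h3 (r n) h1 h2.1 h2.2
    have hv0 : 0 < M.logVar n (r n) := lt_of_lt_of_le (by positivity) h5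
    have h7 := h6 (t / √(M.logVar n (r n))) (by positivity)
    set v := M.logVar n (r n)
    have hs : √v ^ 2 = v := Real.sq_sqrt hv0.le
    have hs0 : 0 < √v := Real.sqrt_pos.2 hv0
    have e1 : (t / √v) ^ 2 / 2 * v = t ^ 2 / 2 := by
      rw [div_pow, hs]
      field_simp
    rw [e1, ← sub_sub] at h7
    refine h7.trans ?_
    have e2 : C * (t / √v) ^ 3 * v / n = C * t ^ 3 * (1 / (√v * n)) := by
      rw [div_pow, pow_succ (√v) 2, hs]
      field_simp
    have e3 : 1 / (√v * n) ≤ √8 * √(1 / n) := by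
      rw [div_le_iff₀ (by positivity)]
      have h8 : √(1 / (8 * n)) ≤ √v := Real.sqrt_le_sqrt h5
      have h9 : √8 * √(1 / (n : ℝ)) * (√(1 / (8 * n)) * n) = 1 := by
        rw [← Real.sqrt_mul (by norm_num), mul_comm _ (n : ℝ), mul_left_comm,
          ← Real.sqrt_mul (by positivity),
          show (8 * (1 / (n : ℝ)) * (1 / (8 * n))) = (1 / n) ^ 2 by field_simp,
          Real.sqrt_sq (by positivity)]
        field_simp
      calc 1 = √8 * √(1 / (n : ℝ)) * (√(1 / (8 * n)) * n) := h9.symm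
        _ ≤ _ := by gcongr
    rw [e2, mul_assoc (C * t ^ 3)]
    gcongr
  have hlim : Tendsto (fun n : ℕ => C * t ^ 3 * √8 * √(1 / (n : ℝ))) atTop (𝓝 0) := by
    have h1 : Tendsto (fun n : ℕ => √(1 / (n : ℝ))) atTop (𝓝 (√0)) :=
      (Real.continuous_sqrt.tendsto 0).comp tendsto_one_div_atTop_nhds_zero_nat
    simpa using h1.const_mul (C * t ^ 3 * √8)
  rw [tendsto_iff_norm_sub_tendsto_zero]
  exact squeeze_zero' (Eventually.of_forall fun n => norm_nonneg _) hev hlim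

end VertexModel

/-! ### Convergence of one-sided exponential moments to those of the normal law -/

/-- The exponential moments of positive order characterize the standard normal law. -/
theorem eq_gaussianReal_of_lintegral_exp {ν : Measure ℝ} [IsProbabilityMeasure ν]
    (h : ∀ t : ℝ, 0 < t →
      ∫⁻ y, ENNReal.ofReal (Real.exp (t * y)) ∂ν = ENNReal.ofReal (Real.exp (t ^ 2 / 2))) :
    ν = gaussianReal 0 1 := by
  have hint : ∀ t : ℝ, 0 < t → Integrable (fun y => Real.exp (t * y)) ν := fun t ht => by
    refine ⟨by fun_prop, ?_⟩
    rw [hasFiniteIntegral_iff_ofReal (ae_of_all _ fun y => (Real.exp_pos _).le), h t ht]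
    exact ENNReal.ofReal_lt_top
  have hmgf : ∀ t : ℝ, 0 < t → mgf id ν t = Real.exp (t ^ 2 / 2) := fun t ht => by
    rw [mgf, integral_eq_lintegral_of_nonneg_ae (ae_of_all _ fun y => (Real.exp_pos _).le)
      (by fun_prop)]
    simp only [id_eq]
    rw [h t ht, ENNReal.toReal_ofReal (Real.exp_pos _).le]
  let U : Set ℂ := {z | 0 < z.re}
  have hsub : Set.Ioi (0 : ℝ) ⊆ interior (integrableExpSet id ν) :=
    interior_maximal (fun t ht => hint t ht) isOpen_Ioi
  have hanal : AnalyticOnNhd ℂ (complexMGF id ν) U :=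
    analyticOnNhd_complexMGF.mono fun z hz => hsub hz
  have hanal' : AnalyticOnNhd ℂ (fun z : ℂ => Complex.exp (z ^ 2 / 2)) U := fun z _ => by
    fun_prop
  have hconn : IsPreconnected U := (convex_halfSpace_re_gt 0).isPreconnected
  have hfreq : ∃ᶠ z in 𝓝[≠] (1 : ℂ), complexMGF id ν z = Complex.exp (z ^ 2 / 2) := by
    have h1 : Tendsto (fun x : ℝ => (x : ℂ)) (𝓝[≠] 1) (𝓝[≠] 1) := by
      refine tendsto_nhdsWithin_of_tendsto_nhds_of_eventually_within _ ?_ ?_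
      · exact (Complex.continuous_ofReal.tendsto 1).mono_left nhdsWithin_le_nhds
      · filter_upwards [self_mem_nhdsWithin] with x hx
        simpa using hx
    refine h1.frequently (Eventually.frequently ?_)
    filter_upwards [nhdsWithin_le_nhds (Ioi_mem_nhds zero_lt_one)] with x hx
    rw [complexMGF_ofReal, hmgf x hx]
    push_cast
    rfl
  have heq : Set.EqOn (complexMGF id ν) (fun z : ℂ => Complex.exp (z ^ 2 / 2)) U :=
    hanal.eqOn_of_preconnected_of_frequently_eq hanal' hconn (by simp [U]) hfreq
  refine Measure.ext_of_charFun ?_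
  funext s
  rw [charFun_gaussianReal, ← complexMGF_id_mul_I]
  -- the characteristic function is the boundary value on the imaginary axis
  have hz : Tendsto (fun ε : ℝ => (ε : ℂ) + s * Complex.I) (𝓝[>] 0) (𝓝 (s * Complex.I)) := by
    have : Continuous fun ε : ℝ => (ε : ℂ) + s * Complex.I := by fun_prop
    have h0 := this.tendsto 0
    rw [Complex.ofReal_zero, zero_add] at h0
    exact h0.mono_left nhdsWithin_le_nhds
  have hlim1 : Tendsto (fun ε : ℝ => complexMGF id ν ((ε : ℂ) + s * Complex.I)) (𝓝[>] 0)
      (𝓝 (complexMGF id ν (s * Complex.I))) := by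
    refine tendsto_integral_filter_of_dominated_convergence (fun y => 1 + Real.exp (1 * y))
      ?_ ?_ ?_ ?_
    · exact Eventually.of_forall fun ε => by fun_prop
    · filter_upwards [Ioo_mem_nhdsGT (zero_lt_one (α := ℝ))] with ε hε
      refine ae_of_all _ fun y => ?_
      rw [Complex.norm_exp]
      have h1 : (((ε : ℂ) + s * Complex.I) * (id y : ℝ)).re = ε * y := by simp
      rw [h1, one_mul]
      rcases le_total 0 y with hy | hy
      · have : Real.exp (ε * y) ≤ Real.exp y :=
          Real.exp_le_exp.2 (mul_le_of_le_one_left hy hε.2.le)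
        linarith
      · have : Real.exp (ε * y) ≤ 1 :=
          Real.exp_le_one_iff.2 (mul_nonpos_of_nonneg_of_nonpos hε.1.le hy)
        linarith [Real.exp_pos y]
    · exact (integrable_const 1).add (hint 1 one_pos)
    · refine ae_of_all _ fun y => ?_
      exact (Complex.continuous_exp.tendsto _).comp (hz.mul_const _)
  have hlim2 : Tendsto (fun ε : ℝ => complexMGF id ν ((ε : ℂ) + s * Complex.I)) (𝓝[>] 0)
      (𝓝 (Complex.exp ((s * Complex.I) ^ 2 / 2))) := by
    have h1 := (Complex.continuous_exp.tendsto _).comp ((hz.pow 2).div_const 2)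
    refine h1.congr' ?_
    filter_upwards [self_mem_nhdsWithin] with ε hε
    have hε0 : (0 : ℝ) < ε := hε
    exact (heq (show (ε : ℂ) + s * Complex.I ∈ U by simpa [U] using hε0)).symm
  rw [tendsto_nhds_unique hlim1 hlim2, mul_pow, Complex.I_sq]
  congr 1
  simp
  ring

section Curtiss

variable {μ : ℕ → ProbabilityMeasure ℝ}

/-- Chebyshev's inequality for `exp (t Y)` around `1`. -/
lemma measure_norm_gt_le {ν : Measure ℝ} [IsProbabilityMeasure ν] {t : ℝ} (ht : 0 < t) :
    ν {x | Real.log 2 / t < ‖x‖} + 8 * ∫⁻ y, ENNReal.ofReal (Real.exp (t * y)) ∂ν ≤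
      4 + 4 * ∫⁻ y, ENNReal.ofReal (Real.exp (2 * t * y)) ∂ν := by
  have hm : MeasurableSet {x : ℝ | Real.log 2 / t < ‖x‖} :=
    measurableSet_lt (by fun_prop) (by fun_prop)
  rw [← lintegral_indicator_one hm, ← lintegral_const_mul _ (by fun_prop),
    ← lintegral_const_mul _ (by fun_prop), ← lintegral_add_left (measurable_one.indicator hm)]
  have h4 : 4 + ∫⁻ y, 4 * ENNReal.ofReal (Real.exp (2 * t * y)) ∂ν =
      ∫⁻ y, (4 + 4 * ENNReal.ofReal (Real.exp (2 * t * y))) ∂ν := by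
    rw [lintegral_add_left measurable_const, lintegral_const, measure_univ, mul_one]
  rw [h4]
  refine lintegral_mono fun y => ?_
  have h2t : Real.exp (2 * t * y) = Real.exp (t * y) ^ 2 := by
    rw [← Real.exp_nat_mul]
    congr 1
    push_cast
    ring
  have h8 : (8 : ℝ≥0∞) = ENNReal.ofReal 8 := by simp
  have h4' : (4 : ℝ≥0∞) = ENNReal.ofReal 4 := by simp
  have hp := Real.exp_pos (t * y)
  simp only
  rw [h2t, h8, h4', ← ENNReal.ofReal_mul (by norm_num), ← ENNReal.ofReal_mul (by norm_num),
    ← ENNReal.ofReal_add (by norm_num) (by positivity)]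
  by_cases hy : Real.log 2 / t < ‖y‖
  · rw [Set.indicator_of_mem (by exact hy), Pi.one_apply, ← ENNReal.ofReal_one,
      ← ENNReal.ofReal_add zero_le_one (by positivity)]
    refine ENNReal.ofReal_le_ofReal ?_
    rw [div_lt_iff₀ ht, Real.norm_eq_abs] at hy
    rcases le_total 0 y with h0 | h0
    · rw [abs_of_nonneg h0] at hy
      have : 2 < Real.exp (t * y) := by
        rw [← Real.log_lt_iff_lt_exp two_pos]
        linarith
      nlinarith
    · rw [abs_of_nonpos h0] at hy
      have : Real.exp (t * y) < 1 / 2 := by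
        rw [← Real.lt_log_iff_exp_lt (by norm_num), one_div, Real.log_inv]
        linarith
      nlinarith
  · rw [Set.indicator_of_notMem (by exact hy), zero_add]
    refine ENNReal.ofReal_le_ofReal ?_
    nlinarith [sq_nonneg (Real.exp (t * y) - 1)]

lemma isTightMeasureSet_of_tendsto_exp
    (h : ∀ t : ℝ, 0 < t → Tendsto (fun n =>
      ∫⁻ y, ENNReal.ofReal (Real.exp (t * y)) ∂(μ n : Measure ℝ))
      atTop (𝓝 (ENNReal.ofReal (Real.exp (t ^ 2 / 2))))) :
    IsTightMeasureSet (Set.range fun n => (μ n : Measure ℝ)) := by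
  refine isTightMeasureSet_range_of_tendsto_limsup_measure_norm_gt ?_
  rw [ENNReal.tendsto_nhds_zero]
  intro ε hε
  -- the limiting Chebyshev bound vanishes as `t → 0`
  obtain ⟨t, ht, hte⟩ : ∃ t : ℝ, 0 < t ∧ 4 + 4 * ENNReal.ofReal (Real.exp ((2 * t) ^ 2 / 2)) <
      ε + 8 * ENNReal.ofReal (Real.exp (t ^ 2 / 2)) := by
    have c1 : Tendsto (fun t : ℝ => 4 + 4 * ENNReal.ofReal (Real.exp ((2 * t) ^ 2 / 2))) (𝓝[>] 0)
        (𝓝 (4 + 4 * ENNReal.ofReal (Real.exp ((2 * 0) ^ 2 / 2)))) := by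
      refine Tendsto.mono_left ?_ nhdsWithin_le_nhds
      refine Tendsto.const_add _ (ENNReal.Tendsto.const_mul (ENNReal.tendsto_ofReal ?_) (by simp))
      have : Continuous fun t : ℝ => Real.exp ((2 * t) ^ 2 / 2) := by fun_prop
      exact this.tendsto 0
    have h8 : 4 + 4 * ENNReal.ofReal (Real.exp ((2 * 0) ^ 2 / 2)) < ε + 8 := by
      norm_num
      rw [add_comm]
      exact ENNReal.lt_add_right (by simp) hε.ne'
    obtain ⟨t, h1, h2⟩ := ((c1.eventually_lt_const h8).and self_mem_nhdsWithin).exists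
    refine ⟨t, h2, h1.trans_le ?_⟩
    gcongr
    calc (8 : ℝ≥0∞) = 8 * 1 := (mul_one _).symm
      _ ≤ _ := by
        gcongr
        exact ENNReal.one_le_ofReal.2 (Real.one_le_exp (by positivity))
  have hev : ∀ᶠ n in atTop, (μ n : Measure ℝ) {x | Real.log 2 / t < ‖x‖} ≤ ε := by
    have e1 := (ENNReal.Tendsto.const_mul (a := 4) (h (2 * t) (by positivity))
      (by simp)).const_add 4
    have e2 := (ENNReal.Tendsto.const_mul (a := 8) (h t ht) (by simp)).const_add ε
    filter_upwards [e1.eventually_lt e2 hte,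
      (h t ht).eventually_lt_const ENNReal.ofReal_lt_top] with n h1 h2
    have h3 := (measure_norm_gt_le (ν := μ n) ht).trans h1.le
    exact (ENNReal.add_le_add_iff_right (ENNReal.mul_ne_top (by simp) h2.ne)).1 h3
  filter_upwards [eventually_ge_atTop (Real.log 2 / t)] with R hR
  refine limsup_le_of_le (by isBoundedDefault) ?_
  filter_upwards [hev] with n hn
  exact (measure_mono fun x (hx : R < ‖x‖) => lt_of_le_of_lt hR hx).trans hn

/-- Along a filter on which the laws converge weakly, the exponential moments pass to the limit. -/
lemma lintegral_exp_of_tendsto {l : Filter ℕ} [l.NeBot] {ν : ProbabilityMeasure ℝ}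
    (hν : Tendsto μ l (𝓝 ν))
    (h : ∀ t : ℝ, 0 < t → Tendsto (fun n =>
      ∫⁻ y, ENNReal.ofReal (Real.exp (t * y)) ∂(μ n : Measure ℝ))
      l (𝓝 (ENNReal.ofReal (Real.exp (t ^ 2 / 2))))) {t : ℝ} (ht : 0 < t) :
    ∫⁻ y, ENNReal.ofReal (Real.exp (t * y)) ∂(ν : Measure ℝ) =
      ENNReal.ofReal (Real.exp (t ^ 2 / 2)) := by
  have hc : Continuous fun y : ℝ => (Real.exp (t * y)).toNNReal := by fun_prop
  have hK : ∀ K : ℕ, Tendsto (fun n => ∫⁻ y, truncation hc K y ∂(μ n : Measure ℝ)) l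
      (𝓝 (∫⁻ y, truncation hc K y ∂(ν : Measure ℝ))) := fun K =>
    ProbabilityMeasure.tendsto_iff_forall_lintegral_tendsto.1 hν _
  have hle : ∀ (K : ℕ) (y : ℝ), (truncation hc K y : ℝ≥0∞) ≤ ENNReal.ofReal (Real.exp (t * y)) :=
    fun K y => ENNReal.coe_le_coe.2 (min_le_left _ _)
  have hge : ∀ (K : ℕ) (y : ℝ), 0 < K → ENNReal.ofReal (Real.exp (t * y)) ≤
      truncation hc K y + ENNReal.ofReal (Real.exp (2 * t * y)) / K := by
    intro K y hK0
    rw [truncation_apply]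
    by_cases hy : (Real.exp (t * y)).toNNReal ≤ K
    · rw [min_eq_left hy]
      exact le_self_add
    · refine le_trans ?_ le_add_self
      rw [ENNReal.le_div_iff_mul_le (by simp; omega) (by simp)]
      push Not at hy
      have h1 : (K : ℝ≥0∞) ≤ ENNReal.ofReal (Real.exp (t * y)) :=
        (ENNReal.coe_natCast K).symm.trans_le (ENNReal.coe_le_coe.2 hy.le)
      calc ENNReal.ofReal (Real.exp (t * y)) * K
          ≤ ENNReal.ofReal (Real.exp (t * y)) * ENNReal.ofReal (Real.exp (t * y)) := by gcongr
        _ = _ := by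
          rw [← ENNReal.ofReal_mul (Real.exp_pos _).le, ← Real.exp_add]
          congr 2
          ring
  apply le_antisymm
  · have h1 : ∫⁻ y, ENNReal.ofReal (Real.exp (t * y)) ∂(ν : Measure ℝ) =
        ⨆ K : ℕ, ∫⁻ y, truncation hc K y ∂(ν : Measure ℝ) := by
      rw [← lintegral_iSup (fun K => by fun_prop)]
      · refine lintegral_congr fun y => le_antisymm ?_ (iSup_le fun K => hle K y)
        obtain ⟨K, hK⟩ := exists_nat_ge (Real.exp (t * y)).toNNReal
        refine le_trans (le_of_eq ?_) (le_iSup _ K)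
        rw [truncation_apply, min_eq_left hK]
        rfl
      · intro K K' hKK' y
        exact ENNReal.coe_le_coe.2 (min_le_min_left _ (by exact_mod_cast hKK'))
    rw [h1]
    refine iSup_le fun K => le_of_tendsto_of_tendsto' (hK K) (h t ht) fun n => ?_
    exact lintegral_mono fun y => hle K y
  · have h2 : ∀ K : ℕ, 0 < K → ENNReal.ofReal (Real.exp (t ^ 2 / 2)) ≤
        ∫⁻ y, ENNReal.ofReal (Real.exp (t * y)) ∂(ν : Measure ℝ) +
          ENNReal.ofReal (Real.exp ((2 * t) ^ 2 / 2)) / K := by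
      intro K hK0
      have hKne : (K : ℝ≥0∞) ≠ 0 := by simp; omega
      have h3 := (hK K).add (ENNReal.Tendsto.div_const (h (2 * t) (by positivity))
        (Or.inr hKne))
      refine (le_of_tendsto_of_tendsto' (h t ht) h3 fun n => ?_).trans ?_
      · simp only [div_eq_mul_inv]
        rw [← lintegral_mul_const _ (by fun_prop), ← lintegral_add_left (by fun_prop)]
        exact lintegral_mono fun y => hge K y hK0
      · gcongr with y
        exact hle K y
    have h4 : Tendsto (fun K : ℕ => ∫⁻ y, ENNReal.ofReal (Real.exp (t * y)) ∂(ν : Measure ℝ) +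
        ENNReal.ofReal (Real.exp ((2 * t) ^ 2 / 2)) / K) atTop
        (𝓝 (∫⁻ y, ENNReal.ofReal (Real.exp (t * y)) ∂(ν : Measure ℝ) + 0)) := by
      refine Tendsto.const_add _ ?_
      simp only [div_eq_mul_inv]
      have := ENNReal.Tendsto.const_mul (a := ENNReal.ofReal (Real.exp ((2 * t) ^ 2 / 2)))
        ENNReal.tendsto_inv_nat_nhds_zero (by simp)
      rw [mul_zero] at this
      exact this
    rw [add_zero] at h4
    exact ge_of_tendsto h4 ((eventually_gt_atTop 0).mono h2)

/-- If all exponential moments of positive order converge to those of the standard normal law, then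
the laws converge weakly. -/
theorem tendsto_gaussianReal_of_tendsto_exp
    (h : ∀ t : ℝ, 0 < t → Tendsto (fun n =>
      ∫⁻ y, ENNReal.ofReal (Real.exp (t * y)) ∂(μ n : Measure ℝ))
      atTop (𝓝 (ENNReal.ofReal (Real.exp (t ^ 2 / 2))))) :
    Tendsto μ atTop (𝓝 ⟨gaussianReal 0 1, inferInstance⟩) := by
  have htight : IsTightMeasureSet {x : Measure ℝ | ∃ ν ∈ Set.range μ, (ν : Measure ℝ) = x} := by
    convert isTightMeasureSet_of_tendsto_exp h using 1
    ext x
    simp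
  refine (isCompact_closure_of_isTightMeasureSet htight).tendsto_nhds_of_unique_mapClusterPt
    (Eventually.of_forall fun n => subset_closure ⟨n, rfl⟩) fun ν _ hν => ?_
  obtain ⟨U, hU, hUν⟩ := mapClusterPt_iff_ultrafilter.1 hν
  apply Subtype.ext
  have : IsProbabilityMeasure (ν : Measure ℝ) := ν.2
  exact eq_gaussianReal_of_lintegral_exp (ν := (ν : Measure ℝ)) fun t ht =>
    lintegral_exp_of_tendsto hUν (fun t ht => (h t ht).mono_left hU) ht

end Curtiss

/-! ### Limit laws for the volume -/

/-- Weak convergence is preserved by a continuous map depending continuously on a convergent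
parameter. -/
lemma tendsto_map_of_tendsto_param {μ : ℕ → ProbabilityMeasure ℝ} {ν : ProbabilityMeasure ℝ}
    (hμ : Tendsto μ atTop (𝓝 ν)) {s : ℕ → ℝ} {s₀ : ℝ} (hs : Tendsto s atTop (𝓝 s₀))
    {H : ℝ × ℝ → ℝ} (hH : Continuous H) :
    Tendsto (fun n => (μ n).map (f := fun y => H (y, s n)) (by fun_prop)) atTop
      (𝓝 (ν.map (f := fun y => H (y, s₀)) (by fun_prop))) := by
  have h1 := hμ.prodMk_nhds ((continuous_diracProba.tendsto s₀).comp hs)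
  have h2 := (ProbabilityMeasure.continuous_prod.tendsto _).comp h1
  have h3 := ProbabilityMeasure.tendsto_map_of_tendsto_of_continuous _ _ h2 hH
  have h4 : ∀ (ρ : ProbabilityMeasure ℝ) (a : ℝ),
      (ρ.prod (diracProba a)).map hH.measurable.aemeasurable =
        ρ.map (f := fun y => H (y, a)) (by fun_prop) := by
    intro ρ a
    apply Subtype.ext
    change ((ρ : Measure ℝ).prod (Measure.dirac a)).map H = (ρ : Measure ℝ).map _
    rw [Measure.prod_dirac, Measure.map_map hH.measurable (by fun_prop)]
    rfl
  rw [← h4]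
  refine h3.congr fun n => ?_
  rw [← h4]
  rfl

lemma measurable_gramVolume {n m : ℕ} :
    Measurable (gramVolume : (Fin (m + 1) → EuclideanSpace ℝ (Fin n)) → ℝ) :=
  continuous_gramVolume.measurable

namespace IsVertexArray

variable {M : VertexModel} {r : ℕ → ℕ} {Ω : ℕ → Type*} [∀ n, MeasurableSpace (Ω n)]
  {P : ∀ n, Measure (Ω n)} {X : ∀ n, Fin (r n + 1) → Ω n → EuclideanSpace ℝ (Fin n)}

lemma aemeasurable (hX : IsVertexArray M r P X) (n : ℕ) :
    AEMeasurable (fun ω i => X n i ω) (P n) := by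
  refine aemeasurable_pi_lambda _ fun i => ?_
  rcases Nat.eq_zero_or_pos n with rfl | hn
  -- in dimension `0` nothing is assumed about the vertices, but `ℝ⁰` has a single point
  · exact (measurable_of_subsingleton_codomain _).aemeasurable
  · exact (hX.hasLaw n hn i).aemeasurable

variable [∀ n, IsProbabilityMeasure (P n)]

lemma map_eq_pi (hX : IsVertexArray M r P X) {n : ℕ} (hn : 1 ≤ n) :
    (P n).map (fun ω i => X n i ω) = Measure.pi fun _ => M.law n := by
  rw [(iIndepFun_iff_map_fun_eq_pi_map fun i => (hX.hasLaw n hn i).aemeasurable).1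
    (hX.indep n hn)]
  congr 1
  funext i
  exact (hX.hasLaw n hn i).map_eq

/-- The simplex is almost surely nondegenerate. -/
lemma ae_gramVolume_pos (hX : IsVertexArray M r P X) {n : ℕ} (hr : r n < n) :
    ∀ᵐ ω ∂(P n), 0 < gramVolume fun i => X n i ω := by
  have hn : 1 ≤ n := by omega
  have := M.isProbabilityMeasure_law hn
  have h1 := ae_linearIndependent_vertexFrame (μ := M.law n) (fun K hK => M.law_submodule K hK)
    (r n) hr
  rw [← hX.map_eq_pi hn] at h1
  filter_upwards [ae_of_ae_map (hX.aemeasurable n) h1] with ω hω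
  exact lt_of_le_of_ne (gramVolume_nonneg _) (gramVolume_ne_zero_of_linearIndependent hω).1.symm

end IsVertexArray

namespace VertexModel

/-- The standardized logarithm of the squared normalized volume. -/
noncomputable def logScore (M : VertexModel) {n m : ℕ}
    (x : Fin (m + 1) → EuclideanSpace ℝ (Fin n)) : ℝ :=
  (Real.log (gramVolume x) - M.logMean n m) / √(M.logVar n m)

lemma measurable_logScore (M : VertexModel) {n m : ℕ} :
    Measurable (M.logScore : (Fin (m + 1) → EuclideanSpace ℝ (Fin n)) → ℝ) := by
  have := measurable_gramVolume (n := n) (m := m)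
  unfold logScore
  fun_prop

lemma eventually_logVar_pos (M : VertexModel) {r : ℕ → ℕ} {α : ℝ} (hα1 : α < 1)
    (hr1 : ∀ᶠ n in atTop, 1 ≤ r n)
    (hr : Tendsto (fun n : ℕ => (r n : ℝ) / n) atTop (𝓝 α)) :
    ∀ᶠ n in atTop, 0 < M.logVar n (r n) := by
  obtain ⟨C, -, N, hN⟩ := M.abs_log_moment_sub_le (δ := (1 - α) / 2) (by linarith)
  filter_upwards [hr1, eventually_lt_and_le_sub hα1 hr, eventually_ge_atTop N,
    eventually_gt_atTop 0] with n h1 h2 h3 h4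
  have hn0 : (0 : ℝ) < n := by exact_mod_cast h4
  exact lt_of_lt_of_le (by positivity) (hN n h3 (r n) h1 h2.1 h2.2).1

variable {M : VertexModel} {r : ℕ → ℕ} {α : ℝ} {Ω : ℕ → Type*} [∀ n, MeasurableSpace (Ω n)]
  {P : ∀ n, Measure (Ω n)} [∀ n, IsProbabilityMeasure (P n)]
  {X : ∀ n, Fin (r n + 1) → Ω n → EuclideanSpace ℝ (Fin n)}

omit [∀ n, IsProbabilityMeasure (P n)] in
lemma aemeasurable_logScore (hX : IsVertexArray M r P X) (n : ℕ) :
    AEMeasurable (fun ω => M.logScore fun i => X n i ω) (P n) :=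
  M.measurable_logScore.comp_aemeasurable (hX.aemeasurable n)

/-- The exponential moments of the standardized logarithm are normalized moments of the volume. -/
lemma lintegral_exp_logScore (hX : IsVertexArray M r P X) {n : ℕ} (hr : r n < n) {t : ℝ}
    (ht : 0 ≤ t) :
    ∫⁻ ω, ENNReal.ofReal (Real.exp (t * M.logScore fun i => X n i ω)) ∂(P n) =
      ENNReal.ofReal (Real.exp (Real.log (M.moment n (t / √(M.logVar n (r n))) (r n)) -
        t / √(M.logVar n (r n)) * M.logMean n (r n))) := by
  set k := t / √(M.logVar n (r n)) with hk
  have hk0 : 0 ≤ k := by positivity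
  have hm := measurable_gramVolume (n := n) (m := r n)
  have h1 : ∀ᵐ ω ∂(P n), ENNReal.ofReal (Real.exp (t * M.logScore fun i => X n i ω)) =
      ENNReal.ofReal (Real.exp (-(k * M.logMean n (r n)))) *
        ENNReal.ofReal ((gramVolume fun i => X n i ω) ^ k) := by
    filter_upwards [hX.ae_gramVolume_pos hr] with ω hω
    rw [← ENNReal.ofReal_mul (Real.exp_pos _).le, Real.rpow_def_of_pos hω, ← Real.exp_add]
    congr 2
    rw [logScore, hk]
    ring
  have h2 := M.lintegral_gramVolume hk0 hr
  rw [← hX.map_eq_pi (by omega), lintegral_map' (by fun_prop) (hX.aemeasurable n)] at h2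
  rw [lintegral_congr_ae h1, lintegral_const_mul' _ _ ENNReal.ofReal_ne_top, h2,
    ← ENNReal.ofReal_mul (Real.exp_pos _).le, sub_eq_add_neg, Real.exp_add,
    Real.exp_log (M.moment_pos hk0 hr), mul_comm]

/-- The standardized logarithm of the volume is asymptotically standard normal. -/
theorem tendsto_map_logScore (hX : IsVertexArray M r P X) (hα1 : α < 1)
    (hr1 : ∀ᶠ n in atTop, 1 ≤ r n)
    (hr : Tendsto (fun n : ℕ => (r n : ℝ) / n) atTop (𝓝 α)) :
    Tendsto (β := ProbabilityMeasure ℝ)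
      (fun n => ⟨(P n).map fun ω => M.logScore fun i => X n i ω,
        Measure.isProbabilityMeasure_map
          (aemeasurable_logScore hX n)⟩) atTop
      (𝓝 ⟨gaussianReal 0 1, inferInstance⟩) := by
  refine tendsto_gaussianReal_of_tendsto_exp fun t ht => ?_
  have h1 := ENNReal.tendsto_ofReal
    ((Real.continuous_exp.tendsto _).comp (M.tendsto_log_moment hα1 hr1 hr ht.le))
  refine h1.congr' ?_
  filter_upwards [eventually_lt_and_le_sub hα1 hr] with n hn
  simp only [ProbabilityMeasure.coe_mk]
  rw [lintegral_map' (by fun_prop) (aemeasurable_logScore hX n)]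
  exact (lintegral_exp_logScore hX hn.1 ht.le).symm

/-- A statistic of the vertices that is a continuous function of the standardized logarithm of the
volume and of its scale converges in distribution. -/
theorem tendstoInDistribution_of_logScore (hX : IsVertexArray M r P X) (hα1 : α < 1)
    (hr1 : ∀ᶠ n in atTop, 1 ≤ r n)
    (hr : Tendsto (fun n : ℕ => (r n : ℝ) / n) atTop (𝓝 α))
    {Ω' : Type*} [MeasurableSpace Ω'] {P' : Measure Ω'} [IsProbabilityMeasure P']
    {Z : Ω' → ℝ} (hZ : HasLaw Z (gaussianReal 0 1) P') {H : ℝ × ℝ → ℝ} (hH : Continuous H)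
    {T : ∀ n, (Fin (r n + 1) → EuclideanSpace ℝ (Fin n)) → ℝ} (hT : ∀ n, Measurable (T n))
    (hTH : ∀ᶠ n in atTop, ∀ x, 0 < gramVolume x →
      T n x = H (M.logScore x, √(M.logVar n (r n)) / 2)) :
    TendstoInDistribution (fun n ω => T n fun i => X n i ω) atTop
      (fun ω => H (Z ω, √(M.limitVariance α))) P P' := by
  have hTm : ∀ n, AEMeasurable (fun ω => T n fun i => X n i ω) (P n) := fun n =>
    (hT n).comp_aemeasurable (hX.aemeasurable n)
  have hs : Tendsto (fun n => √(M.logVar n (r n)) / 2) atTop (𝓝 (√(M.limitVariance α))) := by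
    have h1 := ((Real.continuous_sqrt.tendsto _).comp (M.tendsto_logVar hα1 hr1 hr)).div_const 2
    rw [Real.sqrt_mul (by norm_num), show (4 : ℝ) = 2 ^ 2 by norm_num,
      Real.sqrt_sq zero_le_two, mul_div_cancel_left₀ _ two_ne_zero] at h1
    exact h1
  refine ⟨hTm, hH.measurable.comp_aemeasurable (hZ.aemeasurable.prodMk aemeasurable_const), ?_⟩
  have h2 := tendsto_map_of_tendsto_param (tendsto_map_logScore hX hα1 hr1 hr) hs hH
  have hlim : (⟨P'.map fun ω => H (Z ω, √(M.limitVariance α)), Measure.isProbabilityMeasure_map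
      (hH.measurable.comp_aemeasurable (hZ.aemeasurable.prodMk aemeasurable_const))⟩ :
      ProbabilityMeasure ℝ) = ProbabilityMeasure.map ⟨gaussianReal 0 1, inferInstance⟩
        (f := fun y => H (y, √(M.limitVariance α))) (by fun_prop) := by
    apply Subtype.ext
    change P'.map _ = (gaussianReal 0 1).map _
    rw [← hZ.map_eq, AEMeasurable.map_map_of_aemeasurable (by fun_prop) hZ.aemeasurable]
    rfl
  rw [hlim]
  refine h2.congr' ?_
  filter_upwards [hTH, eventually_lt_and_le_sub hα1 hr] with n h3 h4
  apply Subtype.ext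
  change ((P n).map _).map _ = (P n).map _
  rw [AEMeasurable.map_map_of_aemeasurable (by fun_prop)
    (aemeasurable_logScore hX n)]
  refine Measure.map_congr ?_
  filter_upwards [hX.ae_gramVolume_pos h4.1] with ω hω
  exact (h3 _ hω).symm

end VertexModel

lemma measurable_simplexVolume {n r : ℕ} :
    Measurable (simplexVolume : (Fin (r + 1) → EuclideanSpace ℝ (Fin n)) → ℝ) := by
  have h : (simplexVolume : (Fin (r + 1) → EuclideanSpace ℝ (Fin n)) → ℝ) = fun x =>
      √(gramVolume x) * cornerVolume r := funext fun x => simplexVolume_eq x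
  rw [h]
  exact (Real.continuous_sqrt.measurable.comp measurable_gramVolume).mul_const _

namespace VertexModel

/-- The scale of the volume: the exponential of the center of its logarithm. -/
noncomputable def volumeScale (M : VertexModel) (n r : ℕ) : ℝ :=
  cornerVolume r * Real.exp (M.logMean n r / 2)

lemma volumeScale_pos (M : VertexModel) (n r : ℕ) : 0 < M.volumeScale n r :=
  mul_pos (cornerVolume_pos r) (Real.exp_pos _)

/-- The volume is a scale times the exponential of a multiple of its standardized logarithm. -/
lemma simplexVolume_eq_exp (M : VertexModel) {n r : ℕ} (hv : 0 < M.logVar n r)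
    {x : Fin (r + 1) → EuclideanSpace ℝ (Fin n)} (hx : 0 < gramVolume x) :
    simplexVolume x = M.volumeScale n r * Real.exp (√(M.logVar n r) / 2 * M.logScore x) := by
  have hs : √(M.logVar n r) ≠ 0 := (Real.sqrt_pos.2 hv).ne'
  rw [simplexVolume_eq, volumeScale, mul_assoc, ← Real.exp_add, mul_comm]
  congr 1
  rw [logScore, Real.sqrt_eq_rpow, Real.rpow_def_of_pos hx]
  congr 1
  field_simp
  ring

lemma limitVariance_zero (M : VertexModel) : M.limitVariance 0 = 0 := by
  cases M <;> simp [limitVariance]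

end VertexModel

/-- The difference quotient `(exp (s y) - 1) / s` of the exponential, extended by `y` at `s = 0`. -/
noncomputable def expQuotient (p : ℝ × ℝ) : ℝ := p.1 * dslope Real.exp 0 (p.2 * p.1)

lemma continuous_expQuotient : Continuous expQuotient := by
  have h : Continuous (dslope Real.exp 0) := by
    rw [← continuousOn_univ, continuousOn_dslope univ_mem]
    exact ⟨Real.continuous_exp.continuousOn, Real.differentiableAt_exp⟩
  unfold expQuotient
  fun_prop

lemma expQuotient_zero (y : ℝ) : expQuotient (y, 0) = y := by
  simp [expQuotient]

lemma expQuotient_of_ne_zero (y : ℝ) {s : ℝ} (hs : s ≠ 0) :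
    expQuotient (y, s) = (Real.exp (s * y) - 1) / s := by
  by_cases hy : y = 0
  · simp [expQuotient, hy]
  · rw [expQuotient, dslope_of_ne _ (mul_ne_zero hs hy), slope_def_field]
    simp
    field_simp

theorem mainTheorem1 (m : VertexModel) :
    (∃ a b : ℕ → ℕ → ℝ, (∀ n r, 0 < b n r) ∧
      ∀ r : ℕ → ℕ, (∀ n, 1 ≤ n → 1 ≤ r n ∧ r n ≤ n) →
        (fun n => (r n : ℝ)) =o[atTop] (fun n : ℕ => (n : ℝ)) →
        ∀ (Ω : ℕ → Type*) [∀ n, MeasurableSpace (Ω n)]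
          (P : ∀ n, Measure (Ω n)) [∀ n, IsProbabilityMeasure (P n)]
          (X : ∀ n, Fin (r n + 1) → Ω n → EuclideanSpace ℝ (Fin n)),
          IsVertexArray m r P X →
          ∀ (Ω' : Type*) [MeasurableSpace Ω'] (P' : Measure Ω') [IsProbabilityMeasure P']
            (Z : Ω' → ℝ), HasLaw Z (gaussianReal 0 1) P' →
            TendstoInDistribution
              (fun n ω => (simplexVolume (fun i => X n i ω) - a n (r n)) / b n (r n))
              atTop Z P P') ∧
    (∃ b : ℕ → ℕ → ℝ, (∀ n r, 0 < b n r) ∧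
      ∀ α : ℝ, 0 < α → α < 1 →
      ∀ r : ℕ → ℕ, (∀ n, 1 ≤ n → 1 ≤ r n ∧ r n ≤ n) →
        (fun n => (r n : ℝ)) ~[atTop] (fun n : ℕ => α * (n : ℝ)) →
        ∀ (Ω : ℕ → Type*) [∀ n, MeasurableSpace (Ω n)]
          (P : ∀ n, Measure (Ω n)) [∀ n, IsProbabilityMeasure (P n)]
          (X : ∀ n, Fin (r n + 1) → Ω n → EuclideanSpace ℝ (Fin n)),
          IsVertexArray m r P X →
          ∀ (Ω' : Type*) [MeasurableSpace Ω'] (P' : Measure Ω') [IsProbabilityMeasure P']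
            (Z : Ω' → ℝ), HasLaw Z (gaussianReal 0 1) P' →
            TendstoInDistribution
              (fun n ω => simplexVolume (fun i => X n i ω) / b n (r n))
              atTop (fun ω => Real.exp (√(m.limitVariance α) * Z ω)) P P') := by
  constructor
  -- `(volume - a) / b` is the difference quotient of the exponential at the standardized logarithm;
  -- the value `1` of `b` is used only where the scale vanishes, which happens for no large `n`
  · refine ⟨m.volumeScale, fun n r => if 0 < m.logVar n r then
      √(m.logVar n r) / 2 * m.volumeScale n r else 1, fun n r => ?_, ?_⟩
    · dsimp only
      split_ifs with h
      · exact mul_pos (half_pos (Real.sqrt_pos.2 h)) (m.volumeScale_pos n r)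
      · exact one_pos
    · intro r hr hrn Ω _ P _ X hX Ω' _ P' _ Z hZ
      have hr1 : ∀ᶠ n in atTop, 1 ≤ r n :=
        (eventually_ge_atTop 1).mono fun n hn => (hr n hn).1
      have hlim : Tendsto (fun n : ℕ => (r n : ℝ) / n) atTop (𝓝 0) := hrn.tendsto_div_nhds_zero
      have h := VertexModel.tendstoInDistribution_of_logScore hX zero_lt_one hr1 hlim hZ
        continuous_expQuotient (T := fun n x => (simplexVolume x - m.volumeScale n (r n)) /
          (if 0 < m.logVar n (r n) then √(m.logVar n (r n)) / 2 * m.volumeScale n (r n) else 1))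
        (fun n => (measurable_simplexVolume.sub_const _).div_const _) (by
          filter_upwards [m.eventually_logVar_pos zero_lt_one hr1 hlim] with n hn x hx
          have hs : √(m.logVar n (r n)) / 2 ≠ 0 := (half_pos (Real.sqrt_pos.2 hn)).ne'
          have hc := (m.volumeScale_pos n (r n)).ne'
          rw [if_pos hn, m.simplexVolume_eq_exp hn hx, expQuotient_of_ne_zero _ hs]
          field_simp)
      simpa only [m.limitVariance_zero, Real.sqrt_zero, expQuotient_zero] using h
  · refine ⟨m.volumeScale, m.volumeScale_pos, ?_⟩
    intro α hα0 hα1 r hr hrn Ω _ P _ X hX Ω' _ P' _ Z hZ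
    have hr1 : ∀ᶠ n in atTop, 1 ≤ r n :=
      (eventually_ge_atTop 1).mono fun n hn => (hr n hn).1
    have hlim : Tendsto (fun n : ℕ => (r n : ℝ) / n) atTop (𝓝 α) := by
      have hne : ∀ᶠ n : ℕ in atTop, α * (n : ℝ) ≠ 0 := by
        filter_upwards [eventually_gt_atTop 0] with n hn
        have : (n : ℝ) ≠ 0 := by exact_mod_cast hn.ne'
        exact mul_ne_zero hα0.ne' this
      have h1 := ((isEquivalent_iff_tendsto_one hne).1 hrn).const_mul α
      rw [mul_one] at h1
      refine h1.congr fun n => ?_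
      simp only [Pi.div_apply]
      field_simp
    exact VertexModel.tendstoInDistribution_of_logScore hX hα1 hr1 hlim hZ
      (H := fun p => Real.exp (p.2 * p.1)) (by fun_prop)
      (T := fun n x => simplexVolume x / m.volumeScale n (r n))
      (fun n => measurable_simplexVolume.div_const _) (by
        filter_upwards [m.eventually_logVar_pos hα1 hr1 hlim] with n hn x hx
        have hc := (m.volumeScale_pos n (r n)).ne'
        rw [m.simplexVolume_eq_exp hn hx, mul_div_cancel_left₀ _ hc])
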